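/- Let $p,\tilde p\in W_2^{-1}(0,1)$ and $q,\tilde q\in W_2^{-2}(0,1)$ be complex-valued distributions on $(0,1)$, and let $\tau_1,\tau_2,\tilde\tau_1,\tilde\tau_2\in L_2(0,1)$ be any complex-valued functions with $\tau_1'=p$, $\tau_2''=q$, $\tilde\tau_1'=\tilde p$, $\tilde\tau_2''=\tilde q$ in the sense of distributions. The differential expression $y^{(4)}-(py')'+qy$ is understood through the matrix $$F=[f_{k,j}]_{k,j=1}^4=\begin{pmatrix}0&1&0&0\\-\tau_2&\tau_1&1&0\\ \tau_1\tau_2&-\tau_1^2+2\tau_2&-\tau_1&1\\ \tau_2^2&-\tau_1\tau_2&-\tau_2&0\end{pmatrix}$$ and the quasi-derivatives $y^{[0]}=y$, $y^{[k]}=(y^{[k-1]})'-\sum_{j=1}^k f_{k,j}y^{[j-1]}$, $k=1,\dots,4$, for functions $y$ with $y^{[0]},\dots,y^{[3]}\in AC[0,1]$; for such $y$ one has $y^{(4)}-(py')'+qy=y^{[4]}$, and the equation is $y^{[4]}=\lambda y$ a.e. on $(0,1)$, with $\lambda\in\mathbb C$. Put $U_s(y)=y^{[4-s]}(0)$ and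 $V_s(y)=y^{[4-s]}(1)$, $s=1,\dots,4$. Let $C_k(x,\lambda)$, $k=1,\dots,4$, be the solutions with $U_s(C_k)=\delta_{s,k}$, $s=1,\dots,4$, and put $\Delta_{k,k}(\lambda)=\det[V_s(C_r)]_{s,r=k+1}^4$ (so $\Delta_{4,4}\equiv1$). For $(i,j)\in\{(1,2),(1,3),(2,3)\}$ let $\mathfrak S_{ij}$ be the spectrum of the boundary value problem $$y^{[4]}=\lambda y,\qquad U_i(y)=U_j(y)=0,\qquad V_3(y)=V_4(y)=0,$$ counted with algebraic multiplicities (dimensions of the root subspaces). Objects with a tilde are built in the same way from $\tilde\tau_1,\tilde\tau_2$. Assume the separation condition for both problems: for $m=1,2,3$ the functions $\Delta_{m,m}$ and $\Delta_{m+1,m+1}$ have no common zeros, and $\tilde\Delta_{m,m}$ and $\tilde\Delta_{m+1,m+1}$ have no common zeros. If $\mathfrak S_{12}=\tilde{\mathfrak S}_{12}$, $\mathfrak S_{13}=\tilde{\mathfrak S}_{13}$ and $\mathfrak S_{23}=\tilde{\mathfrak S}_{23}$ (with multiplicities), then $p=\tilde p$ in $W_2^{-1}(0,1)$ and $q=\tilde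 q$ in $W_2^{-2}(0,1)$. -/

import Mathlib

open MeasureTheory Set TopologicalSpace
open scoped Distributions LineDeriv

noncomputable section

namespace FourthOrder

/-- The open interval `(0, 1)`. -/
def unitIoo : Opens ℝ := ⟨Ioo 0 1, isOpen_Ioo⟩

/-- The regular distribution `φ ↦ ∫ φ f` on `(0, 1)` of a (locally integrable) function `f`. -/
def regularDistribution (f : ℝ → ℂ) : 𝓓'(unitIoo, ℂ) :=
  (TestFunction.integralAgainstBilinCLM (ContinuousLinearMap.lsmul ℝ ℝ) volume f :
    𝓓(unitIoo, ℝ) →L[ℝ] ℂ)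

/-- `τ₁, τ₂ ∈ L₂(0,1)` with `τ₁' = p` and `τ₂'' = q` in the sense of distributions on `(0, 1)`.
A distribution `p` lies in `W_2^{-1}(0,1)`, respectively `q` lies in `W_2^{-2}(0,1)`, exactly when
such `τ₁`, respectively `τ₂`, exists. -/
structure IsRegularization (p q : 𝓓'(unitIoo, ℂ)) (τ₁ τ₂ : ℝ → ℂ) : Prop where
  memLp_τ₁ : MemLp τ₁ 2 (volume.restrict (Ioo 0 1))
  memLp_τ₂ : MemLp τ₂ 2 (volume.restrict (Ioo 0 1))
  deriv_τ₁ : ∂_{(1 : ℝ)} (regularDistribution τ₁) = p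
  deriv_deriv_τ₂ : ∂_{(1 : ℝ)} (∂_{(1 : ℝ)} (regularDistribution τ₂)) = q

/-- The matrix associated with the differential expression `y'''' - (p y')' + q y`. -/
def assocMatrix (τ₁ τ₂ : ℝ → ℂ) (x : ℝ) : Matrix (Fin 4) (Fin 4) ℂ :=
  !![0, 1, 0, 0;
     -τ₂ x, τ₁ x, 1, 0;
     τ₁ x * τ₂ x, -τ₁ x ^ 2 + 2 * τ₂ x, -τ₁ x, 1;
     τ₂ x ^ 2, -(τ₁ x * τ₂ x), -τ₂ x, 0]

/-- `Y 0, …, Y 4` are the quasi-derivatives `y^{[0]} = y, …, y^{[4]}` of the function `y = Y 0`,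
which lies in the domain: `y^{[0]}, …, y^{[3]}` are absolutely continuous on `[0, 1]` and
`y^{[k]} = (y^{[k-1]})' - ∑_{j=1}^{k} f_{k,j} y^{[j-1]}` almost everywhere on `(0, 1)`,
`k = 1, …, 4`. Here `k` and `j` are shifted by one, since matrix indices start from zero.
(The entries `Y k` with `k ≥ 5` play no role.) The distribution `y'''' - (p y')' + q y` is then the
regular one of `y^{[4]} = Y 4`. -/
def IsQuasiDerivs (τ₁ τ₂ : ℝ → ℂ) (Y : ℕ → ℝ → ℂ) : Prop :=
  ∀ k : Fin 4, AbsolutelyContinuousOnInterval (Y k) 0 1 ∧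
    ∀ᵐ x ∂(volume.restrict (Ioo (0 : ℝ) 1)),
      HasDerivAt (Y k) (Y (k + 1) x + ∑ j : Fin 4 with j ≤ k, assocMatrix τ₁ τ₂ x k j * Y j x) x

/-- The linear forms `U_s(y) = y^{[4-s]}(0)`, `s = 1, …, 4`. -/
def U (s : ℕ) (Y : ℕ → ℝ → ℂ) : ℂ := Y (4 - s) 0

/-- The linear forms `V_s(y) = y^{[4-s]}(1)`, `s = 1, …, 4`. -/
def V (s : ℕ) (Y : ℕ → ℝ → ℂ) : ℂ := Y (4 - s) 1

/-- `y = Y 0` is a solution of `y^{[4]} = μ y` on `(0, 1)` (with quasi-derivatives `Y k`). -/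
def IsSolution (τ₁ τ₂ : ℝ → ℂ) (μ : ℂ) (Y : ℕ → ℝ → ℂ) : Prop :=
  IsQuasiDerivs τ₁ τ₂ Y ∧ ∀ᵐ x ∂(volume.restrict (Ioo (0 : ℝ) 1)), Y 4 x = μ * Y 0 x

/-- The solution `C_k(·, μ)`, together with its quasi-derivatives, of the initial value problem
`U_s(C_k) = δ_{s,k}`, `s = 1, …, 4`. It exists, and the values of `y^{[0]}, …, y^{[3]}` on `[0, 1]`
are unique, as this is the initial value problem for a linear first-order system with integrable
coefficients. -/
def C (τ₁ τ₂ : ℝ → ℂ) (k : ℕ) (μ : ℂ) : ℕ → ℝ → ℂ :=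
  Classical.epsilon fun Y =>
    IsSolution τ₁ τ₂ μ Y ∧ ∀ s ∈ Finset.Icc 1 4, U s Y = if s = k then 1 else 0

/-- `Δ_{k,k}(μ) = det [V_s(C_r)]_{s,r = k+1}^{4}`; in particular `Δ_{4,4} = 1`. -/
def Delta (τ₁ τ₂ : ℝ → ℂ) (k : ℕ) (μ : ℂ) : ℂ :=
  Matrix.det (Matrix.of fun s r : Fin (4 - k) => V (k + 1 + s) (C τ₁ τ₂ (k + 1 + r) μ))

/-- The separation assumption: `Δ_{m,m}` and `Δ_{m+1,m+1}` have no common zeros, `m = 1, 2, 3`. -/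
def Separated (τ₁ τ₂ : ℝ → ℂ) : Prop :=
  ∀ m ∈ Finset.Icc 1 3, ∀ μ : ℂ, ¬ (Delta τ₁ τ₂ m μ = 0 ∧ Delta τ₁ τ₂ (m + 1) μ = 0)

/-- `IsRootFunction τ₁ τ₂ i j μ m y`: `(L - μ)^m y = 0` on `[0, 1]`, where `L y = y^{[4]}` is the
operator with the boundary conditions `U_i(y) = U_j(y) = 0`, `V_3(y) = V_4(y) = 0`. For `m = 1`
these are the eigenfunctions for `μ` and zero; for general `m` the eigenfunctions and associated
functions of chains of length at most `m`, with their linear combinations. -/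
def IsRootFunction (τ₁ τ₂ : ℝ → ℂ) (i j : ℕ) (μ : ℂ) : ℕ → (ℝ → ℂ) → Prop
  | 0, y => ∀ x ∈ Icc (0 : ℝ) 1, y x = 0
  | m + 1, y => ∃ Y : ℕ → ℝ → ℂ, IsQuasiDerivs τ₁ τ₂ Y ∧ (∀ x ∈ Icc (0 : ℝ) 1, Y 0 x = y x) ∧
      U i Y = 0 ∧ U j Y = 0 ∧ V 3 Y = 0 ∧ V 4 Y = 0 ∧
      ∃ z : ℝ → ℂ, IsRootFunction τ₁ τ₂ i j μ m z ∧
        ∀ᵐ x ∂(volume.restrict (Ioo (0 : ℝ) 1)), Y 4 x = μ * y x + z x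

/-- The root subspace `⋃ₘ ker (L - μ)^m`, as a space of functions on `[0, 1]`. (The set under `span`
is already a linear subspace.) -/
def rootSpace (τ₁ τ₂ : ℝ → ℂ) (i j : ℕ) (μ : ℂ) : Submodule ℂ (Icc (0 : ℝ) 1 → ℂ) :=
  Submodule.span ℂ {f | ∃ m y, IsRootFunction τ₁ τ₂ i j μ m y ∧ f = (Icc (0 : ℝ) 1).domRestrict y}

/-- The spectrum `𝔖_{ij}` of the problem `y^{[4]} = μ y`, `U_i(y) = U_j(y) = 0`,
`V_3(y) = V_4(y) = 0`, counted with multiplicities, as the function which sends `μ` to its algebraic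
multiplicity as an eigenvalue (zero if `μ` is not an eigenvalue). -/
def spec (τ₁ τ₂ : ℝ → ℂ) (i j : ℕ) (μ : ℂ) : Cardinal :=
  Module.rank ℂ (rootSpace τ₁ τ₂ i j μ)

end FourthOrder

end

/-! In the vector of quasi-derivatives the equation is a first-order system `Y' = (F + λE) Y`, where
`E` has a single unit in the lower left corner. The coefficient matrix `A = F + λE` satisfies `S Aᵀ
S = A` for a skew antidiagonal matrix `S`, so a skew form is conserved and the fundamental matrix
`M(x, λ)`, `M(0, λ) = 1`, is symplectic. The conditions at `1` enter only through the 2×2 minors of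
the first two rows of `M(1, λ)`. The characteristic function of the problem with `U_i = U_j = 0` is
the minor on the two columns that these conditions leave free, and algebraic multiplicity is the
order of its zero (`spec_eq_analyticOrderAt`). The three spectra therefore give the zeros of the
minors 10, 20 and 30.

On the ray `λ = -4r⁴` the exponents `r(±1 ± i)` split into two growing and two decaying ones, with
gap `2r`. For merely integrable coefficients a dichotomy (`exists_dichotomy`) shows that the initial
vectors of the solutions satisfying the conditions at `1`, called decaying, form a plane close to
that of the decaying exponentials. Hence suitably scaled ratios of minors have limits independent of
the coefficients (`tendsto_minor_ratios`). The minors are entire and bounded by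
`exp(C(1+|λ|)^{1/4})`. An entire quotient of such functions has the same growth, and if it converges
along one ray it is constant, by Phragmén–Lindelöf and Liouville (`eq_const_mul_of_tendsto_ray`). So
the ratios 20/10 and 30/10 agree for both problems. No spectrum controls the minor 31. But
symplecticity gives 21 = 30, and the Plücker relation then determines 31 wherever 20 does not
vanish. Separation ensures this at the zeros of 10, so the difference of the two ratios 31/10 is
entire; it tends to zero on the ray, hence is zero (`proportionalMinors`). Both problems thus have
the same decaying plane for large `r`.

Let `P = M M̃⁻¹`. Equality of the decaying planes, together with their isotropy, bounds `P` on the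
ray in coordinates along the exponents (`exists_norm_rootCoord_le`). The entries of its first row in
column `j ≠ 0` are then `O(r^{-j})`, and being entire of quarter growth they vanish
(`transMatrix_fst_row`). Inserted into `P' = F P - P F̃` at `λ = 0`, this makes `P` lower triangular
with unit diagonal and forces `τ₁ - τ̃₁` to be constant and `τ₂ - τ̃₂` to be affine
(`coefficients_eq`), which is invisible to the first and second distributional derivative,
respectively. -/

open scoped Topology

noncomputable section

namespace FourthOrder

/-! ### Absolutely continuous functions and their derivatives -/

section ACDeriv

variable {F : Type*} [NormedAddCommGroup F] [NormedSpace ℝ F]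

/-- `f` is absolutely continuous on `[0, 1]` with derivative `f'` almost everywhere. -/
def HasACDeriv (f f' : ℝ → F) : Prop :=
  AbsolutelyContinuousOnInterval f 0 1 ∧
    ∀ᵐ x ∂(volume.restrict (Ioo (0 : ℝ) 1)), HasDerivAt f (f' x) x

theorem ae_Ioo_iff {P : ℝ → Prop} :
    (∀ᵐ x ∂(volume.restrict (Ioo (0 : ℝ) 1)), P x) ↔ ∀ᵐ x, x ∈ uIcc (0 : ℝ) 1 → P x := by
  rw [Measure.restrict_congr_set Ioo_ae_eq_Icc, uIcc_of_le zero_le_one,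
    ae_restrict_iff' measurableSet_Icc]

theorem absolutelyContinuous_congr {F : Type*} [NormedAddCommGroup F] {f g : ℝ → F} {a b : ℝ}
    (hf : AbsolutelyContinuousOnInterval f a b) (h : EqOn f g (uIcc a b)) :
    AbsolutelyContinuousOnInterval g a b := by
  rw [absolutelyContinuousOnInterval_iff] at hf ⊢
  intro ε hε
  obtain ⟨δ, hδ, H⟩ := hf ε hε
  refine ⟨δ, hδ, fun E hE hE' => ?_⟩
  convert H E hE hE' using 1
  refine Finset.sum_congr rfl fun i hi => ?_
  rw [h (hE.1 i hi).1, h (hE.1 i hi).2]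

namespace HasACDeriv

variable {f g f' g' : ℝ → F}

theorem continuousOn (hf : HasACDeriv f f') : ContinuousOn f (Icc 0 1) := by
  simpa [uIcc_of_le (zero_le_one' ℝ)] using hf.1.continuousOn

theorem congr_deriv (hf : HasACDeriv f f')
    (h : ∀ᵐ x ∂(volume.restrict (Ioo (0 : ℝ) 1)), f' x = g' x) : HasACDeriv f g' :=
  ⟨hf.1, by filter_upwards [hf.2, h] with x hx h; rwa [← h]⟩

theorem congr (hf : HasACDeriv f f') (h : EqOn f g (Icc 0 1)) : HasACDeriv g f' := by
  refine ⟨absolutelyContinuous_congr hf.1 (by rwa [uIcc_of_le (zero_le_one' ℝ)]), ?_⟩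
  filter_upwards [hf.2, ae_restrict_mem measurableSet_Ioo] with x hx hx'
  exact hx.congr_of_eventuallyEq
    ((h.mono Ioo_subset_Icc_self).symm.eventuallyEq_of_mem (Ioo_mem_nhds hx'.1 hx'.2))

theorem const (c : F) : HasACDeriv (fun _ => c) (fun _ => 0) :=
  ⟨(contDiff_const (n := 1)).contDiffOn.absolutelyContinuousOnInterval, by
    filter_upwards with x using hasDerivAt_const x c⟩

theorem add (hf : HasACDeriv f f') (hg : HasACDeriv g g') :
    HasACDeriv (fun x => f x + g x) (fun x => f' x + g' x) :=
  ⟨hf.1.fun_add hg.1, by filter_upwards [hf.2, hg.2] with x h1 h2 using h1.add h2⟩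

theorem sub (hf : HasACDeriv f f') (hg : HasACDeriv g g') :
    HasACDeriv (fun x => f x - g x) (fun x => f' x - g' x) :=
  ⟨hf.1.fun_sub hg.1, by filter_upwards [hf.2, hg.2] with x h1 h2 using h1.sub h2⟩

theorem sum {ι : Type*} (s : Finset ι) {f f' : ι → ℝ → F} (h : ∀ i ∈ s, HasACDeriv (f i) (f' i)) :
    HasACDeriv (fun x => ∑ i ∈ s, f i x) (fun x => ∑ i ∈ s, f' i x) := by
  classical
  induction s using Finset.induction_on with
  | empty => simpa using const (0 : F)
  | insert a s ha ih =>
    simp only [Finset.sum_insert ha]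
    exact (h a (by simp)).add (ih fun i hi => h i (by simp [hi]))

theorem mul {A : Type*} [NormedField A] [NormedAlgebra ℝ A] {f g f' g' : ℝ → A}
    (hf : HasACDeriv f f') (hg : HasACDeriv g g') :
    HasACDeriv (fun x => f x * g x) (fun x => f' x * g x + f x * g' x) :=
  ⟨hf.1.fun_smul hg.1, by filter_upwards [hf.2, hg.2] with x h1 h2 using h1.mul h2⟩

theorem const_mul {A : Type*} [NormedField A] [NormedAlgebra ℝ A] {f f' : ℝ → A} (c : A)
    (hf : HasACDeriv f f') :
    HasACDeriv (fun x => c * f x) (fun x => c * f' x) := by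
  simpa using (const c).mul hf

theorem of_contDiff {f f' : ℝ → F} (hf : ContDiff ℝ 1 f) (h : ∀ x, HasDerivAt f (f' x) x) :
    HasACDeriv f f' :=
  ⟨hf.contDiffOn.absolutelyContinuousOnInterval, by filter_upwards with x using h x⟩

theorem comp_contDiff {b b' : ℝ → ℝ} (hb : HasACDeriv b b') {φ φ' : ℝ → F}
    (hφ : ContDiff ℝ 1 φ) (h : ∀ x, HasDerivAt φ (φ' x) x) :
    HasACDeriv (fun x => φ (b x)) (fun x => b' x • φ' (b x)) := by
  refine ⟨?_, by filter_upwards [hb.2] with x hx using (h (b x)).scomp x hx⟩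
  -- An absolutely continuous `b` is bounded, and `φ` is Lipschitz on a compact interval; so the
  -- increments of the composition are controlled by those of `b`.
  obtain ⟨C, hC⟩ := hb.1.exists_bound
  obtain ⟨K, hK⟩ := (hφ.contDiffOn (s := Icc (-C) C)).exists_lipschitzOnWith (by decide)
    (convex_Icc _ _) isCompact_Icc
  have key := hb.1
  rw [absolutelyContinuousOnInterval_iff] at key ⊢
  intro ε hε
  obtain ⟨δ, hδ, H⟩ := key (ε / (K + 1)) (by positivity)
  refine ⟨δ, hδ, fun E hE hE' => ?_⟩
  have h1 := H E hE hE'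
  rw [lt_div_iff₀ (by positivity)] at h1
  refine lt_of_le_of_lt ?_ h1
  rw [Finset.sum_mul]
  refine Finset.sum_le_sum fun i hi => ?_
  have m1 := abs_le.1 (hC _ (hE.1 i hi).1)
  have m2 := abs_le.1 (hC _ (hE.1 i hi).2)
  refine (hK.dist_le_mul _ ⟨m1.1, m1.2⟩ _ ⟨m2.1, m2.2⟩).trans ?_
  nlinarith [dist_nonneg (x := b (E.2 i).1) (y := b (E.2 i).2)]

theorem eq_of_deriv_zero (hf : HasACDeriv f (fun _ => 0)) {x : ℝ} (hx : x ∈ Icc (0 : ℝ) 1) :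
    f x = f 0 := by
  obtain ⟨C, hC⟩ := hf.1.const_of_ae_hasDerivAt_zero (ae_Ioo_iff.1 hf.2)
  rw [uIcc_of_le zero_le_one] at hC
  rw [hC x hx, hC 0 (by simp)]

variable [CompleteSpace F]

theorem of_integral (hf' : IntervalIntegrable f' volume 0 1) (c : F) {s : ℝ}
    (hs : s ∈ Icc (0 : ℝ) 1) :
    HasACDeriv (fun x => c + ∫ t in s..x, f' t) f' := by
  have hs' : s ∈ uIcc (0 : ℝ) 1 := by rwa [uIcc_of_le zero_le_one]
  constructor
  -- The increments of the vector-valued integral are dominated by those of the integral of the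
  -- norm.
  · have h := hf'.norm.absolutelyContinuousOnInterval_intervalIntegral hs'
    rw [absolutelyContinuousOnInterval_iff] at h ⊢
    intro ε hε
    obtain ⟨δ, hδ, H⟩ := h ε hε
    refine ⟨δ, hδ, fun E hE hE' => lt_of_le_of_lt (Finset.sum_le_sum fun i hi => ?_) (H E hE hE')⟩
    have h0 : ∀ y ∈ uIcc (0 : ℝ) 1, IntervalIntegrable f' volume s y := fun y hy =>
      hf'.mono_set (uIcc_subset_uIcc hs' hy)
    have e1 := (hE.1 i hi).1
    have e2 := (hE.1 i hi).2
    rw [dist_add_left, dist_eq_norm, dist_eq_norm,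
      intervalIntegral.integral_interval_sub_left (h0 _ e1) (h0 _ e2),
      intervalIntegral.integral_interval_sub_left (h0 _ e1).norm (h0 _ e2).norm]
    exact intervalIntegral.norm_integral_le_abs_integral_norm
  · rw [ae_Ioo_iff]
    filter_upwards [hf'.ae_hasDerivAt_integral] with x hx hx'
    exact (hx hx' s hs').const_add c

theorem integral_eq (hf : HasACDeriv f f') (hf' : IntervalIntegrable f' volume 0 1) {a b : ℝ}
    (ha : a ∈ Icc (0 : ℝ) 1) (hb : b ∈ Icc (0 : ℝ) 1) : ∫ t in a..b, f' t = f b - f a := by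
  have h := (hf.sub (of_integral hf' 0 ha)).congr_deriv (g' := fun _ => 0) (by simp)
  have h1 := h.eq_of_deriv_zero hb
  have h2 := h.eq_of_deriv_zero ha
  rw [← h2] at h1
  simp at h1
  rw [← h1]; abel

end HasACDeriv

theorem HasACDeriv.antitone {f f' : ℝ → ℝ} (hf : HasACDeriv f f')
    (hf' : IntervalIntegrable f' volume 0 1) {a b : ℝ} (ha : 0 ≤ a) (hab : a ≤ b) (hb : b ≤ 1)
    (h : ∀ x ∈ Icc a b, f' x ≤ 0) : f b ≤ f a := by
  have := hf.integral_eq hf' ⟨ha, hab.trans hb⟩ ⟨ha.trans hab, hb⟩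
  have h2 : ∫ t in a..b, f' t ≤ 0 := by
    rw [intervalIntegral.integral_of_le hab]
    exact setIntegral_nonpos measurableSet_Ioc fun x hx => h x ⟨hx.1.le, hx.2⟩
  linarith

end ACDeriv

/-! ### Gronwall inequalities with an integrable weight -/

theorem intervalIntegrable_sub {F : Type*} [NormedAddCommGroup F] {f : ℝ → F}
    (hf : IntervalIntegrable f volume 0 1) {a b : ℝ} (ha : a ∈ Icc (0 : ℝ) 1)
    (hb : b ∈ Icc (0 : ℝ) 1) : IntervalIntegrable f volume a b :=
  hf.mono_set (uIcc_subset_uIcc (by rwa [uIcc_of_le zero_le_one])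
    (by rwa [uIcc_of_le zero_le_one]))

theorem integral_mono_right {β : ℝ → ℝ} (hβ : IntervalIntegrable β volume 0 1)
    (hβ0 : ∀ x, 0 ≤ β x) {a b : ℝ} (ha : 0 ≤ a) (hab : a ≤ b) (hb : b ≤ 1) :
    ∫ t in a..b, β t ≤ ∫ t in (0 : ℝ)..1, β t :=
  intervalIntegral.integral_mono_interval ha hab hb (by filter_upwards with x using hβ0 x) hβ

theorem intervalIntegrable_mul_continuousOn {β f : ℝ → ℝ} (hβ : IntervalIntegrable β volume 0 1)
    (hf : ContinuousOn f (Icc 0 1)) : IntervalIntegrable (fun t => β t * f t) volume 0 1 :=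
  hβ.mul_continuousOn (by rwa [uIcc_of_le zero_le_one])

/-- The function `(a + ∫ β f) exp (-∫ β)`, with integrals from `s`, is nonincreasing. The exponent
is taken over all of `[0, 1]` to have a bound independent of `s` and `x`. -/
theorem gronwall_forward {f β : ℝ → ℝ} (hf : ContinuousOn f (Icc 0 1))
    (hβ : IntervalIntegrable β volume 0 1) (hβ0 : ∀ x, 0 ≤ β x) {a s x : ℝ} (ha : 0 ≤ a)
    (hs : 0 ≤ s) (h : ∀ y ∈ Icc s 1, f y ≤ a + ∫ t in s..y, β t * f t) (hx : x ∈ Icc s 1) :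
    f x ≤ a * Real.exp (∫ t in (0 : ℝ)..1, β t) := by
  have hs1 : s ≤ 1 := hx.1.trans hx.2
  have hsm : s ∈ Icc (0 : ℝ) 1 := ⟨hs, hs1⟩
  have hxm : x ∈ Icc (0 : ℝ) 1 := ⟨hs.trans hx.1, hx.2⟩
  have hβf := intervalIntegrable_mul_continuousOn hβ hf
  have h1 := HasACDeriv.of_integral hβf a hsm
  have h2 := HasACDeriv.of_integral hβ 0 hsm
  have h3 := h2.comp_contDiff (φ := fun y => Real.exp (-y)) (φ' := fun y => -Real.exp (-y))
    (by fun_prop) (fun y => by simpa using ((hasDerivAt_id y).neg.exp))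
  have h4 := h1.mul h3
  have key := h4.antitone ?_ hs hx.1 hx.2 fun y hy => ?_
  · simp only [zero_add, intervalIntegral.integral_same, add_zero, neg_zero, Real.exp_zero,
      mul_one] at key
    rw [Real.exp_neg, ← div_eq_mul_inv, div_le_iff₀ (Real.exp_pos _)] at key
    refine (h x hx).trans (key.trans ?_)
    gcongr
    exact integral_mono_right hβ hβ0 hs hx.1 hx.2
  · refine (hβf.mul_continuousOn ?_).add ?_
    · rw [uIcc_of_le zero_le_one]; exact h3.continuousOn
    · simp only [smul_eq_mul]
      refine IntervalIntegrable.continuousOn_mul (hβ.mul_continuousOn ?_) ?_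
      · rw [uIcc_of_le zero_le_one]; exact h3.continuousOn.neg
      · rw [uIcc_of_le zero_le_one]; exact h1.continuousOn
  · have e := h y ⟨hy.1, hy.2.trans hx.2⟩
    have : β y * f y ≤ β y * (a + ∫ t in s..y, β t * f t) := mul_le_mul_of_nonneg_left e (hβ0 y)
    simp only [smul_eq_mul]
    nlinarith [Real.exp_pos (-(0 + ∫ t in s..y, β t))]

/-- Reflection `t ↦ 1 - t` of the forward inequality. -/
theorem gronwall_backward {f β : ℝ → ℝ} (hf : ContinuousOn f (Icc 0 1))
    (hβ : IntervalIntegrable β volume 0 1) (hβ0 : ∀ x, 0 ≤ β x) {a s x : ℝ} (ha : 0 ≤ a)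
    (hs : s ≤ 1) (h : ∀ y ∈ Icc 0 s, f y ≤ a + ∫ t in y..s, β t * f t) (hx : x ∈ Icc 0 s) :
    f x ≤ a * Real.exp (∫ t in (0 : ℝ)..1, β t) := by
  have h0 : IntervalIntegrable (fun t => β (1 - t)) volume 0 1 := by
    simpa using (hβ.comp_sub_left 1).symm
  have key := gronwall_forward (f := fun t => f (1 - t)) (β := fun t => β (1 - t)) (a := a)
    (s := 1 - s) (x := 1 - x) (hf.comp (by fun_prop) fun y hy => ⟨by linarith [hy.2],
      by linarith [hy.1]⟩) h0 (fun y => hβ0 _) ha (by linarith) (fun y hy => ?_)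
    ⟨by linarith [hx.2], by linarith [hx.1]⟩
  · rw [intervalIntegral.integral_comp_sub_left (fun t => β t) 1] at key
    simpa using key
  · rw [intervalIntegral.integral_comp_sub_left (fun t => β t * f t) 1]
    simpa using h (1 - y) ⟨by linarith [hy.2], by linarith [hy.1]⟩

end FourthOrder

/-! ### Linear systems with integrable coefficients as Volterra equations -/

namespace FourthOrder

/-- The factor `1 - K` of `1 - K ^ n` commutes with the other factor, a geometric sum. Powers of a
Volterra operator become small even if its own norm is large. -/
theorem isUnit_one_sub_of_norm_pow_lt_one {X : Type*} [NormedAddCommGroup X] [NormedSpace ℂ X]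
    [CompleteSpace X] (K : X →L[ℂ] X) (n : ℕ) (h : ‖K ^ n‖ < 1) : IsUnit (1 - K) := by
  have h2 : IsUnit (1 - K ^ n) := isUnit_one_sub_of_norm_lt_one h
  have e1 := mul_neg_geom_sum K n
  have e2 := geom_sum_mul_neg K n
  rw [isUnit_iff_exists_and_exists]
  obtain ⟨u, hu⟩ := h2
  refine ⟨⟨(∑ i ∈ Finset.range n, K ^ i) * ↑u⁻¹, ?_⟩, ⟨↑u⁻¹ * (∑ i ∈ Finset.range n, K ^ i), ?_⟩⟩
  · rw [← mul_assoc, e1, ← hu, Units.mul_inv]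
  · rw [mul_assoc, e2, ← hu, Units.inv_mul]

section LinearSystem

variable {ι : Type*} [Fintype ι]

/-- The sum of the absolute values of the entries of the coefficient matrix. -/
def entrySum (A : ℝ → Matrix ι ι ℂ) (x : ℝ) : ℝ := ∑ i, ∑ j, ‖A x i j‖

def IntegrableEntries (A : ℝ → Matrix ι ι ℂ) : Prop :=
  ∀ i j, IntervalIntegrable (fun x => A x i j) volume 0 1

theorem entrySum_nonneg (A : ℝ → Matrix ι ι ℂ) (x : ℝ) : 0 ≤ entrySum A x := by
  unfold entrySum; positivity

theorem IntegrableEntries.entrySum {A : ℝ → Matrix ι ι ℂ} (hA : IntegrableEntries A) :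
    IntervalIntegrable (entrySum A) volume 0 1 := by
  have := IntervalIntegrable.sum Finset.univ fun i _ =>
    IntervalIntegrable.sum Finset.univ fun j _ => (hA i j).norm
  refine this.congr fun x _ => ?_
  simp [FourthOrder.entrySum]

theorem norm_mulVec_le_entrySum (A : ℝ → Matrix ι ι ℂ) (x : ℝ) (v : ι → ℂ) :
    ‖(A x).mulVec v‖ ≤ entrySum A x * ‖v‖ := by
  rw [pi_norm_le_iff_of_nonneg (mul_nonneg (entrySum_nonneg A x) (norm_nonneg v))]
  intro i
  calc ‖(A x).mulVec v i‖ ≤ ∑ j, ‖A x i j * v j‖ := norm_sum_le _ _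
    _ ≤ ∑ j, ‖A x i j‖ * ‖v‖ := by
        refine Finset.sum_le_sum fun j _ => ?_
        rw [norm_mul]
        gcongr
        exact norm_le_pi_norm v j
    _ = (∑ j, ‖A x i j‖) * ‖v‖ := by rw [Finset.sum_mul]
    _ ≤ entrySum A x * ‖v‖ := by
        gcongr
        exact Finset.single_le_sum (f := fun i => ∑ j, ‖A x i j‖)
          (fun _ _ => Finset.sum_nonneg fun _ _ => norm_nonneg _) (Finset.mem_univ i)

theorem IntegrableEntries.mulVec_apply {A : ℝ → Matrix ι ι ℂ} (hA : IntegrableEntries A)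
    {Y : ℝ → ι → ℂ} (hY : ∀ j, ContinuousOn (fun x => Y x j) (Icc 0 1)) (i : ι) :
    IntervalIntegrable (fun x => (A x).mulVec (Y x) i) volume 0 1 := by
  have := IntervalIntegrable.sum Finset.univ fun j _ =>
    (hA i j).mul_continuousOn (g := fun x => Y x j)
      (by rw [uIcc_of_le zero_le_one]; exact hY j)
  refine this.congr fun x _ => ?_
  simp [Matrix.mulVec, dotProduct]

theorem IntegrableEntries.mulVec {A : ℝ → Matrix ι ι ℂ} (hA : IntegrableEntries A)
    {Y : ℝ → ι → ℂ} (hY : ∀ j, ContinuousOn (fun x => Y x j) (Icc 0 1)) :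
    IntervalIntegrable (fun x => (A x).mulVec (Y x)) volume 0 1 := by
  rw [intervalIntegrable_iff]
  exact Integrable.of_eval fun i => intervalIntegrable_iff.1 (hA.mulVec_apply hY i)

/-- `Y' = A Y + h` almost everywhere, with `Y` absolutely continuous. -/
def IsLinearSol (A : ℝ → Matrix ι ι ℂ) (h Y : ℝ → ι → ℂ) : Prop :=
  ∀ i, HasACDeriv (fun x => Y x i) (fun x => (A x).mulVec (Y x) i + h x i)

theorem IsLinearSol.continuousOn {A : ℝ → Matrix ι ι ℂ} {h Y : ℝ → ι → ℂ}
    (hY : IsLinearSol A h Y) : ContinuousOn Y (Icc 0 1) :=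
  continuousOn_pi.2 fun i => (hY i).continuousOn

theorem IsLinearSol.norm_le {A : ℝ → Matrix ι ι ℂ} (hA : IntegrableEntries A)
    {Y : ℝ → ι → ℂ} (hY : IsLinearSol A (fun _ => 0) Y) {x : ℝ} (hx : x ∈ Icc (0 : ℝ) 1) :
    ‖Y x‖ ≤ ‖Y 0‖ * Real.exp (∫ t in (0 : ℝ)..1, entrySum A t) := by
  have hint := hA.mulVec (fun j => (hY j).continuousOn)
  refine gronwall_forward hY.continuousOn.norm hA.entrySum (entrySum_nonneg A) (norm_nonneg _)
    le_rfl (fun y hy => ?_) hx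
  have hz : (0 : ℝ) ∈ Icc (0 : ℝ) 1 := by simp
  have hcalc : Y y = Y 0 + ∫ t in (0 : ℝ)..y, (A t).mulVec (Y t) := by
    ext i
    have e1 := (hY i).integral_eq (by simpa using hA.mulVec_apply (fun j => (hY j).continuousOn) i)
      hz hy
    have e2 := (ContinuousLinearMap.proj (R := ℂ) (φ := fun _ : ι => ℂ) i).intervalIntegral_comp_comm
      (intervalIntegrable_sub hint hz hy)
    simp only [ContinuousLinearMap.proj_apply] at e2
    simp only [Pi.zero_apply, add_zero] at e1
    rw [Pi.add_apply, ← e2, e1]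
    ring
  have hle : ‖∫ t in (0 : ℝ)..y, (A t).mulVec (Y t)‖ ≤
      ∫ t in (0 : ℝ)..y, entrySum A t * ‖Y t‖ := by
    refine intervalIntegral.norm_integral_le_of_norm_le hy.1 ?_ ?_
    · filter_upwards with t _ using norm_mulVec_le_entrySum A t (Y t)
    · exact intervalIntegrable_sub
        (intervalIntegrable_mul_continuousOn hA.entrySum hY.continuousOn.norm) hz hy
  rw [hcalc]
  exact (norm_add_le _ _).trans (by gcongr)

theorem IsLinearSol.eq_of_zero {A : ℝ → Matrix ι ι ℂ} (hA : IntegrableEntries A)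
    {h Y Z : ℝ → ι → ℂ} (hY : IsLinearSol A h Y) (hZ : IsLinearSol A h Z) (h0 : Y 0 = Z 0)
    {x : ℝ} (hx : x ∈ Icc (0 : ℝ) 1) : Y x = Z x := by
  have hD : IsLinearSol A (fun _ => 0) (fun x => Y x - Z x) := fun i =>
    ((hY i).sub (hZ i)).congr_deriv <| by
      filter_upwards with x
      simp only [Matrix.mulVec_sub, Pi.sub_apply, Pi.zero_apply]; ring
  have := hD.norm_le hA hx
  rw [h0, sub_self, norm_zero, zero_mul] at this
  exact sub_eq_zero.1 (norm_le_zero_iff.1 this)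

/-- The extension of a continuous function on `[0, 1]` to the real line. -/
abbrev ext01 {ι : Type*} (f : C(Icc (0 : ℝ) 1, ι → ℂ)) : ℝ → ι → ℂ := IccExtend zero_le_one f

theorem continuous_ext01 {ι : Type*} (f : C(Icc (0 : ℝ) 1, ι → ℂ)) : Continuous (ext01 f) :=
  f.continuous.Icc_extend'

theorem norm_ext01_le (f : C(Icc (0 : ℝ) 1, ι → ℂ)) (x : ℝ) : ‖ext01 f x‖ ≤ ‖f‖ :=
  f.norm_coe_le_norm _

theorem intervalIntegrable_mulVec_ext01 {A : ℝ → Matrix ι ι ℂ} (hA : IntegrableEntries A)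
    (f : C(Icc (0 : ℝ) 1, ι → ℂ)) :
    IntervalIntegrable (fun t => (A t).mulVec (ext01 f t)) volume 0 1 :=
  hA.mulVec fun j => ((continuous_apply j).comp (continuous_ext01 f)).continuousOn

theorem zero_mem_Icc01 : (0 : ℝ) ∈ Icc (0 : ℝ) 1 := by simp

theorem one_mem_Icc01 : (1 : ℝ) ∈ Icc (0 : ℝ) 1 := by simp

theorem norm_volterra_le {A : ℝ → Matrix ι ι ℂ} (hA : IntegrableEntries A)
    (f : C(Icc (0 : ℝ) 1, ι → ℂ)) {x : ℝ} (hx : x ∈ Icc (0 : ℝ) 1) {b : ℝ → ℝ}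
    (hb : ContinuousOn b (Icc 0 1)) (hfb : ∀ t ∈ Icc (0 : ℝ) 1, ‖ext01 f t‖ ≤ b t) :
    ‖∫ t in (0 : ℝ)..x, (A t).mulVec (ext01 f t)‖ ≤ ∫ t in (0 : ℝ)..x, entrySum A t * b t := by
  refine intervalIntegral.norm_integral_le_of_norm_le hx.1 ?_ ?_
  · filter_upwards with t ht
    refine (norm_mulVec_le_entrySum A t _).trans ?_
    exact mul_le_mul_of_nonneg_left (hfb t ⟨ht.1.le, ht.2.trans hx.2⟩) (entrySum_nonneg A t)
  · exact intervalIntegrable_sub (intervalIntegrable_mul_continuousOn hA.entrySum hb)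
      zero_mem_Icc01 hx

/-- The Volterra operator `f ↦ ∫₀ˣ A f`. -/
def volterra (A : ℝ → Matrix ι ι ℂ) (hA : IntegrableEntries A) :
    C(Icc (0 : ℝ) 1, ι → ℂ) →L[ℂ] C(Icc (0 : ℝ) 1, ι → ℂ) :=
  LinearMap.mkContinuous
    { toFun := fun f => ⟨fun x => ∫ t in (0 : ℝ)..x, (A t).mulVec (ext01 f t), by
        have := (HasACDeriv.of_integral (intervalIntegrable_mulVec_ext01 hA f) 0
          zero_mem_Icc01).continuousOn.domRestrict
        simpa [Set.domRestrict_def] using this⟩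
      map_add' := fun f g => by
        ext1 x
        change ∫ t in (0 : ℝ)..x, (A t).mulVec (ext01 (f + g) t) =
          (∫ t in (0 : ℝ)..x, (A t).mulVec (ext01 f t)) + ∫ t in (0 : ℝ)..x, (A t).mulVec (ext01 g t)
        rw [← intervalIntegral.integral_add
          (intervalIntegrable_sub (intervalIntegrable_mulVec_ext01 hA f) zero_mem_Icc01 x.2)
          (intervalIntegrable_sub (intervalIntegrable_mulVec_ext01 hA g) zero_mem_Icc01 x.2)]
        refine intervalIntegral.integral_congr fun t _ => ?_
        simp [ext01, IccExtend, Matrix.mulVec_add]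
      map_smul' := fun c f => by
        ext1 x
        change ∫ t in (0 : ℝ)..x, (A t).mulVec (ext01 (c • f) t) =
          c • ∫ t in (0 : ℝ)..x, (A t).mulVec (ext01 f t)
        rw [← intervalIntegral.integral_smul]
        refine intervalIntegral.integral_congr fun t _ => ?_
        simp [ext01, IccExtend, Matrix.mulVec_smul] }
    (∫ t in (0 : ℝ)..1, entrySum A t) (fun f => by
      rw [ContinuousMap.norm_le _ (mul_nonneg (intervalIntegral.integral_nonneg zero_le_one
        fun t _ => entrySum_nonneg A t) (norm_nonneg f))]
      intro x
      refine (norm_volterra_le hA f x.2 (b := fun _ => ‖f‖) continuousOn_const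
        fun t _ => norm_ext01_le f t).trans ?_
      rw [intervalIntegral.integral_mul_const]
      gcongr
      exact integral_mono_right hA.entrySum (entrySum_nonneg A) le_rfl x.2.1 x.2.2)

theorem volterra_apply {A : ℝ → Matrix ι ι ℂ} (hA : IntegrableEntries A)
    (f : C(Icc (0 : ℝ) 1, ι → ℂ)) (x : Icc (0 : ℝ) 1) :
    volterra A hA f x = ∫ t in (0 : ℝ)..x, (A t).mulVec (ext01 f t) := rfl

/-- With `b x = ∫₀ˣ entrySum A`, the integrand `entrySum A · b ^ n / n!` of the induction step is
the derivative of `b ^ (n + 1) / (n + 1)!`. -/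
theorem norm_volterra_pow_apply_le {A : ℝ → Matrix ι ι ℂ} (hA : IntegrableEntries A) (n : ℕ)
    (f : C(Icc (0 : ℝ) 1, ι → ℂ)) (x : Icc (0 : ℝ) 1) :
    ‖(volterra A hA ^ n) f x‖ ≤ (∫ t in (0 : ℝ)..x, entrySum A t) ^ n / n.factorial * ‖f‖ := by
  induction n generalizing x with
  | zero => simpa using f.norm_coe_le_norm x
  | succ n ih =>
    rw [pow_succ', mul_apply_eq_comp, volterra_apply]
    have hb := HasACDeriv.of_integral hA.entrySum 0 zero_mem_Icc01
    have hφ := (hb.comp_contDiff (φ := fun y => y ^ (n + 1) / (n + 1).factorial * ‖f‖)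
      (φ' := fun y => y ^ n / n.factorial * ‖f‖) (by fun_prop) (fun y => by
        have := (((hasDerivAt_pow (n + 1) y).div_const ((n + 1).factorial : ℝ)).mul_const ‖f‖)
        convert! this using 2
        rw [Nat.factorial_succ]
        have : (n.factorial : ℝ) ≠ 0 := by positivity
        have : (n + 1 : ℝ) ≠ 0 := by positivity
        push_cast
        field_simp))
    have hc : ContinuousOn
        (fun y => (∫ t in (0 : ℝ)..y, entrySum A t) ^ n / n.factorial * ‖f‖) (Icc 0 1) := by
      have := hb.continuousOn
      simp only [zero_add] at this
      fun_prop
    refine (norm_volterra_le hA _ x.2 hc fun t ht => ?_).trans (le_of_eq ?_)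
    · rw [ext01, IccExtend_of_mem _ _ ht]
      exact ih ⟨t, ht⟩
    · have := hφ.integral_eq (by
        simpa using intervalIntegrable_mul_continuousOn hA.entrySum hc) zero_mem_Icc01 x.2
      simpa using this

theorem isUnit_one_sub_volterra {A : ℝ → Matrix ι ι ℂ} (hA : IntegrableEntries A) :
    IsUnit (1 - volterra A hA) := by
  set B := ∫ t in (0 : ℝ)..1, entrySum A t
  have hB : 0 ≤ B := intervalIntegral.integral_nonneg zero_le_one fun t _ => entrySum_nonneg A t
  obtain ⟨n, hn⟩ := ((FloorSemiring.tendsto_pow_div_factorial_atTop B).eventually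
    (gt_mem_nhds one_pos)).exists
  have h1 : ‖volterra A hA ^ n‖ < 1 := by
    refine lt_of_le_of_lt (ContinuousLinearMap.opNorm_le_bound _ (by positivity) fun f => ?_) hn
    rw [ContinuousMap.norm_le _ (by positivity)]
    intro x
    refine (norm_volterra_pow_apply_le hA n f x).trans ?_
    gcongr
    · exact intervalIntegral.integral_nonneg x.2.1 fun t _ => entrySum_nonneg A t
    · exact integral_mono_right hA.entrySum (entrySum_nonneg A) le_rfl x.2.1 x.2.2
  exact isUnit_one_sub_of_norm_pow_lt_one _ n h1

/-- Differentiation of the integral equation: the constant is the initial value and the second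
operator the inhomogeneity. The form `B g` is the one met in the recursion for Taylor coefficients
in the spectral parameter. -/
theorem isLinearSol_of_volterra {A B : ℝ → Matrix ι ι ℂ} (hA : IntegrableEntries A)
    (hB : IntegrableEntries B) {f g : C(Icc (0 : ℝ) 1, ι → ℂ)} {c : ι → ℂ}
    (h : (1 - volterra A hA) f = ContinuousMap.const _ c + volterra B hB g) :
    IsLinearSol A (fun x => (B x).mulVec (ext01 g x)) (ext01 f) ∧ ext01 f 0 = c := by
  have hf : ∀ x : Icc (0 : ℝ) 1, f x = c + ((∫ t in (0 : ℝ)..x, (A t).mulVec (ext01 f t)) +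
      ∫ t in (0 : ℝ)..x, (B t).mulVec (ext01 g t)) := by
    intro x
    have := DFunLike.congr_fun h x
    change f x - volterra A hA f x = c + volterra B hB g x at this
    rw [volterra_apply, volterra_apply] at this
    rw [sub_eq_iff_eq_add.1 this]
    abel
  have iA := intervalIntegrable_mulVec_ext01 hA f
  have iB := intervalIntegrable_mulVec_ext01 hB g
  constructor
  · intro i
    have e := HasACDeriv.of_integral (f' := fun t => (A t).mulVec (ext01 f t) i +
      (B t).mulVec (ext01 g t) i) ((hA.mulVec_apply (fun j => ((continuous_apply j).comp
        (continuous_ext01 f)).continuousOn) i).add (hB.mulVec_apply (fun j =>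
        ((continuous_apply j).comp (continuous_ext01 g)).continuousOn) i)) (c i) zero_mem_Icc01
    refine e.congr fun x hx => ?_
    have e3 := (ContinuousLinearMap.proj (R := ℂ) (φ := fun _ : ι => ℂ) i).intervalIntegral_comp_comm
        (intervalIntegrable_sub (iA.add iB) zero_mem_Icc01 hx)
    simp only [ContinuousLinearMap.proj_apply, Pi.add_apply] at e3
    simp only
    rw [e3, ext01, IccExtend_of_mem _ _ hx, hf ⟨x, hx⟩, ← intervalIntegral.integral_add
      (intervalIntegrable_sub iA zero_mem_Icc01 hx) (intervalIntegrable_sub iB zero_mem_Icc01 hx)]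
    rfl
  · rw [ext01, IccExtend_of_mem _ _ zero_mem_Icc01, hf]
    simp

end LinearSystem

/-! ### Expansion of the resolvent in a parameter -/

section Resolvent

variable {X : Type*} [NormedAddCommGroup X] [NormedSpace ℂ X] [CompleteSpace X]

/-- With `S = (1 - K₀)⁻¹ K₁` one has `1 - K₂ = (1 - K₀)(1 - t S)`, and the second factor is inverted
by a Neumann series. -/
theorem hasSum_inverse_one_sub {K₀ K₁ K₂ : X →L[ℂ] X} (h0 : IsUnit (1 - K₀)) {t : ℂ}
    (h1 : IsUnit (1 - K₂)) (h2 : K₂ = K₀ + t • K₁)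
    (ht : ‖t‖ * ‖Ring.inverse (1 - K₀) * K₁‖ < 1) (c : X) :
    HasSum (fun n : ℕ => t ^ n • ((Ring.inverse (1 - K₀) * K₁) ^ n) (Ring.inverse (1 - K₀) c))
      (Ring.inverse (1 - K₂) c) := by
  set R := Ring.inverse (1 - K₀)
  set S := R * K₁
  have hn : ‖t • S‖ < 1 := by rwa [norm_smul]
  have hs := (summable_geometric_of_norm_lt_one hn).hasSum
  set G := ∑' n : ℕ, (t • S) ^ n
  have hG : (1 - t • S) * G = 1 := mul_neg_geom_series _ hn
  have hfac : (1 - K₀) * (1 - t • S) = 1 - K₂ := by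
    have : (1 - K₀) * S = K₁ := by
      simp only [S, R, ← mul_assoc, Ring.mul_inverse_cancel _ h0, one_mul]
    rw [mul_sub, mul_one, mul_smul_comm, this, h2]
    abel
  have key : Ring.inverse (1 - K₂) = G * R := by
    have e : (1 - K₂) * (G * R) = 1 := by
      rw [← hfac, mul_assoc, ← mul_assoc _ G, hG, one_mul, Ring.mul_inverse_cancel _ h0]
    calc Ring.inverse (1 - K₂) = Ring.inverse (1 - K₂) * ((1 - K₂) * (G * R)) := by rw [e, mul_one]
      _ = G * R := by rw [← mul_assoc, Ring.inverse_mul_cancel _ h1, one_mul]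
  rw [key, mul_apply_eq_comp]
  have := hs.mapL (ContinuousLinearMap.apply ℂ X (R c))
  simpa [smul_pow, S] using this

end Resolvent

end FourthOrder

/-! ### The first-order system, its fundamental matrix and its symplectic structure -/

namespace FourthOrder

/-- Both coefficient functions are square integrable on `(0, 1)`. -/
structure SquareIntegrable (τ₁ τ₂ : ℝ → ℂ) : Prop where
  fst : MemLp τ₁ 2 (volume.restrict (Ioo 0 1))
  snd : MemLp τ₂ 2 (volume.restrict (Ioo 0 1))

theorem IsRegularization.squareIntegrable {p q : 𝓓'(unitIoo, ℂ)} {τ₁ τ₂ : ℝ → ℂ}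
    (h : IsRegularization p q τ₁ τ₂) : SquareIntegrable τ₁ τ₂ :=
  ⟨h.memLp_τ₁, h.memLp_τ₂⟩

theorem intervalIntegrable_iff_Ioo {f : ℝ → ℂ} :
    IntervalIntegrable f volume 0 1 ↔ Integrable f (volume.restrict (Ioo 0 1)) := by
  rw [intervalIntegrable_iff_integrableOn_Ioc_of_le zero_le_one, IntegrableOn,
    Measure.restrict_congr_set Ioo_ae_eq_Ioc]

/-- The coefficient matrix of the first order system which is equivalent to `y^{[4]} = μ y`. -/
def sysMatrix (τ₁ τ₂ : ℝ → ℂ) (μ : ℂ) (x : ℝ) : Matrix (Fin 4) (Fin 4) ℂ :=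
  assocMatrix τ₁ τ₂ x + μ • Matrix.single 3 0 1

/-- The entries are at most quadratic in `τ₁`, `τ₂`, so square integrability makes them integrable.
-/
theorem SquareIntegrable.integrableEntries {τ₁ τ₂ : ℝ → ℂ} (h : SquareIntegrable τ₁ τ₂) (μ : ℂ) :
    IntegrableEntries (sysMatrix τ₁ τ₂ μ) := by
  have i1 : IntervalIntegrable τ₁ volume 0 1 :=
    intervalIntegrable_iff_Ioo.2 (h.fst.integrable (by norm_num))
  have i2 : IntervalIntegrable τ₂ volume 0 1 :=
    intervalIntegrable_iff_Ioo.2 (h.snd.integrable (by norm_num))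
  have i11 : IntervalIntegrable (fun x => τ₁ x * τ₁ x) volume 0 1 :=
    intervalIntegrable_iff_Ioo.2 (h.fst.integrable_mul h.fst)
  have i12 : IntervalIntegrable (fun x => τ₁ x * τ₂ x) volume 0 1 :=
    intervalIntegrable_iff_Ioo.2 (h.fst.integrable_mul h.snd)
  have i22 : IntervalIntegrable (fun x => τ₂ x * τ₂ x) volume 0 1 :=
    intervalIntegrable_iff_Ioo.2 (h.snd.integrable_mul h.snd)
  have ic : ∀ c : ℂ, IntervalIntegrable (fun _ => c) volume (0 : ℝ) 1 := fun c => by simp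
  intro i j
  unfold sysMatrix
  fin_cases i <;> fin_cases j <;>
    simp [assocMatrix, pow_two]
  · exact i2.neg
  · exact i1
  · exact i12
  · exact i11.neg.add (i2.const_mul 2)
  · exact i1.neg
  · exact i22.add (ic μ)
  · exact i12.neg
  · exact i2.neg

theorem integrableEntries_single :
    IntegrableEntries (fun _ => Matrix.single (3 : Fin 4) (0 : Fin 4) (1 : ℂ)) :=
  fun i j => by simp

/-- The skew form preserved by the system. -/
def skewForm (y z : Fin 4 → ℂ) : ℂ := y 3 * z 0 - y 2 * z 1 + y 1 * z 2 - y 0 * z 3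

/-- By the symmetry of the coefficient matrix, the derivative of the form along two solutions with
the same `μ` cancels identically. -/
theorem skewForm_eq_of_isLinearSol {τ₁ τ₂ : ℝ → ℂ} {μ : ℂ} {Y Z : ℝ → Fin 4 → ℂ}
    (hY : IsLinearSol (sysMatrix τ₁ τ₂ μ) (fun _ => 0) Y)
    (hZ : IsLinearSol (sysMatrix τ₁ τ₂ μ) (fun _ => 0) Z) {x : ℝ} (hx : x ∈ Icc (0 : ℝ) 1) :
    skewForm (Y x) (Z x) = skewForm (Y 0) (Z 0) := by
  have h := ((((hY 3).mul (hZ 0)).sub ((hY 2).mul (hZ 1))).add ((hY 1).mul (hZ 2))).sub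
    ((hY 0).mul (hZ 3))
  refine (h.congr_deriv (g' := fun _ => 0) ?_).eq_of_deriv_zero hx
  filter_upwards with t
  simp [sysMatrix, assocMatrix, Matrix.mulVec, dotProduct, Fin.sum_univ_four, Matrix.single_apply]
  ring

section System

variable {τ₁ τ₂ : ℝ → ℂ} (h : SquareIntegrable τ₁ τ₂)

/-- The Volterra operator of the system with spectral parameter `μ`. -/
def sysOp (μ : ℂ) : C(Icc (0 : ℝ) 1, Fin 4 → ℂ) →L[ℂ] C(Icc (0 : ℝ) 1, Fin 4 → ℂ) :=
  volterra (sysMatrix τ₁ τ₂ μ) (h.integrableEntries μ)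

/-- The Volterra operator of the derivative of the system in the spectral parameter. -/
def paramOp : C(Icc (0 : ℝ) 1, Fin 4 → ℂ) →L[ℂ] C(Icc (0 : ℝ) 1, Fin 4 → ℂ) :=
  volterra _ integrableEntries_single

theorem sysOp_add (μ t : ℂ) : sysOp h (μ + t) = sysOp h μ + t • paramOp := by
  ext1 f
  ext1 x
  change sysOp h (μ + t) f x = sysOp h μ f x + t • paramOp f x
  simp only [sysOp, paramOp, volterra_apply]
  have hs : IntervalIntegrable
      (fun s => t • (Matrix.single (3 : Fin 4) (0 : Fin 4) (1 : ℂ)).mulVec (ext01 f s)) volume 0 x :=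
    (intervalIntegrable_sub (intervalIntegrable_mulVec_ext01 integrableEntries_single f)
      zero_mem_Icc01 x.2).smul t
  rw [← intervalIntegral.integral_smul, ← intervalIntegral.integral_add
    (intervalIntegrable_sub (intervalIntegrable_mulVec_ext01 (h.integrableEntries μ) f)
      zero_mem_Icc01 x.2) hs]
  refine intervalIntegral.integral_congr fun s _ => ?_
  simp only [sysMatrix, add_smul, Matrix.add_mulVec, Matrix.smul_mulVec, add_assoc]

/-- The `n`-th Taylor coefficient, at `μ` in the spectral parameter, of the solution with initial
value `c`. -/
def taylorSol (μ : ℂ) (c : Fin 4 → ℂ) : ℕ → C(Icc (0 : ℝ) 1, Fin 4 → ℂ) := fun n =>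
  ((Ring.inverse (1 - sysOp h μ) * paramOp) ^ n)
    (Ring.inverse (1 - sysOp h μ) (ContinuousMap.const _ c))

/-- The solution of the system with initial value `c`. -/
def sol (μ : ℂ) (c : Fin 4 → ℂ) : ℝ → Fin 4 → ℂ := ext01 (taylorSol h μ c 0)

theorem isUnit_one_sub_sysOp (μ : ℂ) : IsUnit (1 - sysOp h μ) := isUnit_one_sub_volterra _

theorem one_sub_sysOp_taylorSol_zero (μ : ℂ) (c : Fin 4 → ℂ) :
    (1 - sysOp h μ) (taylorSol h μ c 0) = ContinuousMap.const _ c := by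
  change (((1 - sysOp h μ) * Ring.inverse (1 - sysOp h μ)) (ContinuousMap.const _ c)) = _
  rw [Ring.mul_inverse_cancel _ (isUnit_one_sub_sysOp h μ)]
  rfl

theorem one_sub_sysOp_taylorSol_succ (μ : ℂ) (c : Fin 4 → ℂ) (n : ℕ) :
    (1 - sysOp h μ) (taylorSol h μ c (n + 1)) = paramOp (taylorSol h μ c n) := by
  unfold taylorSol
  rw [pow_succ']
  change (((1 - sysOp h μ) * Ring.inverse (1 - sysOp h μ)) (paramOp _)) = _
  rw [Ring.mul_inverse_cancel _ (isUnit_one_sub_sysOp h μ)]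
  rfl

theorem isLinearSol_taylorSol_zero (μ : ℂ) (c : Fin 4 → ℂ) :
    IsLinearSol (sysMatrix τ₁ τ₂ μ) (fun _ => 0) (ext01 (taylorSol h μ c 0)) ∧
      ext01 (taylorSol h μ c 0) 0 = c := by
  have := isLinearSol_of_volterra (h.integrableEntries μ) integrableEntries_single
    (f := taylorSol h μ c 0) (g := 0) (c := c) (by
      rw [map_zero, add_zero]; exact one_sub_sysOp_taylorSol_zero h μ c)
  refine ⟨fun i => (this.1 i).congr_deriv ?_, this.2⟩
  filter_upwards with x
  simp [ext01, IccExtend]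

theorem isLinearSol_sol (μ : ℂ) (c : Fin 4 → ℂ) :
    IsLinearSol (sysMatrix τ₁ τ₂ μ) (fun _ => 0) (sol h μ c) :=
  (isLinearSol_taylorSol_zero h μ c).1

theorem sol_zero (μ : ℂ) (c : Fin 4 → ℂ) : sol h μ c 0 = c :=
  (isLinearSol_taylorSol_zero h μ c).2

theorem hasSum_sol (μ : ℂ) (c : Fin 4 → ℂ) (x : ℝ) (i : Fin 4) :
    ∀ᶠ t in 𝓝 (0 : ℂ), HasSum (fun n : ℕ => t ^ n * ext01 (taylorSol h μ c n) x i)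
      (sol h (μ + t) c x i) := by
  have hc : Continuous fun t : ℂ => ‖t‖ * ‖Ring.inverse (1 - sysOp h μ) * paramOp‖ := by fun_prop
  have := hc.tendsto 0
  simp only [norm_zero, zero_mul] at this
  filter_upwards [this.eventually (gt_mem_nhds one_pos)] with t ht
  have e := hasSum_inverse_one_sub (isUnit_one_sub_volterra (h.integrableEntries μ))
    (isUnit_one_sub_volterra (h.integrableEntries (μ + t))) (sysOp_add h μ t) ht
    (ContinuousMap.const _ c)
  have e2 := e.mapL ((ContinuousLinearMap.proj (R := ℂ) (φ := fun _ : Fin 4 => ℂ) i) ∘L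
    ContinuousMap.evalCLM ℂ (projIcc 0 1 zero_le_one x))
  exact e2

/-- The fundamental matrix of the system which is the identity at zero. -/
def fundMatrix (x : ℝ) (μ : ℂ) : Matrix (Fin 4) (Fin 4) ℂ :=
  Matrix.of fun k j => sol h μ (Pi.single j 1) x k

theorem taylorSol_sum (μ : ℂ) (c : Fin 4 → ℂ) (n : ℕ) :
    taylorSol h μ c n = ∑ j, c j • taylorSol h μ (Pi.single j 1) n := by
  have : ContinuousMap.const (Icc (0 : ℝ) 1) c =
      ∑ j, c j • ContinuousMap.const (Icc (0 : ℝ) 1) (Pi.single j 1 : Fin 4 → ℂ) := by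
    ext1 x
    simp only [ContinuousMap.const_apply, ContinuousMap.coe_sum, ContinuousMap.coe_smul,
      Finset.sum_apply, Pi.smul_apply]
    exact pi_eq_sum_univ' c
  unfold taylorSol
  rw [this]
  simp only [map_sum, map_smul]

theorem sol_eq_mulVec (μ : ℂ) (c : Fin 4 → ℂ) (x : ℝ) :
    sol h μ c x = (fundMatrix h x μ).mulVec c := by
  ext k
  unfold sol
  rw [taylorSol_sum]
  simp [ext01, IccExtend, Matrix.mulVec, dotProduct, fundMatrix, sol, mul_comm]

theorem eq_fundMatrix_mulVec {μ : ℂ} {Y : ℝ → Fin 4 → ℂ}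
    (hY : IsLinearSol (sysMatrix τ₁ τ₂ μ) (fun _ => 0) Y) {x : ℝ} (hx : x ∈ Icc (0 : ℝ) 1) :
    Y x = (fundMatrix h x μ).mulVec (Y 0) := by
  rw [← sol_eq_mulVec]
  exact hY.eq_of_zero (h.integrableEntries μ) (isLinearSol_sol h μ (Y 0)) (sol_zero h μ _).symm hx

theorem fundMatrix_zero (μ : ℂ) : fundMatrix h 0 μ = 1 := by
  ext k j
  simp only [fundMatrix, Matrix.of_apply, sol_zero, Matrix.one_apply, Pi.single_apply]

theorem skewForm_fundMatrix {x : ℝ} (hx : x ∈ Icc (0 : ℝ) 1) (μ : ℂ) (a b : Fin 4 → ℂ) :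
    skewForm ((fundMatrix h x μ).mulVec a) ((fundMatrix h x μ).mulVec b) = skewForm a b := by
  rw [← sol_eq_mulVec, ← sol_eq_mulVec,
    skewForm_eq_of_isLinearSol (isLinearSol_sol h μ a) (isLinearSol_sol h μ b) hx, sol_zero,
    sol_zero]

/-- The matrix of `skewForm`. -/
def skewMatrix : Matrix (Fin 4) (Fin 4) ℂ :=
  !![0, 0, 0, -1; 0, 0, 1, 0; 0, -1, 0, 0; 1, 0, 0, 0]

theorem skewForm_eq (a b : Fin 4 → ℂ) : skewForm a b = a ⬝ᵥ skewMatrix.mulVec b := by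
  simp [skewForm, skewMatrix, dotProduct, Matrix.mulVec, Fin.sum_univ_four]
  ring

theorem skewMatrix_mul_self : skewMatrix * skewMatrix = -1 := by
  ext i j
  fin_cases i <;> fin_cases j <;> simp [skewMatrix, Matrix.mul_apply, Fin.sum_univ_four]

theorem transpose_mul_skewMatrix_mul {x : ℝ} (hx : x ∈ Icc (0 : ℝ) 1) (μ : ℂ) :
    (fundMatrix h x μ).transpose * skewMatrix * fundMatrix h x μ = skewMatrix := by
  ext i j
  have := skewForm_fundMatrix h hx μ (Pi.single i 1) (Pi.single j 1)
  rw [skewForm_eq, skewForm_eq] at this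
  simp only [Matrix.mulVec_single_one, single_one_dotProduct, Matrix.col_apply] at this
  rw [← this, Matrix.mul_assoc, Matrix.mul_apply_eq_vecMul]
  simp [Matrix.mul_apply, dotProduct, Matrix.mulVec, Matrix.col, Matrix.vecMul]

/-- The inverse of the fundamental matrix. -/
def invFundMatrix (x : ℝ) (μ : ℂ) : Matrix (Fin 4) (Fin 4) ℂ :=
  -(skewMatrix * (fundMatrix h x μ).transpose * skewMatrix)

/-- As `S² = -1`, the relation `Mᵀ S M = S` inverts `M` without division. The entries of the inverse
are those of `M` up to sign and position, and inherit analyticity and growth. -/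
theorem invFundMatrix_mul {x : ℝ} (hx : x ∈ Icc (0 : ℝ) 1) (μ : ℂ) :
    invFundMatrix h x μ * fundMatrix h x μ = 1 := by
  have := transpose_mul_skewMatrix_mul h hx μ
  rw [invFundMatrix, Matrix.neg_mul, Matrix.mul_assoc, Matrix.mul_assoc,
    ← Matrix.mul_assoc _ skewMatrix, this, skewMatrix_mul_self, neg_neg]

theorem mul_invFundMatrix {x : ℝ} (hx : x ∈ Icc (0 : ℝ) 1) (μ : ℂ) :
    fundMatrix h x μ * invFundMatrix h x μ = 1 :=
  mul_eq_one_comm.1 (invFundMatrix_mul h hx μ)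

theorem mul_skewMatrix_mul_transpose {x : ℝ} (hx : x ∈ Icc (0 : ℝ) 1) (μ : ℂ) :
    fundMatrix h x μ * skewMatrix * (fundMatrix h x μ).transpose = skewMatrix := by
  have := congrArg (· * skewMatrix) (mul_invFundMatrix h hx μ)
  simp only [invFundMatrix, Matrix.mul_neg, Matrix.neg_mul, Matrix.mul_assoc,
    skewMatrix_mul_self, one_mul, neg_neg, mul_one] at this
  rw [Matrix.mul_assoc, this]

theorem analyticAt_fundMatrix (x : ℝ) (k j : Fin 4) (μ : ℂ) :
    AnalyticAt ℂ (fun μ => fundMatrix h x μ k j) μ := by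
  refine (hasFPowerSeriesAt_iff (p := FormalMultilinearSeries.ofScalars ℂ
    (fun n => ext01 (taylorSol h μ (Pi.single j 1) n) x k))|>.2 ?_).analyticAt
  simpa [fundMatrix] using hasSum_sol h μ (Pi.single j 1) x k

theorem differentiable_fundMatrix (x : ℝ) (k j : Fin 4) :
    Differentiable ℂ (fun μ => fundMatrix h x μ k j) :=
  fun μ => (analyticAt_fundMatrix h x k j μ).differentiableAt

end System

/-- The units above the diagonal of the matrix reproduce the terms `Y (k + 1)` for `k < 3`, which
lie outside the sum over `j ≤ k`. Only `Y 4` remains as an inhomogeneity. -/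
theorem isQuasiDerivs_iff {τ₁ τ₂ : ℝ → ℂ} {Y : ℕ → ℝ → ℂ} :
    IsQuasiDerivs τ₁ τ₂ Y ↔ IsLinearSol (assocMatrix τ₁ τ₂)
      (fun x => Pi.single 3 (Y 4 x)) (fun x k => Y k x) := by
  unfold IsQuasiDerivs IsLinearSol HasACDeriv
  refine forall_congr' fun k => and_congr_right fun _ => ?_
  refine iff_of_eq (congrArg (fun P : ℝ → Prop => ∀ᵐ x ∂(volume.restrict (Ioo (0 : ℝ) 1)), P x) ?_)
  funext x
  congr 1
  fin_cases k <;>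
    simp [Finset.sum_filter, assocMatrix, Matrix.mulVec, dotProduct, Fin.sum_univ_four, Fin.le_def] <;> ring

theorem sysMatrix_mulVec (τ₁ τ₂ : ℝ → ℂ) (μ : ℂ) (x : ℝ) (v : Fin 4 → ℂ) :
    (sysMatrix τ₁ τ₂ μ x).mulVec v = (assocMatrix τ₁ τ₂ x).mulVec v + Pi.single 3 (μ * v 0) := by
  rw [sysMatrix, Matrix.add_mulVec, Matrix.smul_mulVec]
  congr 1
  ext i
  fin_cases i <;> simp [Matrix.mulVec, dotProduct, Matrix.single_apply]

theorem isSolution_iff {τ₁ τ₂ : ℝ → ℂ} {μ : ℂ} {Y : ℕ → ℝ → ℂ} :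
    IsSolution τ₁ τ₂ μ Y ↔ (∀ᵐ x ∂(volume.restrict (Ioo (0 : ℝ) 1)), Y 4 x = μ * Y 0 x) ∧
      IsLinearSol (sysMatrix τ₁ τ₂ μ) (fun _ => 0) (fun x k => Y k x) := by
  rw [IsSolution, isQuasiDerivs_iff, and_comm]
  refine and_congr_right fun h4 => ⟨fun H i => (H i).congr_deriv ?_, fun H i => (H i).congr_deriv ?_⟩
  all_goals
    filter_upwards [h4] with x hx
    simp [sysMatrix_mulVec, hx]

/-- Existence validates the choice, and uniqueness for the initial value problem fixes the values of
whatever is chosen. As `U_s` reads `y^{[4-s]}`, the index is reversed: `C_r` is column `4 - r`. -/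
theorem C_spec {τ₁ τ₂ : ℝ → ℂ} (h : SquareIntegrable τ₁ τ₂) (μ : ℂ) {r : ℕ} (hr : r ∈ Finset.Icc 1 4)
    {k : Fin 4} {x : ℝ} (hx : x ∈ Icc (0 : ℝ) 1) :
    C τ₁ τ₂ r μ k x = fundMatrix h x μ k ⟨4 - r, by grind⟩ := by
  set j : Fin 4 := ⟨4 - r, by grind⟩ with hj
  have key : IsSolution τ₁ τ₂ μ (C τ₁ τ₂ r μ) ∧
      ∀ s ∈ Finset.Icc 1 4, U s (C τ₁ τ₂ r μ) = if s = r then 1 else 0 := by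
    refine Classical.epsilon_spec (p := fun Y => IsSolution τ₁ τ₂ μ Y ∧
      ∀ s ∈ Finset.Icc 1 4, U s Y = if s = r then 1 else 0)
      -- All entries from index 4 on are set to `μ y`; only the one at 4 matters.
      ⟨fun n x => if hn : n < 4 then sol h μ (Pi.single j 1) x ⟨n, hn⟩
        else μ * sol h μ (Pi.single j 1) x 0, ?_, ?_⟩
    · rw [isSolution_iff]
      refine ⟨by simp, ?_⟩
      simpa using isLinearSol_sol h μ (Pi.single j 1)
    · intro s hs
      have : 4 - s < 4 := by grind
      simp only [U, this, dif_pos, sol_zero, Pi.single_apply]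
      refine if_congr ?_ rfl rfl
      rw [hj, Fin.mk.injEq]
      grind
  have e := eq_fundMatrix_mulVec h (isSolution_iff.1 key.1).2 hx
  have e0 : (fun k : Fin 4 => C τ₁ τ₂ r μ k 0) = Pi.single j 1 := by
    ext k
    have := key.2 (4 - k) (by grind)
    have hk : 4 - (4 - (k : ℕ)) = k := by grind
    rw [U, hk] at this
    rw [this, Pi.single_apply]
    refine if_congr ?_ rfl rfl
    rw [hj, Fin.ext_iff]
    grind
  rw [e0] at e
  have := congrFun e k
  simpa using this

end FourthOrder

/-! ### Growth of the fundamental matrix in the spectral parameter -/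

namespace FourthOrder

/-- Growth of order at most `1/4`, finite type. -/
def QuarterGrowth (f : ℂ → ℂ) : Prop :=
  ∃ C : ℝ, 0 ≤ C ∧ ∀ z, ‖f z‖ ≤ Real.exp (C * (1 + ‖z‖) ^ (1 / 4 : ℝ))

theorem one_le_rpow_quarter (z : ℂ) : 1 ≤ (1 + ‖z‖) ^ (1 / 4 : ℝ) :=
  Real.one_le_rpow (by linarith [norm_nonneg z]) (by norm_num)

namespace QuarterGrowth

variable {f g : ℂ → ℂ}

theorem mul (hf : QuarterGrowth f) (hg : QuarterGrowth g) : QuarterGrowth (fun z => f z * g z) := by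
  obtain ⟨C, hC, h1⟩ := hf
  obtain ⟨D, hD, h2⟩ := hg
  refine ⟨C + D, by positivity, fun z => ?_⟩
  rw [norm_mul, add_mul, Real.exp_add]
  exact mul_le_mul (h1 z) (h2 z) (norm_nonneg _) (Real.exp_pos _).le

theorem add (hf : QuarterGrowth f) (hg : QuarterGrowth g) : QuarterGrowth (fun z => f z + g z) := by
  obtain ⟨C, hC, h1⟩ := hf
  obtain ⟨D, hD, h2⟩ := hg
  refine ⟨C + D + 1, by positivity, fun z => ?_⟩
  have h3 := one_le_rpow_quarter z
  set ρ := (1 + ‖z‖) ^ (1 / 4 : ℝ)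
  have e1 : Real.exp (C * ρ) ≤ Real.exp ((C + D) * ρ) := Real.exp_le_exp.2 (by nlinarith)
  have e2 : Real.exp (D * ρ) ≤ Real.exp ((C + D) * ρ) := Real.exp_le_exp.2 (by nlinarith)
  have e3 : 2 ≤ Real.exp ρ := by linarith [Real.add_one_le_exp ρ]
  calc ‖f z + g z‖ ≤ Real.exp ((C + D) * ρ) + Real.exp ((C + D) * ρ) :=
        (norm_add_le _ _).trans (add_le_add ((h1 z).trans e1) ((h2 z).trans e2))
    _ = Real.exp ((C + D) * ρ) * 2 := by ring
    _ ≤ Real.exp ((C + D) * ρ) * Real.exp ρ := by gcongr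
    _ = Real.exp ((C + D + 1) * ρ) := by rw [← Real.exp_add]; ring_nf

theorem neg (hf : QuarterGrowth f) : QuarterGrowth (fun z => -f z) := by
  obtain ⟨C, hC, h1⟩ := hf
  exact ⟨C, hC, fun z => by simpa using h1 z⟩

theorem sub (hf : QuarterGrowth f) (hg : QuarterGrowth g) : QuarterGrowth (fun z => f z - g z) := by
  simpa [sub_eq_add_neg] using hf.add hg.neg

theorem const (c : ℂ) : QuarterGrowth (fun _ => c) := by
  refine ⟨‖c‖, norm_nonneg c, fun z => ?_⟩
  nlinarith [Real.add_one_le_exp (‖c‖ * (1 + ‖z‖) ^ (1 / 4 : ℝ)), one_le_rpow_quarter z,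
    norm_nonneg c]

theorem sum {ι : Type*} (s : Finset ι) {f : ι → ℂ → ℂ} (hf : ∀ i ∈ s, QuarterGrowth (f i)) :
    QuarterGrowth (fun z => ∑ i ∈ s, f i z) := by
  classical
  induction s using Finset.induction_on with
  | empty => simpa using const 0
  | insert a s ha ih =>
    simp only [Finset.sum_insert ha]
    exact (hf a (by simp)).add (ih fun i hi => hf i (by simp [hi]))

end QuarterGrowth

/-- Scaling component `k` by `ρ ^ (-k)`, with `ρ = (1 + |μ|)^{1/4}`, balances the system: the units
above the diagonal become `ρ`, the corner term `μ ρ⁻³` is at most `ρ`, and the other entries do not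
grow. The Gronwall exponent is then of order `ρ`. -/
theorem quarterGrowth_fundMatrix {τ₁ τ₂ : ℝ → ℂ} (h : SquareIntegrable τ₁ τ₂) {x : ℝ}
    (hx : x ∈ Icc (0 : ℝ) 1) (k j : Fin 4) : QuarterGrowth (fun μ => fundMatrix h x μ k j) := by
  have hA0 : IntegrableEntries (assocMatrix τ₁ τ₂) := by
    have := h.integrableEntries 0
    unfold sysMatrix at this
    simpa using this
  set B := ∫ t in (0 : ℝ)..1, entrySum (assocMatrix τ₁ τ₂) t with hB
  have hB0 : 0 ≤ B := intervalIntegral.integral_nonneg zero_le_one fun t _ => entrySum_nonneg _ t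
  -- Sixteen entries contribute `ρ` each, and three more `ρ` absorb the factor `ρ ^ 3` from undoing
  -- the scaling.
  refine ⟨B + 19, by positivity, fun μ => ?_⟩
  set ρ := (1 + ‖μ‖) ^ (1 / 4 : ℝ) with hρ
  have hρ1 : 1 ≤ ρ := one_le_rpow_quarter μ
  have hρ0 : 0 < ρ := by linarith
  have hρ4 : ρ ^ 4 = 1 + ‖μ‖ := by
    rw [hρ, ← Real.rpow_natCast, ← Real.rpow_mul (by positivity)]
    norm_num
  have hμ : ‖μ‖ ≤ ρ ^ 4 := by linarith
  let M : ℝ → Matrix (Fin 4) (Fin 4) ℂ := fun t => Matrix.of fun k l =>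
    ((ρ : ℂ)⁻¹ ^ (k : ℕ) * (ρ : ℂ) ^ (l : ℕ)) * sysMatrix τ₁ τ₂ μ t k l
  have hM : IntegrableEntries M := fun k l => (h.integrableEntries μ k l).const_mul _
  have hρc : (ρ : ℂ) ≠ 0 := by exact_mod_cast hρ0.ne'
  let Z : ℝ → Fin 4 → ℂ := fun t k => (ρ : ℂ)⁻¹ ^ (k : ℕ) * sol h μ (Pi.single j 1) t k
  have hZ : IsLinearSol M (fun _ => 0) Z := fun k => by
    refine ((isLinearSol_sol h μ (Pi.single j 1) k).const_mul ((ρ : ℂ)⁻¹ ^ (k : ℕ))).congr_deriv ?_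
    filter_upwards with t
    simp only [Pi.zero_apply, add_zero, Matrix.mulVec, dotProduct, M, Z, Finset.mul_sum,
      Matrix.of_apply]
    refine Finset.sum_congr rfl fun l _ => ?_
    have : (ρ : ℂ) ^ (l : ℕ) * (ρ : ℂ)⁻¹ ^ (l : ℕ) = 1 := by
      rw [← mul_pow, mul_inv_cancel₀ hρc, one_pow]
    linear_combination ((ρ : ℂ)⁻¹ ^ (k : ℕ) * sysMatrix τ₁ τ₂ μ t k l *
      sol h μ (Pi.single j 1) t l) * (-this)
  have hent : ∀ t k l, ‖M t k l‖ ≤ ‖assocMatrix τ₁ τ₂ t k l‖ + ρ := by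
    intro t k l
    have hle : ∀ (a b : ℕ) (c : ℂ), b ≤ a → ‖(ρ : ℂ)⁻¹ ^ a * (ρ : ℂ) ^ b * c‖ ≤ ‖c‖ := by
      intro a b c hab
      rw [norm_mul, norm_mul, norm_pow, norm_pow, norm_inv, Complex.norm_real, Real.norm_of_nonneg
        hρ0.le]
      refine mul_le_of_le_one_left (norm_nonneg c) ?_
      rw [inv_pow, inv_mul_le_iff₀ (by positivity), mul_one]
      exact pow_le_pow_right₀ hρ1 hab
    have hle1 : ∀ (a b : ℕ), b ≤ a + 1 → ‖(ρ : ℂ)⁻¹ ^ a * (ρ : ℂ) ^ b‖ ≤ ρ := by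
      intro a b hab
      rw [norm_mul, norm_pow, norm_pow, norm_inv, Complex.norm_real, Real.norm_of_nonneg
        hρ0.le, inv_pow, inv_mul_le_iff₀ (by positivity), ← pow_succ]
      exact pow_le_pow_right₀ hρ1 hab
    by_cases hkl : l ≤ k
    · by_cases h30 : k = 3 ∧ l = 0
      · obtain ⟨rfl, rfl⟩ := h30
        simp only [M, sysMatrix, Matrix.of_apply, Matrix.add_apply, Matrix.smul_apply,
          Matrix.single_apply_same, smul_eq_mul, mul_one, mul_add]
        refine (norm_add_le _ _).trans (add_le_add (hle _ _ _ hkl) ?_)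
        rw [norm_mul, norm_mul, norm_pow, norm_pow, norm_inv, Complex.norm_real, Real.norm_of_nonneg
          hρ0.le, inv_pow, mul_assoc, inv_mul_le_iff₀ (by positivity)]
        simpa [← pow_succ] using hμ
      · have : (Matrix.single 3 0 1 : Matrix (Fin 4) (Fin 4) ℂ) k l = 0 := by
          rw [Matrix.single_apply_of_ne]; tauto
        simp only [M, sysMatrix, Matrix.of_apply, Matrix.add_apply, Matrix.smul_apply, this,
          smul_zero, add_zero]
        exact (hle _ _ _ hkl).trans (by linarith)
    · have hs : sysMatrix τ₁ τ₂ μ t k l = if (l : ℕ) = k + 1 then 1 else 0 := by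
        fin_cases k <;> fin_cases l <;> simp [Fin.le_def] at hkl <;>
          simp [sysMatrix, assocMatrix]
      simp only [M, Matrix.of_apply, hs]
      split_ifs with hl
      · rw [mul_one]
        exact (hle1 _ _ hl.le).trans (by linarith [norm_nonneg (assocMatrix τ₁ τ₂ t k l)])
      · rw [mul_zero, norm_zero]
        positivity
  have hsum : ∫ t in (0 : ℝ)..1, entrySum M t ≤ B + 16 * ρ := by
    have : B + 16 * ρ = ∫ t in (0 : ℝ)..1, (entrySum (assocMatrix τ₁ τ₂) t + 16 * ρ) := by
      rw [intervalIntegral.integral_add hA0.entrySum (by simp)]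
      simp [hB]
    rw [this]
    refine intervalIntegral.integral_mono_on zero_le_one hM.entrySum
      (hA0.entrySum.add (by simp)) fun t _ => ?_
    unfold entrySum
    refine (Finset.sum_le_sum fun k _ => Finset.sum_le_sum fun l _ => hent t k l).trans ?_
    simp only [Finset.sum_add_distrib, Finset.sum_const, Finset.card_univ, Fintype.card_fin,
      nsmul_eq_mul]
    push_cast
    linarith
  have hZ0 : ‖Z 0‖ ≤ 1 := by
    rw [pi_norm_le_iff_of_nonneg zero_le_one]
    intro k
    simp only [Z, sol_zero, norm_mul, norm_pow, norm_inv, Complex.norm_real,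
      Real.norm_of_nonneg hρ0.le, Pi.single_apply]
    split_ifs
    · rw [norm_one, mul_one]
      exact pow_le_one₀ (by positivity) (inv_le_one_of_one_le₀ hρ1)
    · simp
  have key : ‖Z x k‖ ≤ Real.exp (B + 16 * ρ) := by
    refine (norm_le_pi_norm (Z x) k).trans ((hZ.norm_le hM hx).trans ?_)
    calc ‖Z 0‖ * Real.exp (∫ t in (0 : ℝ)..1, entrySum M t)
        ≤ 1 * Real.exp (B + 16 * ρ) := by gcongr
      _ = _ := one_mul _
  have hk : fundMatrix h x μ k j = (ρ : ℂ) ^ (k : ℕ) * Z x k := by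
    simp only [Z, fundMatrix, Matrix.of_apply, ← mul_assoc, ← mul_pow, mul_inv_cancel₀ hρc, one_pow,
      one_mul]
  have e1 : ρ ≤ Real.exp ρ := by linarith [Real.add_one_le_exp ρ]
  calc ‖fundMatrix h x μ k j‖ = ρ ^ (k : ℕ) * ‖Z x k‖ := by
        rw [hk, norm_mul, norm_pow, Complex.norm_real, Real.norm_of_nonneg hρ0.le]
    _ ≤ ρ ^ 3 * Real.exp (B + 16 * ρ) := by
        gcongr
        exact Nat.le_of_lt_succ k.2
    _ ≤ Real.exp ρ ^ 3 * Real.exp (B + 16 * ρ) := by gcongr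
    _ ≤ Real.exp ((B + 19) * ρ) := by
        rw [← Real.exp_nat_mul, ← Real.exp_add]
        refine Real.exp_le_exp.2 ?_
        push_cast
        nlinarith

end FourthOrder

/-! ### Entire functions of order at most one quarter -/

namespace FourthOrder

open Metric Filter

theorem norm_le_of_sphere {f : ℂ → ℂ} (hf : Differentiable ℂ f) {R B : ℝ} (hR : 0 < R)
    (h : ∀ z ∈ sphere (0 : ℂ) R, ‖f z‖ ≤ B) {w : ℂ} (hw : ‖w‖ ≤ R) : ‖f w‖ ≤ B := by
  refine Complex.norm_le_of_forall_mem_frontier_norm_le (U := ball 0 R) isBounded_ball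
    hf.diffContOnCl (fun z hz => h z ?_) ?_
  · rwa [frontier_ball _ hR.ne'] at hz
  · rw [closure_ball _ hR.ne']
    simpa using hw

/-- Borel–Carathéodory for a holomorphic function with real part `log |g|` on the zero-free disc.
The exponents come from `2|w| / (3R/4 - |w|) ≤ 4` for `|w| ≤ R/2`. -/
theorem norm_lower_bound_of_ne_zero {g : ℂ → ℂ} (hg : Differentiable ℂ g) {R M : ℝ} (hR : 0 < R)
    (hM : ∀ z ∈ sphere (0 : ℂ) R, ‖g z‖ ≤ M) (hz : ∀ z ∈ ball (0 : ℂ) (3 / 4 * R), g z ≠ 0)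
    {w : ℂ} (hw : ‖w‖ ≤ R / 2) : ‖g 0‖ ^ 5 ≤ Real.exp 4 * M ^ 4 * ‖g w‖ := by
  have hR' : 0 < 3 / 4 * R := by positivity
  have g0 : 0 < ‖g 0‖ := norm_pos_iff.2 (hz 0 (by simpa using hR))
  have hgM : ∀ z, ‖z‖ ≤ R → ‖g z‖ ≤ M := fun z hz => norm_le_of_sphere hg hR hM hz
  have hM0 : 0 < M := g0.trans_le (hgM 0 (by simpa using hR.le))
  have hwb : w ∈ ball (0 : ℂ) (3 / 4 * R) := by
    rw [mem_ball_zero_iff]; linarith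
  have hharm : InnerProductSpace.HarmonicOnNhd (fun z => Real.log ‖g z‖) (ball 0 (3 / 4 * R)) :=
    fun z hz' => ((hg.analyticAt z).harmonicAt_log_norm (hz z hz'))
  obtain ⟨F, hF, hFre⟩ := hharm.exists_analyticOnNhd_ball_re_eq
  -- The summand `1` makes the bound on the real part positive, as Borel–Carathéodory needs; it is
  -- the source of `exp 4`.
  set A := Real.log M - Real.log ‖g 0‖ + 1 with hA
  have hA0 : 0 < A := by
    have := Real.log_le_log g0 (hgM 0 (by simpa using hR.le))
    linarith
  have h0 : (0 : ℂ) ∈ ball (0 : ℂ) (3 / 4 * R) := by simpa using hR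
  have hbc := Complex.borelCaratheodory_zero (f := fun z => F z - F 0) (M := A)
    (R := 3 / 4 * R) (z := w) hA0
    (hF.differentiableOn.sub_const _) (fun z hz' => by
      have e1 := hFre hz'
      have e2 := hFre h0
      simp only at e1 e2
      simp only [Set.mem_ofPred_eq, Complex.sub_re, e1, e2]
      have : Real.log ‖g z‖ ≤ Real.log M :=
        Real.log_le_log (norm_pos_iff.2 (hz z hz')) (hgM z (by
          rw [mem_ball_zero_iff] at hz'; linarith))
      linarith) hR' hwb (by simp)
  have hbc2 : 2 * A * ‖w‖ / (3 / 4 * R - ‖w‖) ≤ 4 * A := by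
    rw [div_le_iff₀ (by linarith)]
    nlinarith
  have e1 := hFre hwb
  have e2 := hFre h0
  simp only at e1 e2
  have h3 : Real.log ‖g 0‖ - Real.log ‖g w‖ ≤ 4 * A := by
    rw [← e1, ← e2, ← Complex.sub_re]
    refine (Complex.re_le_norm _).trans ?_
    rw [norm_sub_rev]
    exact hbc.trans hbc2
  have gw : 0 < ‖g w‖ := norm_pos_iff.2 (hz w hwb)
  have h4 : 5 * Real.log ‖g 0‖ ≤ 4 + 4 * Real.log M + Real.log ‖g w‖ := by linarith
  have h5 := Real.exp_le_exp.2 h4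
  rw [Real.exp_add, Real.exp_add, Real.exp_log gw, mul_comm (5 : ℝ), mul_comm (4 : ℝ) (Real.log M),
    Real.exp_mul, Real.exp_mul, Real.exp_log g0, Real.exp_log hM0] at h5
  exact_mod_cast h5

/-- Zeros of `g` in the disc of radius `3R/4` are divided out by Blaschke factors. This keeps `|g|`
on the circle and multiplies `|g 0|` by at least `4/3`. As `|g 0| ≤ M` by the maximum principle, the
hypothesis on `n` bounds the number of removals; once no zero is left, the lower bound for `g`
applies. The final estimate does not depend on `n`. -/
theorem norm_quotient_le {R M N : ℝ} (hR : 0 < R) {E : ℂ → ℂ} (hE : Differentiable ℂ E) {w : ℂ}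
    (hw : ‖w‖ ≤ R / 2) (n : ℕ) :
    ∀ g : ℂ → ℂ, Differentiable ℂ g → (∀ z ∈ sphere (0 : ℂ) R, ‖g z‖ ≤ M) →
      (∀ z ∈ sphere (0 : ℂ) R, ‖E z * g z‖ ≤ N) → M < (4 / 3) ^ n * ‖g 0‖ →
      ‖E w‖ * ‖g 0‖ ^ 5 ≤ Real.exp 4 * M ^ 4 * N := by
  induction n with
  | zero =>
    intro g hg hM _ hlt
    have := norm_le_of_sphere hg hR hM (w := 0) (by simpa using hR.le)
    linarith
  | succ n ih =>
    intro g hg hM hN hlt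
    have hM0 : 0 ≤ M := (norm_nonneg _).trans
      (norm_le_of_sphere hg hR hM (w := 0) (by simpa using hR.le))
    by_cases hz : ∀ z ∈ ball (0 : ℂ) (3 / 4 * R), g z ≠ 0
    · have h1 := norm_lower_bound_of_ne_zero hg hR hM hz hw
      have h2 := norm_le_of_sphere (hE.mul hg) hR (B := N) (fun z hz => hN z hz) (w := w)
        (by linarith)
      rw [Pi.mul_apply, norm_mul] at h2
      calc ‖E w‖ * ‖g 0‖ ^ 5 ≤ ‖E w‖ * (Real.exp 4 * M ^ 4 * ‖g w‖) := by gcongr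
        _ = Real.exp 4 * M ^ 4 * (‖E w‖ * ‖g w‖) := by ring
        _ ≤ Real.exp 4 * M ^ 4 * N := by gcongr
    · push Not at hz
      obtain ⟨a, ha, hga⟩ := hz
      rw [mem_ball_zero_iff] at ha
      have hg00 : 0 < ‖g 0‖ := by
        by_contra hcon
        have : ‖g 0‖ = 0 := le_antisymm (not_lt.1 hcon) (norm_nonneg _)
        rw [this, mul_zero] at hlt
        linarith
      have ha0 : a ≠ 0 := by
        rintro rfl
        simp [hga] at hg00
      have hRc : (R : ℂ) ≠ 0 := by exact_mod_cast hR.ne'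
      -- `dslope` is `g z / (z - a)` extended across `a`. On the circle `R² = z z̄`, so the second
      -- factor has modulus `|z - a|` there.
      set g₁ : ℂ → ℂ := fun z => dslope g a z * ((R ^ 2 - (starRingEnd ℂ) a * z) / R) with hg₁
      have hds : Differentiable ℂ (dslope g a) := by
        rw [← differentiableOn_univ, Complex.differentiableOn_dslope univ_mem]
        exact hg.differentiableOn
      have hd₁ : Differentiable ℂ g₁ := hds.mul (by fun_prop)
      have hsl : ∀ z, z ≠ a → (z - a) * dslope g a z = g z := by
        intro z hz
        have := sub_smul_dslope g a z
        rwa [hga, sub_zero, smul_eq_mul] at this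
      have hsph : ∀ z ∈ sphere (0 : ℂ) R, ‖g₁ z‖ = ‖g z‖ := by
        intro z hz
        rw [mem_sphere_zero_iff_norm] at hz
        have hza : z ≠ a := by
          rintro rfl
          linarith
        have : (R : ℂ) ^ 2 - (starRingEnd ℂ) a * z = z * (starRingEnd ℂ) (z - a) := by
          have : z * (starRingEnd ℂ) z = (R : ℂ) ^ 2 := by
            rw [Complex.mul_conj, Complex.normSq_eq_norm_sq, hz]; push_cast; rfl
          rw [map_sub, mul_sub, this]; ring
        rw [hg₁]
        simp only
        rw [this, ← hsl z hza, norm_mul, norm_div, norm_mul, norm_mul, hz, Complex.norm_real,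
          Real.norm_of_nonneg hR.le, RCLike.norm_conj]
        field_simp
      have h0 : ‖g₁ 0‖ = ‖g 0‖ * (R / ‖a‖) := by
        have e := hsl 0 ha0.symm
        simp only [hg₁]
        rw [← e, norm_mul, norm_mul, mul_zero, sub_zero, zero_sub, norm_neg, norm_div, norm_pow,
          Complex.norm_real, Real.norm_of_nonneg hR.le]
        have : ‖a‖ ≠ 0 := norm_ne_zero_iff.2 ha0
        field_simp
      have hR43 : 4 / 3 ≤ R / ‖a‖ := by
        rw [le_div_iff₀ (norm_pos_iff.2 ha0)]
        linarith
      have hlow : ‖g 0‖ * (4 / 3) ≤ ‖g₁ 0‖ := by rw [h0]; gcongr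
      have h01 : ‖g 0‖ ≤ ‖g₁ 0‖ := by linarith
      have := ih g₁ hd₁ (fun z hz => (hsph z hz).trans_le (hM z hz))
        (fun z hz => by
          rw [norm_mul, hsph z hz, ← norm_mul]; exact hN z hz)
        (hlt.trans_le (by rw [pow_succ, mul_assoc]; gcongr; linarith))
      exact le_trans (by gcongr) this

/-- The quotient estimate is applied on a disc about a point `c` where `g` does not vanish, with
radius comparable to `1 + |w - c|`. -/
theorem QuarterGrowth.of_mul {E g : ℂ → ℂ} (hE : Differentiable ℂ E) (hg : Differentiable ℂ g)
    (hgG : QuarterGrowth g) (hfG : QuarterGrowth (fun z => E z * g z)) {c : ℂ} (hc : g c ≠ 0) :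
    QuarterGrowth E := by
  obtain ⟨C, hC, h1⟩ := hgG
  obtain ⟨D, hD, h2⟩ := hfG
  -- Chosen because `1 + |c + z| ≤ (3 + 3|c|)(1 + |w|)` on the circle.
  set κ : ℝ := (3 + 3 * ‖c‖) ^ (1 / 4 : ℝ) with hκ
  have hκ0 : 0 ≤ κ := by positivity
  have hcp : 0 < ‖g c‖ := norm_pos_iff.2 hc
  set δ : ℝ := (‖g c‖ ^ 5)⁻¹ with hδ
  have hδ0 : 0 ≤ δ := by positivity
  refine ⟨δ + 4 + 4 * (C * κ) + D * κ, by positivity, fun w => ?_⟩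
  set σ : ℝ := (1 + ‖w‖) ^ (1 / 4 : ℝ) with hσ
  have hσ1 : 1 ≤ σ := one_le_rpow_quarter w
  set R : ℝ := 2 * (‖w - c‖ + 1) with hR
  have hR0 : 0 < R := by positivity
  have hbd : ∀ z ∈ sphere (0 : ℂ) R, (1 + ‖c + z‖) ^ (1 / 4 : ℝ) ≤ κ * σ := by
    intro z hz
    rw [mem_sphere_zero_iff_norm] at hz
    rw [hκ, hσ, ← Real.mul_rpow (by positivity) (by positivity)]
    refine Real.rpow_le_rpow (by positivity) ?_ (by norm_num)
    have e1 : ‖c + z‖ ≤ ‖c‖ + R := by rw [← hz]; exact norm_add_le _ _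
    have e2 : ‖w - c‖ ≤ ‖w‖ + ‖c‖ := norm_sub_le _ _
    nlinarith [norm_nonneg w, norm_nonneg c, mul_nonneg (norm_nonneg w) (norm_nonneg c)]
  set M : ℝ := Real.exp (C * (κ * σ)) with hM
  set N : ℝ := Real.exp (D * (κ * σ)) with hN
  obtain ⟨n, hn⟩ := pow_unbounded_of_one_lt (M / ‖g c‖) (by norm_num : (1 : ℝ) < 4 / 3)
  rw [div_lt_iff₀ hcp] at hn
  have key := norm_quotient_le (M := M) (N := N) hR0 (E := fun z => E (c + z))
    (hE.comp (by fun_prop)) (w := w - c) (by rw [hR]; linarith) n (fun z => g (c + z))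
    (hg.comp (by fun_prop)) (fun z hz => (h1 _).trans (Real.exp_le_exp.2 (by
      exact mul_le_mul_of_nonneg_left (hbd z hz) hC)))
    (fun z hz => (h2 _).trans (Real.exp_le_exp.2 (by
      exact mul_le_mul_of_nonneg_left (hbd z hz) hD))) (by simpa using hn)
  simp only [add_sub_cancel, add_zero] at key
  rw [← le_div_iff₀ (by positivity), div_eq_mul_inv, ← hδ] at key
  have e3 : δ ≤ Real.exp δ := by linarith [Real.add_one_le_exp δ]
  have e4 : M ^ 4 = Real.exp (4 * (C * κ) * σ) := by
    rw [hM, ← Real.exp_nat_mul]; push_cast; ring_nf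
  calc ‖E w‖ ≤ Real.exp 4 * M ^ 4 * N * δ := key
    _ ≤ Real.exp 4 * M ^ 4 * N * Real.exp δ := by gcongr
    _ = Real.exp (4 + 4 * (C * κ) * σ + D * κ * σ + δ) := by
        rw [e4, hN, ← Real.exp_add, ← Real.exp_add, ← Real.exp_add]; ring_nf
    _ ≤ _ := Real.exp_le_exp.2 (by nlinarith)

/-- The angle `(arg z + π) / 4` lies in `(0, π/2]`. The map `w ↦ -4 w ^ 4` takes both sides of the
first quadrant to the negative real ray, so a bound on that one ray bounds both sides. -/
theorem exists_quadrant_fourth_root (z : ℂ) :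
    ∃ w : ℂ, 0 ≤ w.re ∧ 0 ≤ w.im ∧ -4 * w ^ 4 = z := by
  set s : ℝ := (‖z‖ / 4) ^ (1 / 4 : ℝ) with hs
  have hs0 : 0 ≤ s := by positivity
  have hs4 : s ^ 4 = ‖z‖ / 4 := by
    rw [hs, ← Real.rpow_natCast, ← Real.rpow_mul (by positivity)]; norm_num
  set θ : ℝ := (z.arg + Real.pi) / 4 with hθ
  have h1 := Complex.neg_pi_lt_arg z
  have h2 := Complex.arg_le_pi z
  refine ⟨s * Complex.exp (θ * Complex.I), ?_, ?_, ?_⟩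
  · rw [Complex.re_ofReal_mul, Complex.exp_ofReal_mul_I_re]
    exact mul_nonneg hs0 (Real.cos_nonneg_of_mem_Icc ⟨by linarith, by linarith⟩)
  · rw [Complex.im_ofReal_mul, Complex.exp_ofReal_mul_I_im]
    exact mul_nonneg hs0 (Real.sin_nonneg_of_nonneg_of_le_pi (by linarith) (by linarith))
  · rw [mul_pow, ← Complex.exp_nat_mul]
    have : ((4 : ℕ) : ℂ) * (θ * Complex.I) = z.arg * Complex.I + Real.pi * Complex.I := by
      rw [hθ]; push_cast; ring
    rw [this, Complex.exp_add, Complex.exp_pi_mul_I]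
    have e : (s : ℂ) ^ 4 = ‖z‖ / 4 := by exact_mod_cast congrArg (fun x : ℝ => (x : ℂ)) hs4
    rw [e]
    conv_rhs => rw [← Complex.norm_mul_exp_arg_mul_I z]
    ring

/-- In the variable `w`, `z = -4 w ^ 4`, the growth is of exponential type, below the critical order
two of a quadrant. Phragmén–Lindelöf bounds the function on the whole plane, and Liouville makes it
constant. -/
theorem QuarterGrowth.eq_const_of_bounded_ray {E : ℂ → ℂ} (hE : Differentiable ℂ E)
    (hG : QuarterGrowth E) {B : ℝ} (hB : ∀ r : ℝ, 0 ≤ r → ‖E (-4 * (r : ℂ) ^ 4)‖ ≤ B) (z w : ℂ) :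
    E z = E w := by
  have hbdd : ∀ z, ‖E z‖ ≤ B := by
    intro z
    obtain ⟨w, hre, him, rfl⟩ := exists_quadrant_fourth_root z
    obtain ⟨C, hC, h1⟩ := hG
    refine PhragmenLindelof.quadrant_I (f := fun w => E (-4 * w ^ 4))
      (hE.comp (by fun_prop)).diffContOnCl ⟨1, by norm_num, 4 * C, ?_⟩ (fun x hx => hB x hx)
      (fun x hx => ?_) hre him
    · refine Asymptotics.IsBigO.of_bound (Real.exp (4 * C)) ?_
      filter_upwards with u
      rw [Real.norm_of_nonneg (Real.exp_pos _).le, ← Real.exp_add, Real.rpow_one]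
      refine (h1 _).trans (Real.exp_le_exp.2 ?_)
      have : (1 + ‖-4 * u ^ 4‖) ^ (1 / 4 : ℝ) ≤ 4 * (1 + ‖u‖) := by
        calc (1 + ‖-4 * u ^ 4‖) ^ (1 / 4 : ℝ) ≤ ((4 * (1 + ‖u‖)) ^ (4 : ℝ)) ^ (1 / 4 : ℝ) := by
              refine Real.rpow_le_rpow (by positivity) ?_ (by norm_num)
              rw [norm_mul, norm_pow, norm_neg, Complex.norm_ofNat]
              have : (4 * (1 + ‖u‖)) ^ (4 : ℝ) = 256 * (1 + ‖u‖) ^ 4 := by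
                rw [show (4 : ℝ) = ((4 : ℕ) : ℝ) by norm_num, Real.rpow_natCast]; push_cast; ring
              rw [this]
              have h0 := norm_nonneg u
              have : 1 + ‖u‖ ^ 4 ≤ (1 + ‖u‖) ^ 4 := by
                have : (1 + ‖u‖) ^ 4 = 1 + ‖u‖ ^ 4 + (4 * ‖u‖ + 6 * ‖u‖ ^ 2 + 4 * ‖u‖ ^ 3) := by ring
                rw [this]
                have : 0 ≤ 4 * ‖u‖ + 6 * ‖u‖ ^ 2 + 4 * ‖u‖ ^ 3 := by positivity
                linarith
              nlinarith [pow_nonneg h0 4]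
          _ = 4 * (1 + ‖u‖) := by
              rw [← Real.rpow_mul (by positivity)]; norm_num
      nlinarith
    · have : ((x : ℂ) * Complex.I) ^ 4 = (x : ℂ) ^ 4 := by
        rw [mul_pow, Complex.I_pow_four, mul_one]
      simp only [this]
      exact hB x hx
  refine hE.apply_eq_apply_of_bounded ?_ z w
  exact isBounded_iff_forall_norm_le.2 ⟨B, by rintro _ ⟨z, rfl⟩; exact hbdd z⟩

theorem bounded_ray_of_tendsto {E : ℂ → ℂ} (hE : Continuous E) {L : ℂ}
    (hL : Tendsto (fun r : ℝ => E (-4 * (r : ℂ) ^ 4)) atTop (𝓝 L)) :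
    ∃ B : ℝ, ∀ r : ℝ, 0 ≤ r → ‖E (-4 * (r : ℂ) ^ 4)‖ ≤ B := by
  have h1 := hL.norm.eventually (gt_mem_nhds (show ‖L‖ < ‖L‖ + 1 by linarith))
  obtain ⟨r₀, hr₀⟩ := eventually_atTop.1 h1
  have hc : Continuous fun r : ℝ => E (-4 * (r : ℂ) ^ 4) := by fun_prop
  obtain ⟨B, hB⟩ := (isCompact_Icc (a := (0 : ℝ)) (b := r₀)).exists_bound_of_continuousOn
    hc.continuousOn
  refine ⟨max B (‖L‖ + 1), fun r hr => ?_⟩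
  rcases le_total r r₀ with h | h
  · exact (hB r ⟨hr, h⟩).trans (le_max_left _ _)
  · exact (hr₀ r h).le.trans (le_max_right _ _)

theorem QuarterGrowth.eq_of_tendsto_ray {E : ℂ → ℂ} (hE : Differentiable ℂ E)
    (hG : QuarterGrowth E) {L : ℂ}
    (hL : Tendsto (fun r : ℝ => E (-4 * (r : ℂ) ^ 4)) atTop (𝓝 L)) (z : ℂ) : E z = L := by
  obtain ⟨B, hB⟩ := bounded_ray_of_tendsto hE.continuous hL
  refine tendsto_nhds_unique ?_ hL
  rw [show (fun r : ℝ => E (-4 * (r : ℂ) ^ 4)) = fun _ => E z from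
    funext fun r => hG.eq_const_of_bounded_ray hE hB _ _]
  exact tendsto_const_nhds

/-- The normal form of the meromorphic quotient has nonnegative order everywhere, so it is analytic;
the product identity crosses the isolated zeros of `g` by continuity. -/
theorem exists_entire_quotient {f g : ℂ → ℂ} (hf : Differentiable ℂ f) (hg : Differentiable ℂ g)
    {c : ℂ} (hc : g c ≠ 0) (hord : ∀ z, analyticOrderAt g z ≤ analyticOrderAt f z) :
    ∃ E : ℂ → ℂ, Differentiable ℂ E ∧ ∀ z, E z * g z = f z := by
  have hmero : MeromorphicOn (f / g) univ := fun z _ =>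
    (hf.analyticAt z).meromorphicAt.div (hg.analyticAt z).meromorphicAt
  have hgtop : ∀ z, analyticOrderAt g z ≠ ⊤ := by
    intro z hz
    rw [analyticOrderAt_eq_top] at hz
    have := AnalyticOnNhd.eqOn_zero_of_preconnected_of_eventuallyEq_zero
      (fun w _ => hg.analyticAt w) isPreconnected_univ (mem_univ z) hz
    exact hc (this (mem_univ c))
  set E := toMeromorphicNFOn (f / g) univ with hE
  have hEa : ∀ z, AnalyticAt ℂ E z := by
    intro z
    have hnf : MeromorphicNFAt E z := meromorphicNFOn_toMeromorphicNFOn _ _ (mem_univ z)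
    rw [← hnf.meromorphicOrderAt_nonneg_iff_analyticAt, hE,
      meromorphicOrderAt_toMeromorphicNFOn hmero (mem_univ z),
      meromorphicOrderAt_div (hf.analyticAt z).meromorphicAt (hg.analyticAt z).meromorphicAt,
      (hf.analyticAt z).meromorphicOrderAt_eq, (hg.analyticAt z).meromorphicOrderAt_eq]
    have h1 := hord z
    have h2 := hgtop z
    generalize analyticOrderAt g z = a at h1 h2
    generalize analyticOrderAt f z = b at h1
    lift a to ℕ using h2
    induction b with
    | top => simp
    | coe b =>
      have h3 : a ≤ b := by exact_mod_cast h1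
      simp only [ENat.map_natCast]
      have h4 : (0 : ℤ) ≤ (b : ℤ) - a := by omega
      exact_mod_cast h4
  refine ⟨E, fun z => (hEa z).differentiableAt, fun z => ?_⟩
  have h1 : E =ᶠ[𝓝[≠] z] f / g :=
    MeromorphicOn.toMeromorphicNFOn_eq_self_on_nhdsNE hmero (mem_univ z)
  have h2 : ∀ᶠ w in 𝓝[≠] z, g w ≠ 0 := by
    rcases (hg.analyticAt z).eventually_eq_zero_or_eventually_ne_zero with h | h
    · exact absurd (analyticOrderAt_eq_top.2 h) (hgtop z)
    · exact h
  have h3 : ∀ᶠ w in 𝓝[≠] z, E w * g w = f w := by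
    filter_upwards [h1, h2] with w e1 e2
    rw [e1, Pi.div_apply, div_mul_cancel₀ _ e2]
  have hc1 : Tendsto (fun w => E w * g w) (𝓝[≠] z) (𝓝 (E z * g z)) :=
    ((hEa z).continuousAt.mul hg.continuous.continuousAt).tendsto.mono_left nhdsWithin_le_nhds
  have hc2 : Tendsto f (𝓝[≠] z) (𝓝 (f z)) :=
    hf.continuous.continuousAt.tendsto.mono_left nhdsWithin_le_nhds
  exact tendsto_nhds_unique hc1 (hc2.congr' (h3.mono fun w hw => hw.symm))

/-- Two entire functions of growth order at most `1/4` whose quotient has no poles and has a limit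
along the negative real axis are proportional. -/
theorem eq_const_mul_of_tendsto_ray {f g : ℂ → ℂ} (hf : Differentiable ℂ f)
    (hg : Differentiable ℂ g) (hfG : QuarterGrowth f) (hgG : QuarterGrowth g)
    (hord : ∀ z, analyticOrderAt g z ≤ analyticOrderAt f z)
    (hne : ∀ᶠ r : ℝ in atTop, g (-4 * (r : ℂ) ^ 4) ≠ 0) {L : ℂ}
    (hL : Tendsto (fun r : ℝ => f (-4 * (r : ℂ) ^ 4) / g (-4 * (r : ℂ) ^ 4)) atTop (𝓝 L)) (z : ℂ) :
    f z = L * g z := by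
  obtain ⟨r₀, hr₀⟩ := hne.exists
  obtain ⟨E, hE, hEg⟩ := exists_entire_quotient hf hg hr₀ hord
  have hEG : QuarterGrowth E := QuarterGrowth.of_mul hE hg hgG (by simpa only [hEg] using hfG) hr₀
  rw [← hEg, hEG.eq_of_tendsto_ray hE (L := L) ?_ z]
  refine hL.congr' (hne.mono fun r hr => ?_)
  rw [← hEg, mul_div_cancel_right₀ _ hr]

end FourthOrder

/-! ### Codimension of the range of a matrix of power series -/

namespace FourthOrder

/-- In the chain `range (f ∘ g) ≤ range f ≤ V`, the injective `f` identifies the lower quotient with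
`V ⧸ range g`. -/
theorem rank_quotient_range_comp {K V : Type*} [Field K] [AddCommGroup V] [Module K V]
    (f g : V →ₗ[K] V) (hf : Function.Injective f) :
    Module.rank K (V ⧸ LinearMap.range (f ∘ₗ g)) =
      Module.rank K (V ⧸ LinearMap.range f) + Module.rank K (V ⧸ LinearMap.range g) := by
  set S := LinearMap.range (f ∘ₗ g)
  have hS : S ≤ LinearMap.range f := LinearMap.range_comp_le_range g f
  have e1 := (Submodule.quotientQuotientEquivQuotient S (LinearMap.range f) hS).rank_eq
  have e2 := Submodule.rank_quotient_add_rank ((LinearMap.range f).map S.mkQ)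
  rw [← LinearMap.range_comp] at e2 e1
  have hker : LinearMap.ker (S.mkQ ∘ₗ f) = LinearMap.range g := by
    ext v
    simp only [LinearMap.mem_ker, LinearMap.comp_apply, Submodule.mkQ_apply,
      Submodule.Quotient.mk_eq_zero, S, LinearMap.mem_range]
    exact ⟨fun ⟨w, hw⟩ => ⟨w, hf hw⟩, fun ⟨w, hw⟩ => ⟨w, congrArg f hw⟩⟩
  have e3 := (LinearMap.quotKerEquivRange (S.mkQ ∘ₗ f)).rank_eq
  rw [hker] at e3
  rw [← e2, e1, e3]

section Corank

open PowerSeries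

variable {K : Type*} [Field K]

/-- The linear map of a matrix of power series, over the field of coefficients. -/
def powerSeriesMap (D : Matrix (Fin 2) (Fin 2) K⟦X⟧) : (Fin 2 → K⟦X⟧) →ₗ[K] (Fin 2 → K⟦X⟧) :=
  D.mulVecLin.restrictScalars K

theorem powerSeriesMap_apply (D : Matrix (Fin 2) (Fin 2) K⟦X⟧) (v : Fin 2 → K⟦X⟧) :
    powerSeriesMap D v = D.mulVec v := rfl

theorem powerSeriesMap_mul (D E : Matrix (Fin 2) (Fin 2) K⟦X⟧) :
    powerSeriesMap (D * E) = powerSeriesMap D ∘ₗ powerSeriesMap E := by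
  refine LinearMap.ext fun v => ?_
  rw [LinearMap.comp_apply, powerSeriesMap_apply, powerSeriesMap_apply, powerSeriesMap_apply,
    Matrix.mulVec_mulVec]

theorem powerSeriesMap_injective {D : Matrix (Fin 2) (Fin 2) K⟦X⟧} (hD : D.det ≠ 0) :
    Function.Injective (powerSeriesMap D) := by
  rw [← LinearMap.ker_eq_bot, LinearMap.ker_eq_bot']
  intro v hv
  by_contra hne
  exact hD (Matrix.exists_mulVec_eq_zero_iff.1 ⟨v, hne, hv⟩)

/-- The codimension of the range is the order of the determinant. -/
def CorankEqOrder (D : Matrix (Fin 2) (Fin 2) K⟦X⟧) : Prop :=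
  D.det ≠ 0 ∧ Module.rank K ((Fin 2 → K⟦X⟧) ⧸ LinearMap.range (powerSeriesMap D)) =
    (D.det.order.toNat : Cardinal)

theorem CorankEqOrder.mul {D E : Matrix (Fin 2) (Fin 2) K⟦X⟧} (hD : CorankEqOrder D)
    (hE : CorankEqOrder E) : CorankEqOrder (D * E) := by
  refine ⟨by rw [Matrix.det_mul]; exact mul_ne_zero hD.1 hE.1, ?_⟩
  rw [powerSeriesMap_mul, rank_quotient_range_comp _ _ (powerSeriesMap_injective hD.1), hD.2, hE.2,
    Matrix.det_mul, order_mul, ENat.toNat_add (order_eq_top.not.2 hD.1) (order_eq_top.not.2 hE.1)]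
  push_cast
  rfl

theorem corankEqOrder_of_isUnit {D : Matrix (Fin 2) (Fin 2) K⟦X⟧} (hD : IsUnit D.det) :
    CorankEqOrder D := by
  refine ⟨hD.ne_zero, ?_⟩
  have : LinearMap.range (powerSeriesMap D) = ⊤ := by
    rw [LinearMap.range_eq_top]
    intro v
    refine ⟨D⁻¹.mulVec v, ?_⟩
    rw [powerSeriesMap_apply, Matrix.mulVec_mulVec, Matrix.mul_nonsing_inv _ hD, Matrix.one_mulVec]
  rw [this, order_zero_of_unit hD]
  simp

/-- The range is the kernel of the constant coefficient of the first component. -/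
theorem corankEqOrder_X : CorankEqOrder (!![X, 0; 0, 1] : Matrix (Fin 2) (Fin 2) K⟦X⟧) := by
  have hdet : (!![X, 0; 0, 1] : Matrix (Fin 2) (Fin 2) K⟦X⟧).det = X := by simp
  refine ⟨by rw [hdet]; exact X_ne_zero, ?_⟩
  set φ : (Fin 2 → K⟦X⟧) →ₗ[K] K := (coeff 0).restrictScalars K ∘ₗ LinearMap.proj 0 with hφ
  have hsurj : Function.Surjective φ := fun c => ⟨fun _ => PowerSeries.C c, by simp [hφ]⟩
  have hker : LinearMap.ker φ = LinearMap.range (powerSeriesMap !![X, 0; 0, 1]) := by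
    ext v
    simp only [LinearMap.mem_ker, LinearMap.mem_range, powerSeriesMap_apply]
    constructor
    · intro hv
      obtain ⟨w, hw⟩ := X_dvd_iff.2 (show constantCoeff (v 0) = 0 by simpa [hφ] using hv)
      refine ⟨![w, v 1], ?_⟩
      ext1 i
      fin_cases i <;> simp [hw, Matrix.mulVec, dotProduct]
    · rintro ⟨w, rfl⟩
      simp [hφ, dotProduct]
  rw [hdet, order_X, ← hker, (LinearMap.quotKerEquivOfSurjective φ hsurj).rank_eq]
  simp

/-- A nonzero series is a power of `X` times a unit, so multiplicativity reduces to `X`. -/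
theorem corankEqOrder_diag {a : K⟦X⟧} (ha : a ≠ 0) :
    CorankEqOrder (!![a, 0; 0, 1] : Matrix (Fin 2) (Fin 2) K⟦X⟧) := by
  have hpow : ∀ n : ℕ, CorankEqOrder (!![X ^ n, 0; 0, 1] : Matrix (Fin 2) (Fin 2) K⟦X⟧) := by
    intro n
    induction n with
    | zero => exact corankEqOrder_of_isUnit (by simp)
    | succ n ih =>
      have := ih.mul corankEqOrder_X
      simpa [Matrix.mul_fin_two, pow_succ] using this
  have hu : IsUnit (divXPowOrder a) := by
    rw [isUnit_iff_constantCoeff, isUnit_iff_ne_zero, constantCoeff_divXPowOrder]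
    exact coeff_order ha
  have := (hpow a.order.toNat).mul (corankEqOrder_of_isUnit
    (D := !![divXPowOrder a, 0; 0, 1]) (by simpa using hu))
  simpa [Matrix.mul_fin_two, X_pow_order_mul_divXPowOrder] using this

theorem corankEqOrder_swap :
    CorankEqOrder (!![0, 1; 1, 0] : Matrix (Fin 2) (Fin 2) K⟦X⟧) :=
  corankEqOrder_of_isUnit (by simp)

/-- Elimination: with `b = a t` the matrix factors into unipotent matrices and the diagonal entries
`a` and `d - c t`; the two swaps put the latter in the lower corner. -/
theorem corankEqOrder_of_dvd {a b c d : K⟦X⟧} (hD : (!![a, b; c, d]).det ≠ 0) (hab : a ∣ b) :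
    CorankEqOrder (!![a, b; c, d] : Matrix (Fin 2) (Fin 2) K⟦X⟧) := by
  obtain ⟨t, rfl⟩ := hab
  rw [Matrix.det_fin_two_of, show a * d - a * t * c = a * (d - c * t) by ring] at hD
  have ha := left_ne_zero_of_mul hD
  have hd := right_ne_zero_of_mul hD
  have h1 := (((corankEqOrder_diag ha).mul (corankEqOrder_of_isUnit (D := !![1, 0; c, 1])
    (by simp))).mul ((corankEqOrder_swap.mul (corankEqOrder_diag hd)).mul corankEqOrder_swap)).mul
    (corankEqOrder_of_isUnit (D := !![1, t; 0, 1]) (by simp))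
  simpa [Matrix.mul_fin_two] using h1

/-- Power series over a field form a valuation ring, so one entry of the first row divides the
other, if need be after a swap of columns. -/
theorem corankEqOrder {D : Matrix (Fin 2) (Fin 2) K⟦X⟧} (hD : D.det ≠ 0) : CorankEqOrder D := by
  rw [Matrix.eta_fin_two D] at hD ⊢
  rcases ValuationRing.dvd_total (D 0 0) (D 0 1) with h | h
  · exact corankEqOrder_of_dvd hD h
  · have := (corankEqOrder_of_dvd (a := D 0 1) (b := D 0 0) (c := D 1 1) (d := D 1 0)
      (by rw [Matrix.det_fin_two_of] at hD ⊢; intro h0; exact hD (by linear_combination -h0))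
      h).mul corankEqOrder_swap
    simpa [Matrix.mul_fin_two] using this

end Corank

/-! ### Taylor series and orders of zeros -/

section Taylor

open PowerSeries

/-- `φ` is the Taylor series of `f` at `μ`. -/
def HasTaylor (f : ℂ → ℂ) (μ : ℂ) (φ : ℂ⟦X⟧) : Prop :=
  ∀ᶠ t in 𝓝 (0 : ℂ), HasSum (fun n => t ^ n * coeff n φ) (f (μ + t))

theorem HasTaylor.sub {f g : ℂ → ℂ} {μ : ℂ} {φ ψ : ℂ⟦X⟧} (hf : HasTaylor f μ φ)
    (hg : HasTaylor g μ ψ) : HasTaylor (fun z => f z - g z) μ (φ - ψ) := by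
  filter_upwards [hf, hg] with t h1 h2
  simpa [mul_sub] using h1.sub h2

theorem HasTaylor.mul {f g : ℂ → ℂ} {μ : ℂ} {φ ψ : ℂ⟦X⟧} (hf : HasTaylor f μ φ)
    (hg : HasTaylor g μ ψ) : HasTaylor (fun z => f z * g z) μ (φ * ψ) := by
  filter_upwards [hf, hg] with t h1 h2
  have n1 := h1.summable.norm
  have n2 := h2.summable.norm
  have e : (fun n => t ^ n * coeff n (φ * ψ)) = fun n => ∑ kl ∈ Finset.HasAntidiagonal.antidiagonal n,
      (t ^ kl.1 * coeff kl.1 φ) * (t ^ kl.2 * coeff kl.2 ψ) := by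
    ext n
    rw [coeff_mul, Finset.mul_sum]
    refine Finset.sum_congr rfl fun kl hkl => ?_
    rw [← Finset.HasAntidiagonal.mem_antidiagonal.1 hkl, pow_add]
    ring
  have hs := (summable_norm_sum_mul_antidiagonal_of_summable_norm n1 n2).of_norm
  rw [e, ← h1.tsum_eq, ← h2.tsum_eq, tsum_mul_tsum_eq_tsum_sum_antidiagonal_of_summable_norm n1 n2]
  exact hs.hasSum

theorem HasTaylor.hasFPowerSeriesAt {f : ℂ → ℂ} {μ : ℂ} {φ : ℂ⟦X⟧} (hf : HasTaylor f μ φ) :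
    HasFPowerSeriesAt f (FormalMultilinearSeries.ofScalars ℂ fun n => coeff n φ) μ := by
  rw [hasFPowerSeriesAt_iff]
  unfold HasTaylor at hf
  simpa using hf

theorem HasTaylor.analyticOrderAt_eq {f : ℂ → ℂ} {μ : ℂ} {φ : ℂ⟦X⟧} (hf : HasTaylor f μ φ) :
    analyticOrderAt f μ = φ.order := by
  by_cases hφ : φ = 0
  · rw [hφ, order_zero, analyticOrderAt_eq_top]
    have : ∀ᶠ t in 𝓝 (0 : ℂ), f (μ + t) = 0 := by
      filter_upwards [hf] with t ht
      rw [hφ] at ht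
      simp only [map_zero, mul_zero] at ht
      exact ht.unique hasSum_zero
    have h2 : Filter.Tendsto (fun z => z - μ) (𝓝 μ) (𝓝 0) := by
      have : Continuous fun z : ℂ => z - μ := by fun_prop
      simpa using this.tendsto μ
    filter_upwards [h2.eventually this] with z hz
    simpa using hz
  · have hp := hf.hasFPowerSeriesAt
    -- The series divided by its power of `X` still converges and represents the analytic cofactor,
    -- which is nonzero at `μ`.
    have hg : HasTaylor (fun z => if z = μ then coeff 0 (divXPowOrder φ) else
        f z / (z - μ) ^ φ.order.toNat) μ (divXPowOrder φ) := by
      filter_upwards [hf] with t ht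
      by_cases h0 : t = 0
      · subst h0
        simp only [add_zero, if_true]
        convert hasSum_single (f := fun n => (0 : ℂ) ^ n * coeff n (divXPowOrder φ)) 0
          (fun n hn => by simp [hn]) using 1
        simp
      · simp only [add_eq_left, h0, if_false, add_sub_cancel_left]
        rw [← hasSum_nat_add_iff' φ.order.toNat] at ht
        rw [Finset.sum_eq_zero (fun i hi => by
          rw [coeff_of_lt_order_toNat i (Finset.mem_range.1 hi), mul_zero]), sub_zero] at ht
        have e : (fun n => t ^ n * coeff n (divXPowOrder φ)) = fun n =>
            t ^ (n + φ.order.toNat) * coeff (n + φ.order.toNat) φ / t ^ φ.order.toNat := by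
          ext n
          rw [coeff_divXPowOrder, pow_add]
          field_simp
        rw [e]
        exact ht.div_const _
    rw [← coe_toNat_order hφ, hp.analyticAt.analyticOrderAt_eq_natCast]
    refine ⟨_, hg.hasFPowerSeriesAt.analyticAt, ?_, ?_⟩
    · simp only [if_true, coeff_divXPowOrder, zero_add]
      exact coeff_order hφ
    · have h2 : ∀ᶠ z in 𝓝 μ, HasSum (fun n => (z - μ) ^ n * coeff n φ) (f z) := by
        have h2 : Filter.Tendsto (fun z => z - μ) (𝓝 μ) (𝓝 0) := by
          have : Continuous fun z : ℂ => z - μ := by fun_prop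
          simpa using this.tendsto μ
        filter_upwards [h2.eventually hf] with z hz
        simpa using hz
      filter_upwards [h2] with z hz
      by_cases h0 : z = μ
      · subst h0
        simp only [sub_self, if_true, smul_eq_mul] at hz ⊢
        have h3 := hasSum_single (f := fun n => (0 : ℂ) ^ n * coeff n φ) 0
          (fun n hn => by simp [hn])
        rw [hz.unique h3]
        rcases Nat.eq_zero_or_pos φ.order.toNat with hN | hN
        · rw [coeff_divXPowOrder, hN]
        · rw [zero_pow hN.ne', zero_mul, coeff_of_lt_order_toNat 0 hN, mul_zero]
      · have : (z - μ) ^ φ.order.toNat ≠ 0 := pow_ne_zero _ (sub_ne_zero.2 h0)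
        simp only [h0, if_false, smul_eq_mul]
        field_simp

end Taylor

end FourthOrder

/-! ### Algebraic multiplicity as the order of a zero of a minor -/

namespace FourthOrder

theorem eqOn_zero_of_ae {g : ℝ → ℂ} (hg : ContinuousOn g (Icc 0 1))
    (h : ∀ᵐ x ∂(volume.restrict (Ioo (0 : ℝ) 1)), g x = 0) : ∀ x ∈ Icc (0 : ℝ) 1, g x = 0 := by
  rw [Measure.restrict_congr_set Ioo_ae_eq_Icc] at h
  exact Measure.eqOn_Icc_of_ae_eq volume zero_ne_one (g := fun _ => (0 : ℂ)) h hg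
    continuousOn_const

theorem HasACDeriv.ae_eq_zero {f g : ℝ → ℂ} (h : HasACDeriv f g)
    (hf : ∀ x ∈ Icc (0 : ℝ) 1, f x = 0) :
    ∀ᵐ x ∂(volume.restrict (Ioo (0 : ℝ) 1)), g x = 0 := by
  filter_upwards [h.2, ae_restrict_mem measurableSet_Ioo] with x hx hm
  refine hx.unique ((hasDerivAt_const x (0 : ℂ)).congr_of_eventuallyEq ?_)
  filter_upwards [isOpen_Ioo.mem_nhds hm] with y hy
  exact hf y (Ioo_subset_Icc_self hy)

theorem single_mulVec (w : Fin 4 → ℂ) :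
    (Matrix.single 3 0 1 : Matrix (Fin 4) (Fin 4) ℂ).mulVec w = Pi.single 3 (w 0) := by
  ext i
  fin_cases i <;> simp [Matrix.mulVec, dotProduct, Matrix.single_apply]

/-- If the first component of a solution of the inhomogeneous system vanishes, then so do the
solution and the inhomogeneity. -/
theorem IsLinearSol.eq_zero_of_fst {τ₁ τ₂ : ℝ → ℂ} {μ : ℂ} {Y Z : ℝ → Fin 4 → ℂ}
    (hY : IsLinearSol (sysMatrix τ₁ τ₂ μ)
      (fun x => (Matrix.single 3 0 1 : Matrix (Fin 4) (Fin 4) ℂ).mulVec (Z x)) Y)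
    (h0 : ∀ x ∈ Icc (0 : ℝ) 1, Y x 0 = 0) :
    (∀ x ∈ Icc (0 : ℝ) 1, Y x = 0) ∧
      ∀ᵐ x ∂(volume.restrict (Ioo (0 : ℝ) 1)), Z x 0 = 0 := by
  -- Once the components up to `i` vanish, the `i`-th equation leaves only component `i + 1`, or for
  -- `i = 3` the inhomogeneity.
  have hd : ∀ i, (∀ x ∈ Icc (0 : ℝ) 1, Y x i = 0) → ∀ᵐ x ∂(volume.restrict (Ioo (0 : ℝ) 1)),
      (assocMatrix τ₁ τ₂ x).mulVec (Y x) i + (Pi.single 3 (μ * Y x 0) : Fin 4 → ℂ) i +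
        (Pi.single 3 (Z x 0) : Fin 4 → ℂ) i = 0 := by
    intro i hi
    filter_upwards [(hY i).ae_eq_zero hi] with x hx
    simpa [sysMatrix_mulVec, single_mulVec] using hx
  have hm : ∀ᵐ x ∂(volume.restrict (Ioo (0 : ℝ) 1)), x ∈ Icc (0 : ℝ) 1 := by
    filter_upwards [ae_restrict_mem measurableSet_Ioo] with x hx using Ioo_subset_Icc_self hx
  have h1 : ∀ x ∈ Icc (0 : ℝ) 1, Y x 1 = 0 := by
    refine eqOn_zero_of_ae (hY 1).continuousOn ?_
    filter_upwards [hd 0 h0] with x hx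
    simpa [assocMatrix, Matrix.mulVec, dotProduct, Fin.sum_univ_four] using hx
  have h2 : ∀ x ∈ Icc (0 : ℝ) 1, Y x 2 = 0 := by
    refine eqOn_zero_of_ae (hY 2).continuousOn ?_
    filter_upwards [hd 1 h1, hm] with x hx hxm
    simpa [assocMatrix, Matrix.mulVec, dotProduct, Fin.sum_univ_four, h0 x hxm, h1 x hxm] using hx
  have h3 : ∀ x ∈ Icc (0 : ℝ) 1, Y x 3 = 0 := by
    refine eqOn_zero_of_ae (hY 3).continuousOn ?_
    filter_upwards [hd 2 h2, hm] with x hx hxm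
    simpa [assocMatrix, Matrix.mulVec, dotProduct, Fin.sum_univ_four, h0 x hxm, h1 x hxm,
      h2 x hxm] using hx
  refine ⟨fun x hx => ?_, ?_⟩
  · ext i
    fin_cases i
    exacts [h0 x hx, h1 x hx, h2 x hx, h3 x hx]
  · filter_upwards [hd 3 h3, hm] with x hx hxm
    simpa [assocMatrix, Matrix.mulVec, dotProduct, Fin.sum_univ_four, h0 x hxm, h1 x hxm,
      h2 x hxm, h3 x hxm] using hx

section Chains

open PowerSeries

variable {τ₁ τ₂ : ℝ → ℂ} (h : SquareIntegrable τ₁ τ₂) (μ : ℂ) (e : Fin 2 → Fin 4)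

/-- The `k`-th coefficient of the combination, with power series coefficients `α`, of the Taylor
series at `μ` of the solutions whose initial values are the unit vectors `e 0` and `e 1`. -/
def chainSol (k : ℕ) : (Fin 2 → ℂ⟦X⟧) →ₗ[ℂ] C(Icc (0 : ℝ) 1, Fin 4 → ℂ) :=
  ∑ c, ∑ l ∈ Finset.HasAntidiagonal.antidiagonal k,
    LinearMap.smulRight ((coeff l.1).restrictScalars ℂ ∘ₗ LinearMap.proj c)
      (taylorSol h μ (Pi.single (e c) 1) l.2)

theorem chainSol_apply (k : ℕ) (α : Fin 2 → ℂ⟦X⟧) : chainSol h μ e k α =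
    ∑ c, ∑ l ∈ Finset.HasAntidiagonal.antidiagonal k,
      coeff l.1 (α c) • taylorSol h μ (Pi.single (e c) 1) l.2 := by
  simp [chainSol]

theorem chainSol_congr {k : ℕ} {α β : Fin 2 → ℂ⟦X⟧}
    (hαβ : ∀ c, ∀ l ≤ k, coeff l (α c) = coeff l (β c)) :
    chainSol h μ e k α = chainSol h μ e k β := by
  rw [chainSol_apply, chainSol_apply]
  refine Finset.sum_congr rfl fun c _ => Finset.sum_congr rfl fun l hl => ?_
  rw [hαβ c l.1 (Finset.HasAntidiagonal.mem_antidiagonal.1 hl ▸ Nat.le_add_right _ _)]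

/-- The initial value of `chainSol`. -/
def chainInit (k : ℕ) (α : Fin 2 → ℂ⟦X⟧) : Fin 4 → ℂ :=
  ∑ c, coeff k (α c) • Pi.single (e c) 1

theorem chainSol_zero (α : Fin 2 → ℂ⟦X⟧) (hα : ∀ c, coeff 0 (α c) = 0) :
    chainSol h μ e 0 α = 0 := by
  rw [chainSol_congr h μ e (β := 0) (by simpa using hα), map_zero]

/-- This compares coefficients of `t ^ (k + 1)` in the equation with parameter `μ + t`: the term
linear in `t` lowers the index by one. The coefficients of a series of solutions therefore form a
chain of associated functions. -/
theorem isLinearSol_chainSol_succ (k : ℕ) (α : Fin 2 → ℂ⟦X⟧) :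
    IsLinearSol (sysMatrix τ₁ τ₂ μ)
      (fun x => (Matrix.single 3 0 1 : Matrix (Fin 4) (Fin 4) ℂ).mulVec
        (ext01 (chainSol h μ e k α) x)) (ext01 (chainSol h μ e (k + 1) α)) ∧
      ext01 (chainSol h μ e (k + 1) α) 0 = chainInit e (k + 1) α := by
  refine isLinearSol_of_volterra (h.integrableEntries μ) integrableEntries_single ?_
  change (1 - sysOp h μ) _ = _ + paramOp _
  simp only [chainSol_apply, map_sum, map_smul]
  have : ContinuousMap.const (Icc (0 : ℝ) 1) (chainInit e (k + 1) α) =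
      ∑ c, coeff (k + 1) (α c) • ContinuousMap.const (Icc (0 : ℝ) 1)
        (Pi.single (e c) 1 : Fin 4 → ℂ) := by
    ext1 x
    simp [chainInit]
  rw [this, ← Finset.sum_add_distrib]
  refine Finset.sum_congr rfl fun c _ => ?_
  rw [Finset.Nat.sum_antidiagonal_succ', one_sub_sysOp_taylorSol_zero]
  congr 1
  refine Finset.sum_congr rfl fun l _ => ?_
  rw [one_sub_sysOp_taylorSol_succ]

theorem chainSol_X_pow_smul (n m : ℕ) (α : Fin 2 → ℂ⟦X⟧) :
    chainSol h μ e (m + n) ((X : ℂ⟦X⟧) ^ n • α) = chainSol h μ e m α := by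
  simp only [chainSol_apply, Pi.smul_apply, smul_eq_mul]
  refine Finset.sum_congr rfl fun c _ => ?_
  rw [Finset.Nat.sum_antidiagonal_eq_sum_range_succ_mk,
    Finset.Nat.sum_antidiagonal_eq_sum_range_succ_mk, Nat.succ_eq_add_one, Nat.succ_eq_add_one,
    show m + n + 1 = n + (m + 1) by ring, Finset.sum_range_add, Finset.sum_eq_zero, zero_add]
  · refine Finset.sum_congr rfl fun l _ => ?_
    rw [add_comm n l, coeff_X_pow_mul, show m + n - (l + n) = m - l by omega]
  · intro l hl
    rw [coeff_X_pow_mul', if_neg (by simpa using hl)]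
    exact zero_smul ℂ (taylorSol h μ (Pi.single (e c) 1) _)

/-- The Taylor series at `μ` of the boundary values at `1`. -/
def charSeries : Matrix (Fin 2) (Fin 2) ℂ⟦X⟧ :=
  Matrix.of fun s c => PowerSeries.mk fun n =>
    ext01 (taylorSol h μ (Pi.single (e c) 1) n) 1 (![0, 1] s)

theorem coeff_charSeries_mulVec (k : ℕ) (α : Fin 2 → ℂ⟦X⟧) (s : Fin 2) :
    coeff k ((charSeries h μ e).mulVec α s) = ext01 (chainSol h μ e k α) 1 (![0, 1] s) := by
  rw [chainSol_apply, Matrix.mulVec, dotProduct, map_sum]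
  simp only [ext01, IccExtend, Function.comp_apply, ContinuousMap.coe_sum, Finset.sum_apply,
    ContinuousMap.coe_smul, Pi.smul_apply, smul_eq_mul]
  refine Finset.sum_congr rfl fun c _ => ?_
  rw [mul_comm, coeff_mul]
  refine Finset.sum_congr rfl fun l _ => ?_
  simp [charSeries, ext01, IccExtend]

theorem chainInit_apply {e : Fin 2 → Fin 4} (he : Function.Injective e) (k : ℕ)
    (α : Fin 2 → ℂ⟦X⟧) (c : Fin 2) : chainInit e k α (e c) = coeff k (α c) := by
  simp [chainInit, Finset.sum_apply, Pi.single_apply, he.eq_iff]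

theorem chainInit_of_ne {k : ℕ} {α : Fin 2 → ℂ⟦X⟧} {i : Fin 4} (hi : ∀ c, i ≠ e c) :
    chainInit e k α i = 0 := by
  simp only [chainInit, Finset.sum_apply, Pi.smul_apply, Pi.single_apply, hi, if_false, smul_zero,
    Finset.sum_const_zero]

variable {i j : ℕ} {e}

/-- The components `e` are those that `U_i = U_j = 0` leave free at zero, and raising the level by
one prescribes one more coefficient of `α`, their initial values. The constant term of `α` is zero
because level zero is the zero function. All boundary values through order `m` must vanish because
every member of the chain satisfies the conditions at `1`. -/
theorem isRootFunction_iff (he : Function.Injective e)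
    (hc : ∀ k : Fin 4, (∀ c, k ≠ e c) ↔ (k : ℕ) = 4 - i ∨ (k : ℕ) = 4 - j) (hi : 1 ≤ i) (hj : 1 ≤ j)
    (m : ℕ) (y : ℝ → ℂ) :
    IsRootFunction τ₁ τ₂ i j μ m y ↔ ∃ α : Fin 2 → ℂ⟦X⟧, (∀ c, coeff 0 (α c) = 0) ∧
      (∀ k ≤ m, ∀ s, coeff k ((charSeries h μ e).mulVec α s) = 0) ∧
      ∀ x ∈ Icc (0 : ℝ) 1, y x = ext01 (chainSol h μ e m α) x 0 := by
  have hi4 : ∃ k : Fin 4, (k : ℕ) = 4 - i := ⟨⟨4 - i, by omega⟩, rfl⟩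
  have hj4 : ∃ k : Fin 4, (k : ℕ) = 4 - j := ⟨⟨4 - j, by omega⟩, rfl⟩
  obtain ⟨ki, hki⟩ := hi4
  obtain ⟨kj, hkj⟩ := hj4
  have hni := (hc ki).2 (Or.inl hki)
  have hnj := (hc kj).2 (Or.inr hkj)
  induction m generalizing y with
  | zero =>
    constructor
    · intro hy
      refine ⟨0, by simp, by simp, fun x hx => ?_⟩
      rw [hy x hx, map_zero]
      rfl
    · rintro ⟨α, hα, -, hy⟩ x hx
      rw [hy x hx, chainSol_zero h μ e α hα]
      rfl
  | succ m ih =>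
    constructor
    · rintro ⟨Y, hY, hYy, hUi, hUj, hV3, hV4, z, hz, h4⟩
      obtain ⟨α, hα0, hαm, hzα⟩ := (ih z).1 hz
      -- Coefficients up to `m` are kept, the next one is the free initial value of `Y`, and the
      -- later ones are irrelevant.
      set β : Fin 2 → ℂ⟦X⟧ := fun c => PowerSeries.mk fun k =>
        if k ≤ m then coeff k (α c) else Y (e c) 0 with hβ
      have hβc : ∀ k ≤ m, ∀ c, coeff k (β c) = coeff k (α c) := fun k hk c => by simp [hβ, hk]
      have hchain : ∀ k ≤ m, chainSol h μ e k β = chainSol h μ e k α := fun k hk =>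
        chainSol_congr h μ e fun c l hl => hβc l (hl.trans hk) c
      have hL : IsLinearSol (sysMatrix τ₁ τ₂ μ)
          (fun x => (Matrix.single 3 0 1 : Matrix (Fin 4) (Fin 4) ℂ).mulVec
          (ext01 (chainSol h μ e m β) x)) (fun x k => Y k x) := by
        intro k
        refine (isQuasiDerivs_iff.1 hY k).congr_deriv ?_
        filter_upwards [h4, ae_restrict_mem measurableSet_Ioo] with x hx hxm
        have hxm' := Ioo_subset_Icc_self hxm
        rw [sysMatrix_mulVec, single_mulVec, hx, hchain m le_rfl, ← hzα x hxm', ← hYy x hxm',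
          Pi.single_add]
        simp [add_assoc]
      have hS := isLinearSol_chainSol_succ h μ e m β
      have h0 : (fun k : Fin 4 => Y k 0) = chainInit e (m + 1) β := by
        ext k
        by_cases hk : ∀ c, k ≠ e c
        · rw [chainInit_of_ne e hk]
          rcases (hc k).1 hk with hk' | hk'
          · rw [hk']; exact hUi
          · rw [hk']; exact hUj
        · push Not at hk
          obtain ⟨c, rfl⟩ := hk
          simp [chainInit_apply he, hβ]
      have heq : ∀ x ∈ Icc (0 : ℝ) 1, (fun k : Fin 4 => Y k x) =
          ext01 (chainSol h μ e (m + 1) β) x := fun x hx =>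
        hL.eq_of_zero (h.integrableEntries μ) hS.1 (by rw [hS.2]; exact h0) hx
      refine ⟨β, fun c => by rw [hβc 0 (Nat.zero_le m), hα0], fun k hk s => ?_, fun x hx => ?_⟩
      · rw [coeff_charSeries_mulVec]
        rcases Nat.le_succ_iff.1 hk with hk | rfl
        · rw [hchain k hk, ← coeff_charSeries_mulVec, hαm k hk]
        · rw [← heq 1 one_mem_Icc01]
          fin_cases s
          · exact hV4
          · exact hV3
      · rw [← hYy x hx, ← heq x hx]
        rfl
    · rintro ⟨α, hα0, hαm, hy⟩
      have hS := isLinearSol_chainSol_succ h μ e m α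
      set S := ext01 (chainSol h μ e (m + 1) α) with hSdef
      refine ⟨fun n x => if hn : n < 4 then S x ⟨n, hn⟩ else
        μ * S x 0 + ext01 (chainSol h μ e m α) x 0, ?_, fun x hx => ?_, ?_, ?_, ?_, ?_,
        fun x => ext01 (chainSol h μ e m α) x 0, (ih _).2 ⟨α, hα0, fun k hk => hαm k (by omega),
          fun _ _ => rfl⟩, ?_⟩
      · rw [isQuasiDerivs_iff]
        intro k
        have := hS.1 k
        simp only [Fin.is_lt, dif_pos, Fin.eta, lt_irrefl, dif_neg, not_false_iff]
        refine this.congr_deriv ?_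
        filter_upwards with x
        rw [sysMatrix_mulVec, single_mulVec, Pi.single_add]
        simp [add_assoc]
      · simp [hy x hx, hSdef]
      · simp only [U, show 4 - i < 4 by omega, dif_pos]
        rw [hS.2, show (⟨4 - i, by omega⟩ : Fin 4) = ki from Fin.ext hki.symm]
        exact chainInit_of_ne e hni
      · simp only [U, show 4 - j < 4 by omega, dif_pos]
        rw [hS.2, show (⟨4 - j, by omega⟩ : Fin 4) = kj from Fin.ext hkj.symm]
        exact chainInit_of_ne e hnj
      · have := hαm (m + 1) le_rfl 1
        rw [coeff_charSeries_mulVec] at this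
        simpa [V, hSdef] using this
      · have := hαm (m + 1) le_rfl 0
        rw [coeff_charSeries_mulVec] at this
        simpa [V, hSdef] using this
      · filter_upwards [ae_restrict_mem measurableSet_Ioo] with x hx
        simp [hy x (Ioo_subset_Icc_self hx), hSdef]

/-- The first component of `chainSol`, as a function on `[0, 1]`. -/
def chainFst (k : ℕ) : (Fin 2 → ℂ⟦X⟧) →ₗ[ℂ] (Icc (0 : ℝ) 1 → ℂ) where
  toFun α x := chainSol h μ e k α x 0
  map_add' α β := by ext x; simp
  map_smul' a α := by ext x; simp

/-- If the top member of a chain vanishes, its equation makes the member below vanish too. The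
initial values then annihilate the coefficients one by one. -/
theorem eq_zero_of_chainFst (he : Function.Injective e) {α : Fin 2 → ℂ⟦X⟧}
    (hα : ∀ c, coeff 0 (α c) = 0) {n : ℕ} (hn : chainFst (e := e) h μ n α = 0) :
    ∀ k ≤ n, ∀ c, coeff k (α c) = 0 := by
  induction n with
  | zero =>
    intro k hk c
    rw [Nat.le_zero.1 hk, hα c]
  | succ n ih =>
    have hS := isLinearSol_chainSol_succ h μ e n α
    have h0 : ∀ x ∈ Icc (0 : ℝ) 1, ext01 (chainSol h μ e (n + 1) α) x 0 = 0 := fun x hx => by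
      rw [ext01, IccExtend_of_mem _ _ hx]
      exact congrFun hn ⟨x, hx⟩
    have hz := hS.1.eq_zero_of_fst h0
    have hn' := eqOn_zero_of_ae (((continuous_apply 0).comp
      (continuous_ext01 (chainSol h μ e n α))).continuousOn) hz.2
    have hprev := ih (by
      ext x
      have := hn' x x.2
      simp only [Function.comp_apply, ext01, IccExtend_of_mem _ _ x.2] at this
      exact this)
    intro k hk c
    rcases Nat.le_succ_iff.1 hk with hk | rfl
    · exact hprev k hk c
    · rw [← chainInit_apply he, ← hS.2, hz.1 0 zero_mem_Icc01]
      rfl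

theorem coeff_X_mul_zero (f : ℂ⟦X⟧) : coeff 0 (X * f) = 0 := by simp

/-- Let `det D = X ^ N u` with a unit `u`. Since `D · adj D = X ^ N u`, the vector `X adj(D) b`
yields root functions at level `N`. The resulting map `Θ` has the root space as range and the range
of `D` as kernel, so the multiplicity is the codimension of the latter. -/
theorem spec_eq_order (he : Function.Injective e)
    (hc : ∀ k : Fin 4, (∀ c, k ≠ e c) ↔ (k : ℕ) = 4 - i ∨ (k : ℕ) = 4 - j) (hi : 1 ≤ i) (hj : 1 ≤ j)
    (hD : (charSeries h μ e).det ≠ 0) :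
    spec τ₁ τ₂ i j μ = ((charSeries h μ e).det.order.toNat : Cardinal) := by
  set D := charSeries h μ e with hDdef
  set N := D.det.order.toNat with hN
  obtain ⟨u, v, huv, hu⟩ : ∃ u v : ℂ⟦X⟧, v * u = 1 ∧ D.det = X ^ N * u := by
    have : IsUnit (divXPowOrder D.det) := by
      rw [isUnit_iff_constantCoeff, isUnit_iff_ne_zero, constantCoeff_divXPowOrder]
      exact coeff_order hD
    obtain ⟨v, hv⟩ := this.exists_left_inv
    exact ⟨_, v, hv, X_pow_order_mul_divXPowOrder.symm⟩
  have hXne : (X : ℂ⟦X⟧) ^ N ≠ 0 := pow_ne_zero _ X_ne_zero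
  set Θ : (Fin 2 → ℂ⟦X⟧) →ₗ[ℂ] (Icc (0 : ℝ) 1 → ℂ) :=
    chainFst (e := e) h μ N ∘ₗ powerSeriesMap ((X : ℂ⟦X⟧) • D.adjugate) with hΘ
  have hΘa : ∀ b, Θ b = chainFst (e := e) h μ N ((X : ℂ⟦X⟧) • D.adjugate.mulVec b) := fun b => by
    rw [hΘ, LinearMap.comp_apply, powerSeriesMap_apply]
    refine congrArg _ (funext fun c => ?_)
    simp only [Matrix.mulVec, dotProduct, Matrix.smul_apply, Pi.smul_apply, smul_eq_mul,
      Finset.mul_sum, mul_assoc]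
  have hker : LinearMap.ker Θ = LinearMap.range (powerSeriesMap D) := by
    ext b
    rw [LinearMap.mem_ker, LinearMap.mem_range]
    constructor
    · intro hb
      rw [hΘa] at hb
      have hz := eq_zero_of_chainFst h μ he (fun c => coeff_X_mul_zero _) hb
      have hdvd : ∀ c, (X : ℂ⟦X⟧) ^ N ∣ D.adjugate.mulVec b c := fun c => by
        rw [X_pow_dvd_iff]
        intro m hm
        have := hz (m + 1) (by omega) c
        rwa [coeff_succ_X_mul] at this
      choose a ha using hdvd
      have ha' : D.adjugate.mulVec b = (X : ℂ⟦X⟧) ^ N • a := funext ha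
      refine ⟨v • a, ?_⟩
      have h1 := congrArg D.mulVec ha'
      rw [Matrix.mulVec_mulVec, Matrix.mul_adjugate, Matrix.smul_mulVec, Matrix.one_mulVec, hu,
        Matrix.mulVec_smul, mul_smul] at h1
      have h2 : u • b = D.mulVec a := smul_right_injective _ hXne h1
      rw [powerSeriesMap_apply, Matrix.mulVec_smul, ← h2, smul_smul, huv, one_smul]
    · rintro ⟨a, rfl⟩
      rw [hΘa, powerSeriesMap_apply, Matrix.mulVec_mulVec, Matrix.adjugate_mul,
        Matrix.smul_mulVec, Matrix.one_mulVec, hu]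
      have hz : chainSol h μ e N ((X : ℂ⟦X⟧) • (X ^ N * u) • a) = 0 := by
        rw [chainSol_congr h μ e (β := 0), map_zero]
        intro c l hl
        rw [Pi.smul_apply, Pi.smul_apply, smul_eq_mul, smul_eq_mul,
          show X * (X ^ N * u * a c) = X ^ (N + 1) * (u * a c) by ring,
          coeff_X_pow_mul', if_neg (by omega)]
        simp
      ext x
      change chainSol h μ e N _ x 0 = 0
      rw [hz]
      rfl
  have hrange : rootSpace τ₁ τ₂ i j μ = LinearMap.range Θ := by
    apply le_antisymm
    · refine Submodule.span_le.2 ?_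
      rintro f ⟨m, y, hy, rfl⟩
      obtain ⟨α, hα0, hαm, hyα⟩ := (isRootFunction_iff h μ he hc hi hj m y).1 hy
      have hX : ∀ c, ∃ a, α c = X * a := fun c => X_dvd_iff.2 (by simpa using hα0 c)
      choose a ha using hX
      have hα : α = (X : ℂ⟦X⟧) • a := funext ha
      have hγ : ∀ s, (X : ℂ⟦X⟧) ^ m ∣ D.mulVec a s := fun s => by
        rw [X_pow_dvd_iff]
        intro k hk
        have := hαm (k + 1) (by omega) s
        rwa [hα, Matrix.mulVec_smul, Pi.smul_apply, smul_eq_mul, coeff_succ_X_mul] at this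
      choose γ hγ using hγ
      have hγ' : D.mulVec a = (X : ℂ⟦X⟧) ^ m • γ := funext hγ
      refine ⟨v • γ, ?_⟩
      have h1 := congrArg D.adjugate.mulVec hγ'
      rw [Matrix.mulVec_mulVec, Matrix.adjugate_mul, Matrix.smul_mulVec, Matrix.one_mulVec, hu,
        Matrix.mulVec_smul] at h1
      -- The function at level `m` for `α` is the one at level `m + N` for `X ^ N • α`. This
      -- identity exhibits the latter series as a multiple of `X ^ m`, so the function also occurs
      -- at level `N`.
      have h2 : (X : ℂ⟦X⟧) ^ m • (X : ℂ⟦X⟧) • D.adjugate.mulVec (v • γ) =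
          (X : ℂ⟦X⟧) ^ N • α := by
        calc (X : ℂ⟦X⟧) ^ m • (X : ℂ⟦X⟧) • D.adjugate.mulVec (v • γ)
            = ((X : ℂ⟦X⟧) * v) • (X : ℂ⟦X⟧) ^ m • D.adjugate.mulVec γ := by
              rw [Matrix.mulVec_smul, smul_smul, smul_smul, smul_smul]
              congr 1
              ring
          _ = (X : ℂ⟦X⟧) ^ N • α := by
              rw [← h1, hα, smul_smul, smul_smul,
                show X * v * (X ^ N * u) = X ^ N * X * (v * u) by ring, huv, mul_one]
      rw [hΘa]
      ext x
      change chainSol h μ e N _ x 0 = y x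
      rw [hyα x x.2, ← chainSol_X_pow_smul h μ e m N, h2, add_comm N m, chainSol_X_pow_smul, ext01,
        IccExtend_of_mem _ _ x.2]
    · rintro _ ⟨b, rfl⟩
      refine Submodule.subset_span ⟨N, fun x => ext01 (chainSol h μ e N
        ((X : ℂ⟦X⟧) • D.adjugate.mulVec b)) x 0, ?_, ?_⟩
      · refine (isRootFunction_iff h μ he hc hi hj N _).2 ⟨(X : ℂ⟦X⟧) • D.adjugate.mulVec b, fun c => coeff_X_mul_zero _,
          fun k hk s => ?_, fun _ _ => rfl⟩
        rw [Matrix.mulVec_smul, ← hDdef, Matrix.mulVec_mulVec, Matrix.mul_adjugate,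
          Matrix.smul_mulVec, Matrix.one_mulVec, hu, Pi.smul_apply, Pi.smul_apply, smul_eq_mul, smul_eq_mul,
          show X * (X ^ N * u * b s) = X ^ (N + 1) * (u * b s) by ring,
          coeff_X_pow_mul', if_neg (by omega)]
      · rw [hΘa]
        ext x
        change _ = ext01 _ x 0
        rw [ext01, IccExtend_of_mem _ _ x.2]
        rfl
  rw [spec, hrange, ← (LinearMap.quotKerEquivRange Θ).rank_eq, hker]
  exact (corankEqOrder hD).2

/-- The minor of the rows `0, 1` and the columns `k, l`, with the sign of the rows `1, 0`. -/
def minor (k l : Fin 4) (μ : ℂ) : ℂ :=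
  fundMatrix h 1 μ 1 k * fundMatrix h 1 μ 0 l - fundMatrix h 1 μ 1 l * fundMatrix h 1 μ 0 k

theorem hasTaylor_fundMatrix (s : Fin 2) (c : Fin 2) :
    HasTaylor (fun z => fundMatrix h 1 z (![0, 1] s) (e c)) μ (charSeries h μ e s c) := by
  have := hasSum_sol h μ (Pi.single (e c) 1) 1 (![0, 1] s)
  unfold HasTaylor
  simpa [charSeries, fundMatrix] using this

/-- The Taylor series of `minor h (e 1) (e 0)` is the determinant itself: in `minor` both the rows
and the columns are reversed, so the signs cancel. -/
theorem analyticOrderAt_minor :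
    analyticOrderAt (minor h (e 1) (e 0)) μ = (charSeries h μ e).det.order := by
  have h1 := ((hasTaylor_fundMatrix h μ (e := e) 1 1).mul (hasTaylor_fundMatrix h μ (e := e) 0 0)).sub
    ((hasTaylor_fundMatrix h μ (e := e) 1 0).mul (hasTaylor_fundMatrix h μ (e := e) 0 1))
  have h2 := h1.analyticOrderAt_eq
  rw [show (charSeries h μ e).det = charSeries h μ e 1 1 * charSeries h μ e 0 0 -
    charSeries h μ e 1 0 * charSeries h μ e 0 1 by rw [Matrix.det_fin_two]; ring, ← h2]
  rfl

theorem spec_eq_analyticOrderAt (he : Function.Injective e)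
    (hc : ∀ k : Fin 4, (∀ c, k ≠ e c) ↔ (k : ℕ) = 4 - i ∨ (k : ℕ) = 4 - j) (hi : 1 ≤ i) (hj : 1 ≤ j)
    (hne : analyticOrderAt (minor h (e 1) (e 0)) μ ≠ ⊤) :
    spec τ₁ τ₂ i j μ = ((analyticOrderAt (minor h (e 1) (e 0)) μ).toNat : Cardinal) := by
  rw [analyticOrderAt_minor] at hne ⊢
  exact spec_eq_order h μ he hc hi hj (order_eq_top.not.1 hne)

end Chains

end FourthOrder

/-! ### Exponential dichotomy for perturbed diagonal systems -/

namespace FourthOrder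

open Complex (I)

theorem integrable_mul_sub {β f : ℝ → ℝ} (hβ : IntervalIntegrable β volume 0 1)
    (hf : ContinuousOn f (Icc 0 1)) {a b : ℝ} (ha : a ∈ Icc (0 : ℝ) 1) (hb : b ∈ Icc (0 : ℝ) 1) :
    IntervalIntegrable (fun t => β t * f t) volume a b :=
  intervalIntegrable_sub (intervalIntegrable_mul_continuousOn hβ hf) ha hb

/-- An `L¹` approximation of `β` by a bounded function costs `ε`, and `M` bounds the approximant. As
`M` does not depend on the kernel, concentrated kernels give uniformly small integrals although `β`
is only integrable. -/
theorem exists_integral_mul_kernel_le {β : ℝ → ℝ} (hβ : IntervalIntegrable β volume 0 1) {ε : ℝ}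
    (hε : 0 < ε) : ∃ M : ℝ, 0 ≤ M ∧ ∀ a b : ℝ, 0 ≤ a → a ≤ b → b ≤ 1 → ∀ k : ℝ → ℝ, Continuous k →
      (∀ t ∈ Icc a b, 0 ≤ k t ∧ k t ≤ 1) →
      ∫ t in a..b, β t * k t ≤ ε + M * ∫ t in a..b, k t := by
  obtain ⟨g, hg, -⟩ := Integrable.exists_boundedContinuous_integral_sub_le
    ((intervalIntegrable_iff_integrableOn_Ioc_of_le zero_le_one).1 hβ) hε
  rw [← intervalIntegral.integral_of_le zero_le_one] at hg
  have hi : IntervalIntegrable (fun t => ‖β t - g t‖) volume 0 1 :=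
    (hβ.sub (g.continuous.intervalIntegrable _ _)).norm
  refine ⟨‖g‖, norm_nonneg _, fun a b ha hab hb k hk hk01 => ?_⟩
  have ma : a ∈ Icc (0 : ℝ) 1 := ⟨ha, hab.trans hb⟩
  have mb : b ∈ Icc (0 : ℝ) 1 := ⟨ha.trans hab, hb⟩
  calc ∫ t in a..b, β t * k t ≤ ∫ t in a..b, (‖β t - g t‖ + ‖g‖ * k t) := by
        refine intervalIntegral.integral_mono_on hab (integrable_mul_sub hβ hk.continuousOn ma mb)
          ((intervalIntegrable_sub hi ma mb).add ((hk.intervalIntegrable _ _).const_mul _))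
          fun t ht => ?_
        have h1 := hk01 t ht
        have h2 : g t ≤ ‖g‖ := (le_abs_self _).trans (g.norm_coe_le_norm t)
        have h3 : β t - g t ≤ ‖β t - g t‖ := le_abs_self _
        nlinarith [norm_nonneg (β t - g t)]
    _ = (∫ t in a..b, ‖β t - g t‖) + ‖g‖ * ∫ t in a..b, k t := by
        rw [intervalIntegral.integral_add (intervalIntegrable_sub hi ma mb)
          ((hk.intervalIntegrable _ _).const_mul _), intervalIntegral.integral_const_mul]
    _ ≤ ε + ‖g‖ * ∫ t in a..b, k t := by
        gcongr
        refine le_trans ?_ hg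
        exact intervalIntegral.integral_mono_interval ha hab hb
          (Filter.Eventually.of_forall fun _ => norm_nonneg _) hi

theorem integral_exp_mul_le {c : ℝ} (hc : 0 < c) (a b : ℝ) :
    ∫ t in a..b, Real.exp (-(c * (t - a))) ≤ c⁻¹ ∧ ∫ t in a..b, Real.exp (-(c * (b - t))) ≤ c⁻¹ := by
  constructor
  · have : ∀ t ∈ uIcc a b, HasDerivAt (fun t => -(c⁻¹ * Real.exp (-(c * (t - a)))))
        (Real.exp (-(c * (t - a)))) t := fun t _ => by
      have := ((((hasDerivAt_id t).sub_const a).const_mul c).neg.exp.const_mul c⁻¹).neg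
      refine this.congr_deriv ?_
      field_simp
      simp
    rw [intervalIntegral.integral_eq_sub_of_hasDerivAt this
      (Continuous.intervalIntegrable (by fun_prop) _ _)]
    have := inv_pos.2 hc
    have := Real.exp_pos (-(c * (b - a)))
    simp only [sub_self, mul_zero, neg_zero, Real.exp_zero]
    nlinarith
  · have : ∀ t ∈ uIcc a b, HasDerivAt (fun t => c⁻¹ * Real.exp (-(c * (b - t))))
        (Real.exp (-(c * (b - t)))) t := fun t _ => by
      have := (((hasDerivAt_id t).const_sub b).const_mul c).neg.exp.const_mul c⁻¹
      refine this.congr_deriv ?_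
      field_simp
      simp
    rw [intervalIntegral.integral_eq_sub_of_hasDerivAt this
      (Continuous.intervalIntegrable (by fun_prop) _ _)]
    have := inv_pos.2 hc
    have := Real.exp_pos (-(c * (b - a)))
    simp only [sub_self, mul_zero, neg_zero, Real.exp_zero]
    nlinarith

/-- The fourth roots of `-4`; the first two have real part `1`, the last two `-1`. -/
def rootsNegFour : Fin 4 → ℂ := ![1 + I, 1 - I, -1 + I, -1 - I]

/-- A solution of an integrable perturbation, of size `β`, of the diagonal system
`ζ' = r ω ζ`, where `ω` runs through the fourth roots of `-4`. -/
def IsDiagonalSol (r : ℝ) (β : ℝ → ℝ) (ζ : ℝ → Fin 4 → ℂ) : Prop :=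
  ∃ g : ℝ → Fin 4 → ℂ, ∀ j, IntervalIntegrable (fun x => g x j) volume 0 1 ∧
    HasACDeriv (fun x => ζ x j) (fun x => r * rootsNegFour j * ζ x j + g x j) ∧
    ∀ x ∈ Icc (0 : ℝ) 1, ‖g x j‖ ≤ β x * ‖ζ x‖

section Dichotomy

variable {r : ℝ} {β : ℝ → ℝ} {ζ : ℝ → Fin 4 → ℂ}

theorem IsDiagonalSol.continuousOn (hζ : IsDiagonalSol r β ζ) : ContinuousOn ζ (Icc 0 1) := by
  obtain ⟨g, hg⟩ := hζ
  exact continuousOn_pi.2 fun j => (hg j).2.1.continuousOn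

/-- Variation of constants: `exp (-r ω x) ζ_j` has derivative `exp (-r ω x) g_j`. -/
theorem IsDiagonalSol.duhamel (hζ : IsDiagonalSol r β ζ) (hβ : IntervalIntegrable β volume 0 1)
    (j : Fin 4) {s t : ℝ} (hs : 0 ≤ s) (hst : s ≤ t) (ht : t ≤ 1) :
    |Real.exp (-(r * (rootsNegFour j).re * t)) * ‖ζ t j‖ -
      Real.exp (-(r * (rootsNegFour j).re * s)) * ‖ζ s j‖| ≤
      ∫ x in s..t, β x * (Real.exp (-(r * (rootsNegFour j).re * x)) * ‖ζ x‖) := by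
  have hcont := hζ.continuousOn
  obtain ⟨g, hg⟩ := hζ
  obtain ⟨hgi, hgd, hgb⟩ := hg j
  set ω := rootsNegFour j
  have ms : s ∈ Icc (0 : ℝ) 1 := ⟨hs, hst.trans ht⟩
  have mt : t ∈ Icc (0 : ℝ) 1 := ⟨hs.trans hst, ht⟩
  have hnorm : ∀ x : ℝ, ‖Complex.exp (-(r * ω * x))‖ = Real.exp (-(r * ω.re * x)) := fun x => by
    rw [Complex.norm_exp]
    congr 1
    simp [Complex.mul_re]
  have hE : HasACDeriv (fun x : ℝ => Complex.exp (-(r * ω * x)))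
      (fun x : ℝ => -(r * ω) * Complex.exp (-(r * ω * x))) := by
    refine HasACDeriv.of_contDiff ?_ fun x => ?_
    · have : ContDiff ℝ 1 (fun x : ℝ => (x : ℂ)) := Complex.ofRealCLM.contDiff
      exact Complex.contDiff_exp.comp (contDiff_const.mul this).neg
    · have := (((hasDerivAt_id (x : ℂ)).const_mul (r * ω)).neg.cexp).comp_ofReal
      refine this.congr_deriv ?_
      simp
      ring
  have h1 := (hE.mul hgd).congr_deriv (g' := fun x => Complex.exp (-(r * ω * x)) * g x j)
    (by filter_upwards with x; ring)
  have hi : IntervalIntegrable (fun x : ℝ => Complex.exp (-(r * ω * x)) * g x j) volume 0 1 :=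
    hgi.continuousOn_mul (by rw [uIcc_of_le zero_le_one]; exact hE.continuousOn)
  have h2 := h1.integral_eq hi ms mt
  calc _ ≤ ‖Complex.exp (-(r * ω * t)) * ζ t j - Complex.exp (-(r * ω * s)) * ζ s j‖ := by
        have := abs_norm_sub_norm_le (Complex.exp (-(r * ω * t)) * ζ t j)
          (Complex.exp (-(r * ω * s)) * ζ s j)
        rwa [norm_mul, norm_mul, hnorm, hnorm] at this
    _ ≤ _ := by
        rw [← h2]
        refine intervalIntegral.norm_integral_le_of_norm_le hst ?_
          (integrable_mul_sub hβ (ContinuousOn.mul (by fun_prop) hcont.norm) ms mt)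
        filter_upwards with x hx
        rw [norm_mul, hnorm]
        have := hgb x ⟨hs.trans hx.1.le, hx.2.trans ht⟩
        calc _ ≤ Real.exp (-(r * ω.re * x)) * (β x * ‖ζ x‖) := by gcongr
          _ = _ := by ring

theorem IsDiagonalSol.norm_apply_le (hζ : IsDiagonalSol r β ζ)
    (hβ : IntervalIntegrable β volume 0 1)
    (j : Fin 4) {s t : ℝ} (hs : 0 ≤ s) (hst : s ≤ t) (ht : t ≤ 1) :
    ‖ζ t j‖ ≤ Real.exp (r * (rootsNegFour j).re * (t - s)) * ‖ζ s j‖ +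
        ∫ x in s..t, β x * (Real.exp (r * (rootsNegFour j).re * (t - x)) * ‖ζ x‖) ∧
      ‖ζ s j‖ ≤ Real.exp (-(r * (rootsNegFour j).re * (t - s))) * ‖ζ t j‖ +
        ∫ x in s..t, β x * (Real.exp (-(r * (rootsNegFour j).re * (x - s))) * ‖ζ x‖) := by
  have h := abs_le.1 (hζ.duhamel hβ j hs hst ht)
  set σ := r * (rootsNegFour j).re
  have key : ∀ a : ℝ, Real.exp (σ * a) *
      (∫ x in s..t, β x * (Real.exp (-(σ * x)) * ‖ζ x‖)) =
      ∫ x in s..t, β x * (Real.exp (σ * (a - x)) * ‖ζ x‖) := fun a => by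
    rw [← intervalIntegral.integral_const_mul]
    refine intervalIntegral.integral_congr fun x _ => ?_
    rw [show σ * (a - x) = σ * a + -(σ * x) by ring, Real.exp_add]
    ring
  have e : ∀ a b : ℝ, Real.exp (σ * a) * Real.exp (-(σ * b)) = Real.exp (σ * (a - b)) := fun a b => by
    rw [← Real.exp_add]; congr 1; ring
  constructor
  · have h1 := mul_le_mul_of_nonneg_left h.2 (Real.exp_pos (σ * t)).le
    rw [mul_sub, ← mul_assoc, ← mul_assoc, e, e, sub_self, mul_zero, Real.exp_zero, one_mul, key]
      at h1
    linarith
  · have h1 := mul_le_mul_of_nonneg_left h.1 (Real.exp_pos (σ * s)).le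
    rw [mul_sub, ← mul_assoc, ← mul_assoc, e, e, sub_self, mul_zero, Real.exp_zero, one_mul,
      mul_neg, key] at h1
    have e1 : ∀ x, -(σ * (x - s)) = σ * (s - x) := fun x => by ring
    simp only [e1]
    linarith

theorem re_rootsNegFour_growing {j : Fin 4} (hj : j < 2) : (rootsNegFour j).re = 1 := by
  fin_cases j <;> simp_all [rootsNegFour]

theorem re_rootsNegFour_decaying {j : Fin 4} (hj : 2 ≤ j) : (rootsNegFour j).re = -1 := by
  fin_cases j <;> simp_all [rootsNegFour]

theorem abs_re_rootsNegFour_le (j : Fin 4) : |(rootsNegFour j).re| ≤ 1 := by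
  fin_cases j <;> simp [rootsNegFour]

theorem integral_mono_kernel (hβ : IntervalIntegrable β volume 0 1) (hβ0 : ∀ x, 0 ≤ β x)
    {k l : ℝ → ℝ} (hk : ContinuousOn k (Icc 0 1)) (hl : ContinuousOn l (Icc 0 1)) {s t : ℝ}
    (hs : 0 ≤ s) (hst : s ≤ t) (ht : t ≤ 1) (hkl : ∀ x ∈ Icc s t, k x ≤ l x) :
    ∫ x in s..t, β x * k x ≤ ∫ x in s..t, β x * l x :=
  intervalIntegral.integral_mono_on hst
    (integrable_mul_sub hβ hk ⟨hs, hst.trans ht⟩ ⟨hs.trans hst, ht⟩)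
    (integrable_mul_sub hβ hl ⟨hs, hst.trans ht⟩ ⟨hs.trans hst, ht⟩)
    fun x hx => mul_le_mul_of_nonneg_left (hkl x hx) (hβ0 x)

theorem IsDiagonalSol.norm_le_forward (hζ : IsDiagonalSol r β ζ) (hr : 0 ≤ r)
    (hβ : IntervalIntegrable β volume 0 1) (hβ0 : ∀ x, 0 ≤ β x) {x : ℝ} (hx : x ∈ Icc (0 : ℝ) 1) :
    ‖ζ x‖ ≤ Real.exp (∫ t in (0 : ℝ)..1, β t) * Real.exp (r * x) * ‖ζ 0‖ := by
  have hc := hζ.continuousOn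
  have hf : ContinuousOn (fun y => Real.exp (-(r * y)) * ‖ζ y‖) (Icc 0 1) :=
    ContinuousOn.mul (by fun_prop) hc.norm
  have := gronwall_forward hf hβ hβ0 (norm_nonneg (ζ 0)) le_rfl (fun y hy => ?_) hx
  · rw [Real.exp_neg, inv_mul_le_iff₀ (Real.exp_pos _)] at this
    linarith
  · rw [Real.exp_neg, inv_mul_le_iff₀ (Real.exp_pos _)]
    have hnn : 0 ≤ ∫ t in (0 : ℝ)..y, β t * (Real.exp (-(r * t)) * ‖ζ t‖) :=
      intervalIntegral.integral_nonneg hy.1 fun t _ => mul_nonneg (hβ0 t) (by positivity)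
    rw [pi_norm_le_iff_of_nonneg (mul_nonneg (Real.exp_pos _).le
      (add_nonneg (norm_nonneg _) hnn))]
    intro j
    refine (hζ.norm_apply_le hβ j le_rfl hy.1 hy.2).1.trans ?_
    rw [mul_add, ← intervalIntegral.integral_const_mul]
    have hσ := (abs_le.1 (abs_re_rootsNegFour_le j)).2
    have hrσ : r * (rootsNegFour j).re ≤ r := by nlinarith
    refine add_le_add ?_ ?_
    · have := hy.1
      rw [sub_zero]
      gcongr
      exact norm_le_pi_norm _ _
    · have e : ∀ t, Real.exp (r * y) * (β t * (Real.exp (-(r * t)) * ‖ζ t‖)) =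
          β t * (Real.exp (r * (y - t)) * ‖ζ t‖) := fun t => by
        rw [show r * (y - t) = r * y + -(r * t) by ring, Real.exp_add]; ring
      simp only [e]
      refine integral_mono_kernel hβ hβ0 (ContinuousOn.mul (by fun_prop) hc.norm)
        (ContinuousOn.mul (by fun_prop) hc.norm) le_rfl hy.1 hy.2 fun t ht => ?_
      have : 0 ≤ y - t := by linarith [ht.2]
      simp only [Pi.mul_apply]
      gcongr

theorem IsDiagonalSol.norm_le_backward (hζ : IsDiagonalSol r β ζ) (hr : 0 ≤ r)
    (hβ : IntervalIntegrable β volume 0 1) (hβ0 : ∀ x, 0 ≤ β x) {x s : ℝ} (hx : 0 ≤ x)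
    (hxs : x ≤ s) (hs : s ≤ 1) :
    ‖ζ x‖ ≤ Real.exp (∫ t in (0 : ℝ)..1, β t) * Real.exp (r * (s - x)) * ‖ζ s‖ := by
  have hc := hζ.continuousOn
  have hf : ContinuousOn (fun y => Real.exp (-(r * (s - y))) * ‖ζ y‖) (Icc 0 1) :=
    ContinuousOn.mul (by fun_prop) hc.norm
  have := gronwall_backward hf hβ hβ0 (norm_nonneg (ζ s)) hs (fun y hy => ?_) ⟨hx, hxs⟩
  · rw [Real.exp_neg, inv_mul_le_iff₀ (Real.exp_pos _)] at this
    linarith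
  · rw [Real.exp_neg, inv_mul_le_iff₀ (Real.exp_pos _)]
    have hnn : 0 ≤ ∫ t in y..s, β t * (Real.exp (-(r * (s - t))) * ‖ζ t‖) :=
      intervalIntegral.integral_nonneg hy.2 fun t _ => mul_nonneg (hβ0 t) (by positivity)
    rw [pi_norm_le_iff_of_nonneg (mul_nonneg (Real.exp_pos _).le
      (add_nonneg (norm_nonneg _) hnn))]
    intro j
    refine (hζ.norm_apply_le hβ j hy.1 hy.2 hs).2.trans ?_
    rw [mul_add, ← intervalIntegral.integral_const_mul]
    have hσ := (abs_le.1 (abs_re_rootsNegFour_le j)).1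
    have hrσ : -(r * (rootsNegFour j).re) ≤ r := by nlinarith
    refine add_le_add ?_ ?_
    · gcongr
      · rw [← neg_mul]; exact mul_le_mul_of_nonneg_right hrσ (by linarith [hy.2])
      · exact norm_le_pi_norm _ _
    · have e : ∀ t, Real.exp (r * (s - y)) * (β t * (Real.exp (-(r * (s - t))) * ‖ζ t‖)) =
          β t * (Real.exp (r * (t - y)) * ‖ζ t‖) := fun t => by
        rw [show r * (t - y) = r * (s - y) + -(r * (s - t)) by ring, Real.exp_add]; ring
      simp only [e]
      refine integral_mono_kernel hβ hβ0 (ContinuousOn.mul (by fun_prop) hc.norm)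
        (ContinuousOn.mul (by fun_prop) hc.norm) hy.1 hy.2 hs fun t ht => ?_
      have : 0 ≤ t - y := by linarith [ht.1]
      simp only [Pi.mul_apply, ← neg_mul]
      gcongr
      linarith

/-- The size of the growing components. -/
def growingNorm (z : Fin 4 → ℂ) : ℝ := max ‖z 0‖ ‖z 1‖

/-- The size of the decaying components. -/
def decayingNorm (z : Fin 4 → ℂ) : ℝ := max ‖z 2‖ ‖z 3‖

theorem growingNorm_nonneg (z : Fin 4 → ℂ) : 0 ≤ growingNorm z := le_max_of_le_left (norm_nonneg _)

theorem decayingNorm_nonneg (z : Fin 4 → ℂ) : 0 ≤ decayingNorm z :=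
  le_max_of_le_left (norm_nonneg _)

theorem norm_le_growingNorm_add (z : Fin 4 → ℂ) : ‖z‖ ≤ growingNorm z + decayingNorm z := by
  have h1 := growingNorm_nonneg z
  have h2 := decayingNorm_nonneg z
  rw [pi_norm_le_iff_of_nonneg (by positivity)]
  intro j
  fin_cases j
  · exact (le_max_left _ _).trans (le_add_of_nonneg_right h2)
  · exact (le_max_right _ _).trans (le_add_of_nonneg_right h2)
  · exact (le_max_left _ _).trans (le_add_of_nonneg_left h1)
  · exact (le_max_right _ _).trans (le_add_of_nonneg_left h1)

theorem decayingNorm_le_norm (z : Fin 4 → ℂ) : decayingNorm z ≤ ‖z‖ :=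
  max_le (norm_le_pi_norm _ _) (norm_le_pi_norm _ _)

/-- Let `v` be the decaying size at `1`. Backward Gronwall gives `|ζ x| ≤ 4 b v e^{r(1-x)}`.
Inserted into the backward equations of the growing components, it is multiplied by kernels
`e^{-2r(t-x)}` with small integrals against `β`, so these components are small relative to `v
e^{r(1-x)}`, up to a term concentrated at `1`. In forward Gronwall for the decaying components they
act as a source contributing at most half of `e^r v`. Absorbing it bounds `e^r v` by the decaying
size at zero. -/
theorem exists_dichotomy (hβ : IntervalIntegrable β volume 0 1) (hβ0 : ∀ x, 0 ≤ β x) {ε : ℝ}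
    (hε : 0 < ε) : ∃ R : ℝ, ∀ r ≥ R, ∀ ζ : ℝ → Fin 4 → ℂ, IsDiagonalSol r β ζ →
      ‖ζ 1‖ ≤ 4 * decayingNorm (ζ 1) →
      growingNorm (ζ 0) ≤ ε * decayingNorm (ζ 0) ∧
      ∀ x ∈ Icc (0 : ℝ) 1, ‖ζ x‖ ≤
        8 * Real.exp (∫ t in (0 : ℝ)..1, β t) ^ 2 * Real.exp (-(r * x)) * decayingNorm (ζ 0) := by
  set B := ∫ t in (0 : ℝ)..1, β t with hB
  have hB0 : 0 ≤ B := intervalIntegral.integral_nonneg zero_le_one fun t _ => hβ0 t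
  set b := Real.exp B with hb
  have hb0 : 0 < b := Real.exp_pos _
  -- The first condition permits the absorption of the growing components, the second yields the
  -- final `ε`.
  obtain ⟨δ, hδ, hδ1, hδ2⟩ : ∃ δ : ℝ, 0 < δ ∧ 4 * b * (δ + B * (b * δ)) ≤ 1 / 2 ∧
      8 * b * (δ + b * δ) ≤ ε := by
    refine ⟨min ((1 / 2) / (4 * b * (1 + B * b))) (ε / (8 * b * (1 + b))), by positivity, ?_, ?_⟩
    · have := min_le_left ((1 / 2) / (4 * b * (1 + B * b))) (ε / (8 * b * (1 + b)))
      rw [le_div_iff₀ (by positivity)] at this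
      linarith
    · have := min_le_right ((1 / 2) / (4 * b * (1 + B * b))) (ε / (8 * b * (1 + b)))
      rw [le_div_iff₀ (by positivity)] at this
      linarith
  obtain ⟨M, hM, hker⟩ := exists_integral_mul_kernel_le hβ (half_pos hδ)
  refine ⟨max 1 (max (M / δ) (1 / δ)), fun r hr ζ hζ h1 => ?_⟩
  have hr1 : 1 ≤ r := (le_max_left _ _).trans hr
  have hrM : M / δ ≤ r := ((le_max_left _ _).trans (le_max_right _ _)).trans hr
  have hrd : 1 / δ ≤ r := ((le_max_right _ _).trans (le_max_right _ _)).trans hr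
  have hr0 : 0 < r := by linarith
  rw [div_le_iff₀ hδ] at hrM hrd
  have hMr : M * (2 * r)⁻¹ ≤ δ / 2 := by
    rw [← div_eq_mul_inv, div_le_iff₀ (by positivity)]
    nlinarith
  have hexp : Real.exp (-(2 * r)) ≤ δ := by
    have h2 := Real.add_one_le_exp (2 * r)
    rw [Real.exp_neg, inv_le_comm₀ (Real.exp_pos _) hδ]
    rw [← one_div, div_le_iff₀ hδ]
    nlinarith
  have k1 : ∀ x ∈ Icc (0 : ℝ) 1, ∫ t in x..1, β t * Real.exp (-(2 * r * (t - x))) ≤ δ := by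
    intro x hx
    have := hker x 1 hx.1 hx.2 le_rfl (fun t => Real.exp (-(2 * r * (t - x)))) (by fun_prop)
      fun t ht => ⟨(Real.exp_pos _).le, Real.exp_le_one_iff.2
        (neg_nonpos.2 (mul_nonneg (by positivity) (by linarith [ht.1])))⟩
    have h3 := (integral_exp_mul_le (c := 2 * r) (by positivity) x 1).1
    have h4 := mul_le_mul_of_nonneg_left h3 hM
    linarith
  have k2 : ∫ t in (0 : ℝ)..1, β t * Real.exp (-(2 * r * (1 - t))) ≤ δ := by
    have := hker 0 1 le_rfl zero_le_one le_rfl (fun t => Real.exp (-(2 * r * (1 - t))))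
      (by fun_prop) fun t ht => ⟨(Real.exp_pos _).le, Real.exp_le_one_iff.2
        (neg_nonpos.2 (mul_nonneg (by positivity) (by linarith [ht.2])))⟩
    have h3 := (integral_exp_mul_le (c := 2 * r) (by positivity) 0 1).2
    have h4 := mul_le_mul_of_nonneg_left h3 hM
    linarith
  have hc := hζ.continuousOn
  set v := decayingNorm (ζ 1) with hv
  have hv0 : 0 ≤ v := decayingNorm_nonneg _
  have hback : ∀ x ∈ Icc (0 : ℝ) 1, ‖ζ x‖ ≤ 4 * b * v * Real.exp (r * (1 - x)) := by
    intro x hx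
    refine (hζ.norm_le_backward hr0.le hβ hβ0 hx.1 hx.2 le_rfl).trans ?_
    calc _ ≤ b * Real.exp (r * (1 - x)) * (4 * v) := by gcongr
      _ = _ := by ring
  have hgrow : ∀ x ∈ Icc (0 : ℝ) 1, growingNorm (ζ x) ≤
      4 * v * Real.exp (r * (1 - x)) * (Real.exp (-(2 * r * (1 - x))) + b * δ) := by
    intro x hx
    have main : ∀ j : Fin 4, j < 2 → ‖ζ x j‖ ≤
        4 * v * Real.exp (r * (1 - x)) * (Real.exp (-(2 * r * (1 - x))) + b * δ) := by
      intro j hj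
      refine (hζ.norm_apply_le hβ j hx.1 hx.2 le_rfl).2.trans ?_
      rw [re_rootsNegFour_growing hj, mul_one, mul_add]
      refine add_le_add ?_ ?_
      · calc Real.exp (-(r * (1 - x))) * ‖ζ 1 j‖ ≤ Real.exp (-(r * (1 - x))) * (4 * v) := by
              gcongr
              exact (norm_le_pi_norm _ _).trans h1
          _ = 4 * v * (Real.exp (r * (1 - x)) * Real.exp (-(2 * r * (1 - x)))) := by
              rw [← Real.exp_add, show r * (1 - x) + -(2 * r * (1 - x)) = -(r * (1 - x)) by ring]
              ring
          _ = _ := by ring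
      · calc ∫ t in x..1, β t * (Real.exp (-(r * (t - x))) * ‖ζ t‖)
            ≤ ∫ t in x..1, β t * (4 * b * v * Real.exp (r * (1 - x)) *
                Real.exp (-(2 * r * (t - x)))) := by
              refine integral_mono_kernel hβ hβ0 (ContinuousOn.mul (by fun_prop) hc.norm)
                (by fun_prop) hx.1 hx.2 le_rfl fun t ht => ?_
              calc _ ≤ Real.exp (-(r * (t - x))) * (4 * b * v * Real.exp (r * (1 - t))) := by
                    exact mul_le_mul_of_nonneg_left (hback t ⟨hx.1.trans ht.1, ht.2⟩)
                      (Real.exp_pos _).le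
                _ = 4 * b * v * (Real.exp (-(r * (t - x))) * Real.exp (r * (1 - t))) := by ring
                _ = 4 * b * v * (Real.exp (r * (1 - x)) * Real.exp (-(2 * r * (t - x)))) := by
                    rw [← Real.exp_add, ← Real.exp_add]
                    congr 2
                    ring
                _ = _ := by ring
          _ = 4 * b * v * Real.exp (r * (1 - x)) *
                ∫ t in x..1, β t * Real.exp (-(2 * r * (t - x))) := by
              rw [← intervalIntegral.integral_const_mul]
              congr 1; ext t; ring
          _ ≤ 4 * b * v * Real.exp (r * (1 - x)) * δ := by
              gcongr
              exact k1 x hx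
          _ = _ := by ring
    exact max_le (main 0 (by decide)) (main 1 (by decide))
  have hcg : ContinuousOn (fun x => growingNorm (ζ x)) (Icc 0 1) :=
    ((continuousOn_pi.1 hc 0).norm).sup ((continuousOn_pi.1 hc 1).norm)
  have hcd : ContinuousOn (fun x => decayingNorm (ζ x)) (Icc 0 1) :=
    ((continuousOn_pi.1 hc 2).norm).sup ((continuousOn_pi.1 hc 3).norm)
  have hJ : ∫ t in (0 : ℝ)..1, β t * (Real.exp (r * t) * growingNorm (ζ t)) ≤
      4 * v * Real.exp r * (δ + B * (b * δ)) := by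
    calc _ ≤ ∫ t in (0 : ℝ)..1, β t * (4 * v * Real.exp r *
            (Real.exp (-(2 * r * (1 - t))) + b * δ)) := by
          refine integral_mono_kernel hβ hβ0 (ContinuousOn.mul (by fun_prop) hcg)
            (by fun_prop) le_rfl zero_le_one le_rfl fun t ht => ?_
          calc _ ≤ Real.exp (r * t) * (4 * v * Real.exp (r * (1 - t)) *
                (Real.exp (-(2 * r * (1 - t))) + b * δ)) := by
                exact mul_le_mul_of_nonneg_left (hgrow t ht) (Real.exp_pos _).le
            _ = 4 * v * (Real.exp (r * t) * Real.exp (r * (1 - t))) *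
                (Real.exp (-(2 * r * (1 - t))) + b * δ) := by ring
            _ = _ := by rw [← Real.exp_add, show r * t + r * (1 - t) = r by ring]
      _ = 4 * v * Real.exp r * ((∫ t in (0 : ℝ)..1, β t * Real.exp (-(2 * r * (1 - t)))) +
            (∫ t in (0 : ℝ)..1, β t) * (b * δ)) := by
          rw [← intervalIntegral.integral_mul_const, ← intervalIntegral.integral_add
            (intervalIntegrable_mul_continuousOn hβ (by fun_prop)) (hβ.mul_const _),
            ← intervalIntegral.integral_const_mul]
          congr 1; ext t; ring
      _ ≤ _ := by gcongr
  have hG := gronwall_forward (f := fun y => Real.exp (r * y) * decayingNorm (ζ y)) (β := β)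
    (a := decayingNorm (ζ 0) + ∫ t in (0 : ℝ)..1, β t * (Real.exp (r * t) * growingNorm (ζ t)))
    (s := 0) (x := 1) (ContinuousOn.mul (by fun_prop) hcd) hβ hβ0
    (add_nonneg (decayingNorm_nonneg _) (intervalIntegral.integral_nonneg zero_le_one fun t _ =>
      mul_nonneg (hβ0 t) (mul_nonneg (Real.exp_pos _).le (growingNorm_nonneg _)))) le_rfl
    (fun y hy => ?_) one_mem_Icc01
  · rw [← hB, ← hb, ← hv, mul_one] at hG
    have hE : 0 < Real.exp r := Real.exp_pos r
    have hv1 : Real.exp r * v ≤ 2 * b * decayingNorm (ζ 0) := by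
      have h5 : (4 * v * Real.exp r * (δ + B * (b * δ))) * b ≤ (1 / 2) * (Real.exp r * v) := by
        have := mul_le_mul_of_nonneg_right hδ1 (mul_nonneg hE.le hv0)
        linarith
      have h6 := mul_le_mul_of_nonneg_right hJ hb0.le
      linarith
    have hd0 := decayingNorm_nonneg (ζ 0)
    constructor
    · refine (hgrow 0 zero_mem_Icc01).trans ?_
      rw [sub_zero, mul_one, mul_one]
      calc 4 * v * Real.exp r * (Real.exp (-(2 * r)) + b * δ)
          = 4 * (Real.exp r * v) * (Real.exp (-(2 * r)) + b * δ) := by ring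
        _ ≤ 4 * (2 * b * decayingNorm (ζ 0)) * (δ + b * δ) := by gcongr
        _ = 8 * b * (δ + b * δ) * decayingNorm (ζ 0) := by ring
        _ ≤ _ := by
          gcongr
    · intro x hx
      refine (hback x hx).trans ?_
      calc 4 * b * v * Real.exp (r * (1 - x)) = 4 * b * (Real.exp r * v) * Real.exp (-(r * x)) := by
            rw [show r * (1 - x) = r + -(r * x) by ring, Real.exp_add]; ring
        _ ≤ 4 * b * (2 * b * decayingNorm (ζ 0)) * Real.exp (-(r * x)) := by gcongr
        _ = _ := by ring
  · have hmain : ∀ j : Fin 4, 2 ≤ j → Real.exp (r * y) * ‖ζ y j‖ ≤ ‖ζ 0 j‖ +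
        ∫ x in (0 : ℝ)..y, β x * (Real.exp (r * x) * ‖ζ x‖) := by
      intro j hj
      have := (abs_le.1 (hζ.duhamel hβ j le_rfl hy.1 hy.2)).2
      rw [re_rootsNegFour_decaying hj] at this
      simp only [mul_neg, mul_one, neg_mul, neg_neg, mul_zero, neg_zero, Real.exp_zero, one_mul]
        at this
      linarith
    have hsplit : ∫ x in (0 : ℝ)..y, β x * (Real.exp (r * x) * ‖ζ x‖) ≤
        (∫ t in (0 : ℝ)..1, β t * (Real.exp (r * t) * growingNorm (ζ t))) +
        ∫ t in (0 : ℝ)..y, β t * (Real.exp (r * t) * decayingNorm (ζ t)) := by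
      have ig := intervalIntegrable_mul_continuousOn hβ
        (f := fun t => Real.exp (r * t) * growingNorm (ζ t)) (ContinuousOn.mul (by fun_prop) hcg)
      have i_d := intervalIntegrable_mul_continuousOn hβ
        (f := fun t => Real.exp (r * t) * decayingNorm (ζ t)) (ContinuousOn.mul (by fun_prop) hcd)
      calc _ ≤ ∫ t in (0 : ℝ)..y, β t * (Real.exp (r * t) * (growingNorm (ζ t) +
              decayingNorm (ζ t))) := by
            refine integral_mono_kernel hβ hβ0 (ContinuousOn.mul (by fun_prop) hc.norm)
              (ContinuousOn.mul (by fun_prop) (hcg.add hcd)) le_rfl hy.1 hy.2 fun t ht => ?_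
            exact mul_le_mul_of_nonneg_left (norm_le_growingNorm_add _) (Real.exp_pos _).le
        _ = (∫ t in (0 : ℝ)..y, β t * (Real.exp (r * t) * growingNorm (ζ t))) +
            ∫ t in (0 : ℝ)..y, β t * (Real.exp (r * t) * decayingNorm (ζ t)) := by
            rw [← intervalIntegral.integral_add (intervalIntegrable_sub ig zero_mem_Icc01 hy)
              (intervalIntegrable_sub i_d zero_mem_Icc01 hy)]
            congr 1; ext t; ring
        _ ≤ _ := by
            gcongr
            exact intervalIntegral.integral_mono_interval le_rfl hy.1 hy.2
              (Filter.Eventually.of_forall fun t => mul_nonneg (hβ0 t)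
                (mul_nonneg (Real.exp_pos _).le (growingNorm_nonneg _))) ig
    have h2 := hmain 2 le_rfl
    have h3 := hmain 3 (by decide)
    nth_rewrite 1 [decayingNorm]
    rw [mul_max_of_nonneg _ _ (Real.exp_pos _).le]
    have l2 : ‖ζ 0 2‖ ≤ decayingNorm (ζ 0) := le_max_left _ _
    have l3 : ‖ζ 0 3‖ ≤ decayingNorm (ζ 0) := le_max_right _ _
    exact max_le (by linarith) (by linarith)

end Dichotomy

end FourthOrder

/-! ### Coordinates along the exponents on the ray -/

namespace FourthOrder

open Complex (I)

theorem rootsNegFour_pow_four (j : Fin 4) : rootsNegFour j ^ 4 = -4 := by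
  have h2 : I ^ 2 = -1 := Complex.I_sq
  have h4 : I ^ 4 = 1 := Complex.I_pow_four
  fin_cases j <;> simp [rootsNegFour]
  · linear_combination 6 * h2 + h4 + 4 * I * h2
  · linear_combination 6 * h2 + h4 - 4 * I * h2
  · linear_combination 6 * h2 + h4 - 4 * I * h2
  · linear_combination 6 * h2 + h4 + 4 * I * h2

theorem norm_rootsNegFour_pow_four (j : Fin 4) : ‖rootsNegFour j‖ ^ 4 = 4 := by
  rw [← norm_pow, rootsNegFour_pow_four]
  simp

theorem one_le_norm_rootsNegFour (j : Fin 4) : 1 ≤ ‖rootsNegFour j‖ := by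
  by_contra! h
  have := pow_lt_one₀ (norm_nonneg _) h (n := 4) (by norm_num)
  rw [norm_rootsNegFour_pow_four] at this
  norm_num at this

/-- The vector with given coordinates in the basis `(r ω) ^ k`, `ω` a fourth root of `-4`. -/
def fromRoots (r : ℝ) (z : Fin 4 → ℂ) : Fin 4 → ℂ :=
  fun k => (r : ℂ) ^ (k : ℕ) * ∑ j, rootsNegFour j ^ (k : ℕ) * z j

/-- The coordinates in the basis `(r ω) ^ k`, `ω` a fourth root of `-4`. -/
def rootCoord (r : ℝ) (y : Fin 4 → ℂ) : Fin 4 → ℂ :=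
  fun j => -(1 / 16) * ∑ k : Fin 4, rootsNegFour j ^ (4 - (k : ℕ)) * (((r : ℂ)⁻¹) ^ (k : ℕ) * y k)

theorem sum_rootsNegFour (k l : Fin 4) : ∑ j, rootsNegFour j ^ (k : ℕ) * rootsNegFour j ^ (4 - (l : ℕ)) =
    if k = l then -16 else 0 := by
  have h2 : I ^ 2 = -1 := Complex.I_sq
  have h4 : I ^ 4 = 1 := Complex.I_pow_four
  have h6 : I ^ 6 = -1 := by rw [show 6 = 4 + 2 by rfl, pow_add, h4, h2, one_mul]
  simp only [← pow_add]
  fin_cases k <;> fin_cases l <;> simp [Fin.sum_univ_four, rootsNegFour] <;> ring_nf <;>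
    simp only [h2, h4, h6] <;> ring

theorem fromRoots_rootCoord {r : ℝ} (hr : r ≠ 0) (y : Fin 4 → ℂ) : fromRoots r (rootCoord r y) = y := by
  ext k
  have hr' : (r : ℂ) ≠ 0 := by exact_mod_cast hr
  simp only [fromRoots, rootCoord]
  have : ∀ j, rootsNegFour j ^ (k : ℕ) * (-(1 / 16) * ∑ l : Fin 4, rootsNegFour j ^ (4 - (l : ℕ)) *
      (((r : ℂ)⁻¹) ^ (l : ℕ) * y l)) = ∑ l : Fin 4, (-(1 / 16) * (((r : ℂ)⁻¹) ^ (l : ℕ) * y l)) *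
      (rootsNegFour j ^ (k : ℕ) * rootsNegFour j ^ (4 - (l : ℕ))) := fun j => by
    rw [Finset.mul_sum, Finset.mul_sum]
    exact Finset.sum_congr rfl fun l _ => by ring
  simp only [this]
  rw [Finset.sum_comm]
  simp only [← Finset.mul_sum, sum_rootsNegFour]
  simp only [mul_ite, mul_zero, Finset.sum_ite_eq, Finset.mem_univ, if_true]
  rw [inv_pow]
  field_simp

theorem rootCoord_add (r : ℝ) (y z : Fin 4 → ℂ) :
    rootCoord r (y + z) = rootCoord r y + rootCoord r z := by
  ext j
  simp only [rootCoord, Pi.add_apply, mul_add, Finset.sum_add_distrib]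

theorem rootCoord_sub (r : ℝ) (y z : Fin 4 → ℂ) :
    rootCoord r (y - z) = rootCoord r y - rootCoord r z := by
  ext j
  simp only [rootCoord, Pi.sub_apply, mul_sub, Finset.sum_sub_distrib]

theorem rootCoord_smul (r : ℝ) (c : ℂ) (y : Fin 4 → ℂ) :
    rootCoord r (c • y) = c • rootCoord r y := by
  ext j
  simp only [rootCoord, Pi.smul_apply, smul_eq_mul, Finset.mul_sum]
  exact Finset.sum_congr rfl fun k _ => by ring

theorem eq_zero_of_rootCoord {r : ℝ} (hr : r ≠ 0) {y : Fin 4 → ℂ} (h : rootCoord r y = 0) :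
    y = 0 := by
  rw [← fromRoots_rootCoord hr y, h]
  ext k
  simp [fromRoots]

theorem norm_apply_le_rootCoord {r : ℝ} (hr : 0 < r) (y : Fin 4 → ℂ) (k j : Fin 4) :
    ‖y k‖ ≤ r ^ (k : ℕ) * ‖rootsNegFour j‖ ^ (k : ℕ) * (4 * ‖rootCoord r y‖) := by
  have hn : ∀ i, ‖rootsNegFour i‖ = ‖rootsNegFour j‖ := fun i =>
    (pow_left_inj₀ (norm_nonneg _) (norm_nonneg _) (n := 4) (by norm_num)).1
      (by simp only [norm_rootsNegFour_pow_four])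
  conv_lhs => rw [← fromRoots_rootCoord hr.ne' y]
  rw [fromRoots, norm_mul, norm_pow, Complex.norm_real, Real.norm_of_nonneg hr.le, mul_assoc]
  gcongr
  refine (norm_sum_le _ _).trans ?_
  calc ∑ i, ‖rootsNegFour i ^ (k : ℕ) * rootCoord r y i‖
      ≤ ∑ _i : Fin 4, ‖rootsNegFour j‖ ^ (k : ℕ) * ‖rootCoord r y‖ := by
        refine Finset.sum_le_sum fun i _ => ?_
        rw [norm_mul, norm_pow, hn]
        gcongr
        exact norm_le_pi_norm _ _
    _ = _ := by
        simp
        ring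

/-- The form pairs only opposite exponents. In the chosen order the roots with indices `j` and `3 -
j` are opposite, so growing coordinates pair with decaying ones. -/
theorem skewForm_rootCoord {r : ℝ} (hr : r ≠ 0) (y z : Fin 4 → ℂ) :
    skewForm y z = 4 * (r : ℂ) ^ 3 *
      (rootsNegFour 0 ^ 3 * (rootCoord r y 0 * rootCoord r z 3) +
        rootsNegFour 1 ^ 3 * (rootCoord r y 1 * rootCoord r z 2) +
        rootsNegFour 2 ^ 3 * (rootCoord r y 2 * rootCoord r z 1) +
        rootsNegFour 3 ^ 3 * (rootCoord r y 3 * rootCoord r z 0)) := by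
  have h2 : I ^ 2 = -1 := Complex.I_sq
  have h3 : I ^ 3 = -I := Complex.I_pow_three
  conv_lhs => rw [← fromRoots_rootCoord hr y, ← fromRoots_rootCoord hr z]
  generalize rootCoord r y = a
  generalize rootCoord r z = b
  simp [skewForm, fromRoots, Fin.sum_univ_four, rootsNegFour]
  ring_nf
  simp only [h2, h3]
  ring

/-- The vanishing components say `∑ z_j = 0` and `∑ ω_j z_j = 0`, which express the growing
coordinates through the decaying ones independently of `r`. This is the condition at `1` required by
`exists_dichotomy`. -/
theorem norm_rootCoord_le {r : ℝ} {y : Fin 4 → ℂ} (hr : 0 < r) (h0 : y 0 = 0) (h1 : y 1 = 0) :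
    ‖rootCoord r y‖ ≤ 4 * decayingNorm (rootCoord r y) := by
  have hI : I * I = -1 := Complex.I_mul_I
  have e0 := congrFun (fromRoots_rootCoord hr.ne' y) 0
  have e1 := congrFun (fromRoots_rootCoord hr.ne' y) 1
  have hr' : (r : ℂ) ≠ 0 := by exact_mod_cast hr.ne'
  rw [h0] at e0
  rw [h1] at e1
  set z := rootCoord r y
  simp [fromRoots, Fin.sum_univ_four, rootsNegFour, hr.ne'] at e0 e1
  have z0 : z 0 = -(1 + I) * z 2 - I * z 3 := by
    linear_combination ((1 + I) / 2) * e0 - (I / 2) * e1 +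
      (-(z 0) / 2 + z 1 / 2 - z 2 / 2 + z 3 / 2 + z 0) * hI * 0 +
      (z 0 / 2 - z 1 / 2 + z 2 / 2 - z 3 / 2) * hI
  have z1 : z 1 = I * z 2 - (1 - I) * z 3 := by
    linear_combination ((1 - I) / 2) * e0 + (I / 2) * e1 -
      (z 0 / 2 - z 1 / 2 + z 2 / 2 - z 3 / 2) * hI
  have d2 : ‖z 2‖ ≤ decayingNorm z := le_max_left _ _
  have d3 : ‖z 3‖ ≤ decayingNorm z := le_max_right _ _
  have n1 : ‖(1 : ℂ) + I‖ ≤ 2 := (norm_add_le _ _).trans (by simp; norm_num)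
  have n2 : ‖(1 : ℂ) - I‖ ≤ 2 := (norm_sub_le _ _).trans (by simp; norm_num)
  have hd := decayingNorm_nonneg z
  rw [pi_norm_le_iff_of_nonneg (by positivity)]
  intro j
  fin_cases j
  · change ‖z 0‖ ≤ _
    rw [z0]
    refine (norm_sub_le _ _).trans ?_
    rw [norm_mul, norm_mul, norm_neg, Complex.norm_I]
    nlinarith [norm_nonneg (z 2)]
  · change ‖z 1‖ ≤ _
    rw [z1]
    refine (norm_sub_le _ _).trans ?_
    rw [norm_mul, norm_mul, Complex.norm_I]
    nlinarith [norm_nonneg (z 3)]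
  · change ‖z 2‖ ≤ _
    linarith
  · change ‖z 3‖ ≤ _
    linarith

section RaySystem

variable {τ₁ τ₂ : ℝ → ℂ}

theorem SquareIntegrable.integrableEntries_assocMatrix (h : SquareIntegrable τ₁ τ₂) :
    IntegrableEntries (assocMatrix τ₁ τ₂) := by
  have := h.integrableEntries 0
  unfold sysMatrix at this
  simpa using this

theorem sysMatrix_mulVec_apply (μ : ℂ) (x : ℝ) (y : Fin 4 → ℂ) (k : Fin 4) :
    (sysMatrix τ₁ τ₂ μ x).mulVec y k = ![y 1, y 2, y 3, μ * y 0] k +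
      ∑ l, (if l ≤ k then assocMatrix τ₁ τ₂ x k l else 0) * y l := by
  rw [sysMatrix_mulVec]
  fin_cases k <;>
    simp [assocMatrix, dotProduct, Fin.sum_univ_four, Fin.le_def] <;> ring

/-- The companion part of the system becomes `r` times the diagonal of the roots. The rest lives on
and below the diagonal, where the scaling factors `r ^ (l - k)`, `l ≤ k`, do not exceed one. The
factors `|ω|⁴ = 4` and `4` from the sum over the roots cancel the `1/16` of `rootCoord`. -/
theorem isDiagonalSol_rootCoord (h : SquareIntegrable τ₁ τ₂) {r : ℝ} (hr : 1 ≤ r) {Y : ℝ → Fin 4 → ℂ}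
    (hY : IsLinearSol (sysMatrix τ₁ τ₂ (-4 * (r : ℂ) ^ 4)) (fun _ => 0) Y) :
    IsDiagonalSol r (entrySum (assocMatrix τ₁ τ₂)) (fun x => rootCoord r (Y x)) := by
  have hr0 : 0 < r := by linarith
  have hr' : (r : ℂ) ≠ 0 := by exact_mod_cast hr0.ne'
  set L : ℝ → Matrix (Fin 4) (Fin 4) ℂ := fun x =>
    Matrix.of fun k l => if l ≤ k then assocMatrix τ₁ τ₂ x k l else 0 with hL
  have hLi : IntegrableEntries L := fun k l => by
    have := h.integrableEntries_assocMatrix k l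
    by_cases hkl : l ≤ k <;> simp [hL, hkl, this]
  refine ⟨fun x => rootCoord r ((L x).mulVec (Y x)), fun j => ⟨?_, ?_, fun x _ => ?_⟩⟩
  · have := fun k => hLi.mulVec_apply (fun j => (hY j).continuousOn) k
    simp only [rootCoord]
    refine ((IntervalIntegrable.sum Finset.univ (f := fun (k : Fin 4) x =>
      rootsNegFour j ^ (4 - (k : ℕ)) * (((r : ℂ)⁻¹) ^ (k : ℕ) * (L x).mulVec (Y x) k)) fun k _ =>
      ((this k).const_mul _).const_mul _).const_mul (-(1 / 16))).congr fun x _ => ?_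
    simp only [Finset.sum_apply]
  · have := (HasACDeriv.sum Finset.univ fun k _ => ((hY k).const_mul (((r : ℂ)⁻¹) ^ (k : ℕ))).const_mul
      (rootsNegFour j ^ (4 - (k : ℕ)))).const_mul (-(1 / 16))
    refine this.congr_deriv ?_
    filter_upwards with x
    have h4 := rootsNegFour_pow_four j
    have hrs : (r : ℂ) * (r : ℂ)⁻¹ = 1 := mul_inv_cancel₀ hr'
    have hLx : ∀ k, (L x).mulVec (Y x) k =
        ∑ l, (if l ≤ k then assocMatrix τ₁ τ₂ x k l else 0) * Y x l := fun k => rfl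
    simp only [sysMatrix_mulVec_apply, ← hLx, rootCoord, Pi.zero_apply, add_zero]
    generalize (L x).mulVec (Y x) = g
    generalize Y x = y
    generalize rootsNegFour j = ω at *
    generalize (r : ℂ)⁻¹ = s at *
    simp [Fin.sum_univ_four]
    linear_combination (-1 / 16) * (-(ω ^ 4 * y 1 + ω ^ 3 * s * y 2 + ω ^ 2 * s ^ 2 * y 3) -
      4 * ω * r * y 0 * ((r * s) ^ 2 + r * s + 1)) * hrs + (1 / 16) * r * ω * y 0 * h4
  · set w := ‖rootsNegFour j‖ with hw
    have hw1 : 1 ≤ w := one_le_norm_rootsNegFour j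
    have hw4 : w ^ 4 = 4 := norm_rootsNegFour_pow_four j
    have hs1 : r⁻¹ ≤ 1 := inv_le_one_of_one_le₀ hr
    have hs0 : 0 < r⁻¹ := inv_pos.2 hr0
    set Z := ‖rootCoord r (Y x)‖
    have hterm : ∀ k l : Fin 4, ‖rootsNegFour j ^ (4 - (k : ℕ)) * (((r : ℂ)⁻¹) ^ (k : ℕ) *
        (L x k l * Y x l))‖ ≤ 16 * (‖assocMatrix τ₁ τ₂ x k l‖ * Z) := by
      intro k l
      by_cases hkl : l ≤ k
      · have hkl' : (l : ℕ) ≤ k := hkl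
        have e1 : w ^ (4 - (k : ℕ)) * (r⁻¹ ^ (k : ℕ) * (r ^ (l : ℕ) * w ^ (l : ℕ))) ≤ 4 := by
          calc _ = w ^ (4 - (k : ℕ) + l) * (r⁻¹ ^ ((k : ℕ) - l) * (r⁻¹ ^ (l : ℕ) * r ^ (l : ℕ))) := by
                rw [← mul_assoc (r⁻¹ ^ ((k : ℕ) - l)), ← pow_add, Nat.sub_add_cancel hkl', pow_add]
                ring
            _ = w ^ (4 - (k : ℕ) + l) * r⁻¹ ^ ((k : ℕ) - l) := by
                rw [← mul_pow r⁻¹ r, inv_mul_cancel₀ hr0.ne', one_pow, mul_one]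
            _ ≤ w ^ 4 * 1 := by
                have hk := k.isLt
                have : 4 - (k : ℕ) + l ≤ 4 := by omega
                gcongr
                exact pow_le_one₀ hs0.le hs1
            _ = 4 := by rw [hw4, mul_one]
        have e2 := norm_apply_le_rootCoord hr0 (Y x) l j
        simp only [hL, Matrix.of_apply, if_pos hkl, norm_mul, norm_pow, norm_inv, Complex.norm_real,
          Real.norm_of_nonneg hr0.le]
        calc w ^ (4 - (k : ℕ)) * (r⁻¹ ^ (k : ℕ) * (‖assocMatrix τ₁ τ₂ x k l‖ * ‖Y x l‖))
            ≤ w ^ (4 - (k : ℕ)) * (r⁻¹ ^ (k : ℕ) * (‖assocMatrix τ₁ τ₂ x k l‖ *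
              (r ^ (l : ℕ) * w ^ (l : ℕ) * (4 * Z)))) := by gcongr
          _ = (w ^ (4 - (k : ℕ)) * (r⁻¹ ^ (k : ℕ) * (r ^ (l : ℕ) * w ^ (l : ℕ)))) *
              (4 * (‖assocMatrix τ₁ τ₂ x k l‖ * Z)) := by ring
          _ ≤ 4 * (4 * (‖assocMatrix τ₁ τ₂ x k l‖ * Z)) := by gcongr
          _ = _ := by ring
      · simp only [hL, Matrix.of_apply, if_neg hkl, zero_mul, mul_zero, norm_zero]
        positivity
    simp only [rootCoord]
    rw [norm_mul, entrySum, Finset.sum_mul]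
    have hsum : ‖∑ k : Fin 4, rootsNegFour j ^ (4 - (k : ℕ)) * (((r : ℂ)⁻¹) ^ (k : ℕ) *
        (L x).mulVec (Y x) k)‖ ≤ ∑ k : Fin 4, 16 * ((∑ l, ‖assocMatrix τ₁ τ₂ x k l‖) * Z) := by
      refine (norm_sum_le _ _).trans (Finset.sum_le_sum fun k _ => ?_)
      rw [Matrix.mulVec, dotProduct, Finset.mul_sum, Finset.mul_sum, Finset.sum_mul, Finset.mul_sum]
      exact (norm_sum_le _ _).trans (Finset.sum_le_sum fun l _ => hterm k l)
    rw [← Finset.mul_sum] at hsum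
    have : ‖(-(1 / 16) : ℂ)‖ = 1 / 16 := by rw [norm_neg]; simp
    rw [this]
    linarith

end RaySystem

end FourthOrder

/-! ### Decaying solutions on the ray -/

namespace FourthOrder

open Complex (I)
open Filter

section Decaying

variable {τ₁ τ₂ : ℝ → ℂ} (h : SquareIntegrable τ₁ τ₂)

/-- `a` is the initial value of a solution which satisfies the boundary conditions at `1`. -/
def IsDecaying (μ : ℂ) (a : Fin 4 → ℂ) : Prop :=
  (fundMatrix h 1 μ).mulVec a 0 = 0 ∧ (fundMatrix h 1 μ).mulVec a 1 = 0

/-- At `1` only components 2 and 3 survive, and the form pairs these with 0 and 1. -/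
theorem skewForm_isDecaying {μ : ℂ} {a b : Fin 4 → ℂ} (ha : IsDecaying h μ a)
    (hb : IsDecaying h μ b) : skewForm a b = 0 := by
  rw [← skewForm_fundMatrix h one_mem_Icc01 μ, skewForm, ha.1, ha.2, hb.1, hb.2]
  ring

/-- The exponential of the integral of the coefficients. -/
def coeffBound (τ₁ τ₂ : ℝ → ℂ) : ℝ :=
  Real.exp (∫ t in (0 : ℝ)..1, entrySum (assocMatrix τ₁ τ₂) t)

theorem coeffBound_pos : 0 < coeffBound τ₁ τ₂ := Real.exp_pos _

theorem isDiagonalSol_fundMatrix {r : ℝ} (hr : 1 ≤ r) (a : Fin 4 → ℂ) :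
    IsDiagonalSol r (entrySum (assocMatrix τ₁ τ₂))
      (fun x => rootCoord r ((fundMatrix h x (-4 * (r : ℂ) ^ 4)).mulVec a)) := by
  have := isDiagonalSol_rootCoord h hr (isLinearSol_sol h (-4 * (r : ℂ) ^ 4) a)
  simpa only [sol_eq_mulVec] using this

theorem norm_rootCoord_fundMatrix_le {r : ℝ} (hr : 1 ≤ r) (a : Fin 4 → ℂ) {x : ℝ}
    (hx : x ∈ Icc (0 : ℝ) 1) :
    ‖rootCoord r ((fundMatrix h x (-4 * (r : ℂ) ^ 4)).mulVec a)‖ ≤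
        coeffBound τ₁ τ₂ * Real.exp (r * x) * ‖rootCoord r a‖ ∧
      ‖rootCoord r a‖ ≤ coeffBound τ₁ τ₂ * Real.exp (r * x) *
        ‖rootCoord r ((fundMatrix h x (-4 * (r : ℂ) ^ 4)).mulVec a)‖ := by
  have hs := isDiagonalSol_fundMatrix h hr a
  have hr0 : 0 ≤ r := by linarith
  have h1 := hs.norm_le_forward hr0 h.integrableEntries_assocMatrix.entrySum (entrySum_nonneg _) hx
  have h2 := hs.norm_le_backward hr0 h.integrableEntries_assocMatrix.entrySum (entrySum_nonneg _)
    le_rfl hx.1 hx.2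
  simp only [fundMatrix_zero, Matrix.one_mulVec, sub_zero] at h1 h2
  exact ⟨h1, h2⟩

theorem exists_isDecaying_bound {ε : ℝ} (hε : 0 < ε) : ∃ R : ℝ, 1 ≤ R ∧ ∀ r ≥ R, ∀ a,
    IsDecaying h (-4 * (r : ℂ) ^ 4) a →
    growingNorm (rootCoord r a) ≤ ε * decayingNorm (rootCoord r a) ∧
    ∀ x ∈ Icc (0 : ℝ) 1, ‖rootCoord r ((fundMatrix h x (-4 * (r : ℂ) ^ 4)).mulVec a)‖ ≤
      8 * coeffBound τ₁ τ₂ ^ 2 * Real.exp (-(r * x)) * decayingNorm (rootCoord r a) := by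
  obtain ⟨R, hR⟩ := exists_dichotomy h.integrableEntries_assocMatrix.entrySum
    (entrySum_nonneg (assocMatrix τ₁ τ₂)) hε
  refine ⟨max R 1, le_max_right _ _, fun r hr a ha => ?_⟩
  have hr1 : 1 ≤ r := (le_max_right _ _).trans hr
  have := hR r ((le_max_left _ _).trans hr) _ (isDiagonalSol_fundMatrix h hr1 a)
    (norm_rootCoord_le (by linarith) ha.1 ha.2)
  simpa only [fundMatrix_zero, Matrix.one_mulVec, coeffBound] using this

/-- The linear map to the two boundary values at `1` and the two decaying coordinates at zero is
injective, by the dichotomy bound at `x = 0`, hence surjective. -/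
theorem exists_isDecaying : ∃ R : ℝ, 1 ≤ R ∧ ∀ r ≥ R, ∀ c d : ℂ, ∃ s,
    IsDecaying h (-4 * (r : ℂ) ^ 4) s ∧ rootCoord r s 2 = c ∧ rootCoord r s 3 = d := by
  obtain ⟨R, hR1, hR⟩ := exists_isDecaying_bound h one_pos
  refine ⟨R, hR1, fun r hr c d => ?_⟩
  have hr0 : r ≠ 0 := by linarith
  set T := fundMatrix h 1 (-4 * (r : ℂ) ^ 4) with hT
  set Φ : (Fin 4 → ℂ) →ₗ[ℂ] (Fin 4 → ℂ) :=
    { toFun := fun a => ![T.mulVec a 0, T.mulVec a 1, rootCoord r a 2, rootCoord r a 3]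
      map_add' := fun a b => by
        rw [Matrix.mulVec_add, rootCoord_add]; ext i; fin_cases i <;> simp
      map_smul' := fun a b => by
        rw [Matrix.mulVec_smul, rootCoord_smul]; ext i; fin_cases i <;> simp } with hΦ
  have hinj : Function.Injective Φ := by
    rw [← LinearMap.ker_eq_bot, LinearMap.ker_eq_bot']
    intro a ha
    have e : ∀ i, ![T.mulVec a 0, T.mulVec a 1, rootCoord r a 2, rootCoord r a 3] i = 0 :=
      fun i => congrFun ha i
    have hd : decayingNorm (rootCoord r a) = 0 := by
      have e2 : rootCoord r a 2 = 0 := e 2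
      have e3 : rootCoord r a 3 = 0 := e 3
      simp [decayingNorm, e2, e3]
    have hb := (hR r hr a ⟨e 0, e 1⟩).2 0 zero_mem_Icc01
    rw [hd, mul_zero, fundMatrix_zero, Matrix.one_mulVec] at hb
    exact eq_zero_of_rootCoord hr0 (norm_le_zero_iff.1 hb)
  obtain ⟨s, hs⟩ := (LinearMap.injective_iff_surjective.1 hinj) ![0, 0, c, d]
  exact ⟨s, ⟨congrFun hs 0, congrFun hs 1⟩, congrFun hs 2, congrFun hs 3⟩

end Decaying

theorem norm_rootsNegFour_pow_three_le (j : Fin 4) : ‖rootsNegFour j ^ 3‖ ≤ 4 := by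
  rw [norm_pow, ← norm_rootsNegFour_pow_four j]
  exact pow_le_pow_right₀ (one_le_norm_rootsNegFour j) (by norm_num)

theorem norm_skewForm_le {r : ℝ} (hr : 0 < r) (y z : Fin 4 → ℂ) :
    ‖skewForm y z‖ ≤ 4 * r ^ 3 * (16 * (‖rootCoord r y‖ * ‖rootCoord r z‖)) := by
  rw [skewForm_rootCoord hr.ne', norm_mul]
  have e : ‖4 * (r : ℂ) ^ 3‖ = 4 * r ^ 3 := by
    rw [norm_mul, norm_pow, Complex.norm_real, Real.norm_of_nonneg hr.le]; norm_num
  rw [e]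
  gcongr
  have hterm : ∀ i j : Fin 4, ‖rootsNegFour i ^ 3 * (rootCoord r y i * rootCoord r z j)‖ ≤
      4 * (‖rootCoord r y‖ * ‖rootCoord r z‖) := fun i j => by
    rw [norm_mul, norm_mul]
    gcongr
    · exact norm_rootsNegFour_pow_three_le i
    · exact norm_le_pi_norm _ _
    · exact norm_le_pi_norm _ _
  refine (norm_add_le _ _).trans ?_
  refine (add_le_add_left ((norm_add_le _ _).trans (add_le_add_left (norm_add_le _ _) _)) _).trans ?_
  linarith [hterm 0 3, hterm 1 2, hterm 2 1, hterm 3 0]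

/-- If the decaying solutions of two systems have the same initial values, then the solutions
with the same initial value have the same size. -/
theorem exists_norm_rootCoord_le {τ₁ τ₂ σ₁ σ₂ : ℝ → ℂ} (h : SquareIntegrable τ₁ τ₂)
    (k : SquareIntegrable σ₁ σ₂) : ∃ K R : ℝ, 0 ≤ K ∧ 1 ≤ R ∧ ∀ r ≥ R,
      (∀ a, IsDecaying h (-4 * (r : ℂ) ^ 4) a → IsDecaying k (-4 * (r : ℂ) ^ 4) a) →
      ∀ x ∈ Icc (0 : ℝ) 1, ∀ a, ‖rootCoord r ((fundMatrix h x (-4 * (r : ℂ) ^ 4)).mulVec a)‖ ≤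
        K * ‖rootCoord r ((fundMatrix k x (-4 * (r : ℂ) ^ 4)).mulVec a)‖ := by
  obtain ⟨R₁, hR₁, H₁⟩ := exists_isDecaying_bound h one_pos
  obtain ⟨R₂, hR₂, H₂⟩ := exists_isDecaying_bound k one_pos
  obtain ⟨R₃, hR₃, H₃⟩ := exists_isDecaying h
  set b := coeffBound τ₁ τ₂
  set c := coeffBound σ₁ σ₂
  have hb : 0 < b := coeffBound_pos
  have hc : 0 < c := coeffBound_pos
  refine ⟨b * (16 * (8 * c ^ 2)) + 8 * b ^ 2 * (c * (1 + c * (16 * (8 * c ^ 2)))),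
    max R₁ (max R₂ R₃), by positivity, hR₁.trans (le_max_left _ _), fun r hr hS x hx a => ?_⟩
  have hr1 : R₁ ≤ r := (le_max_left _ _).trans hr
  have hr2 : R₂ ≤ r := ((le_max_left _ _).trans (le_max_right _ _)).trans hr
  have hr3 : R₃ ≤ r := ((le_max_right _ _).trans (le_max_right _ _)).trans hr
  have hr : 1 ≤ r := hR₁.trans hr1
  have hr0 : 0 < r := by linarith
  set μ : ℂ := -4 * (r : ℂ) ^ 4
  set M := ‖rootCoord r ((fundMatrix k x μ).mulVec a)‖ with hM
  -- Splitting `a = s + n`, with `s` decaying and `n` having only growing coordinates at zero.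
  obtain ⟨s, hs, hs2, hs3⟩ := H₃ r hr3 (rootCoord r a 2) (rootCoord r a 3)
  set n := a - s with hn
  have hn2 : rootCoord r n 2 = 0 := by rw [hn, rootCoord_sub, Pi.sub_apply, hs2, sub_self]
  have hn3 : rootCoord r n 3 = 0 := by rw [hn, rootCoord_sub, Pi.sub_apply, hs3, sub_self]
  have hexp : Real.exp (r * x) * Real.exp (-(r * x)) = 1 := by rw [← Real.exp_add]; simp
  -- The size of `n` is found by pairing with decaying `φ`. Isotropy replaces `n` by `a`, and the
  -- form of the second system is conserved up to `x`, where `φ`, decaying for that system too, has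
  -- shrunk by `e^{-rx}`.
  have hφ : ∀ φ, IsDecaying h μ φ → decayingNorm (rootCoord r φ) = 1 →
      ‖skewForm n φ‖ ≤ 4 * r ^ 3 * (16 * (M * (8 * c ^ 2 * Real.exp (-(r * x))))) := by
    intro φ hφ hφ1
    have e : skewForm n φ = skewForm a φ := by
      have := skewForm_isDecaying h hs hφ
      have e2 : skewForm n φ = skewForm a φ - skewForm s φ := by
        simp only [hn, skewForm, Pi.sub_apply]; ring
      rw [e2, this, sub_zero]
    rw [e, ← skewForm_fundMatrix k hx μ]
    refine (norm_skewForm_le hr0 _ _).trans ?_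
    have := (H₂ r hr2 φ (hS φ hφ)).2 x hx
    rw [hφ1, mul_one] at this
    gcongr
  have hpos : 0 < 4 * r ^ 3 := by positivity
  have hcoef : ∀ (i : Fin 4) (z : ℂ), ‖4 * (r : ℂ) ^ 3 * (rootsNegFour i ^ 3 * z)‖ ≥
      4 * r ^ 3 * ‖z‖ := by
    intro i z
    rw [norm_mul, norm_mul, norm_mul, norm_pow, norm_pow, Complex.norm_real,
      Real.norm_of_nonneg hr0.le, Complex.norm_ofNat]
    have := one_le_pow₀ (one_le_norm_rootsNegFour i) (n := 3)
    have : ‖z‖ ≤ ‖rootsNegFour i‖ ^ 3 * ‖z‖ := le_mul_of_one_le_left (norm_nonneg _) this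
    gcongr
  obtain ⟨φ, hφS, hφ2, hφ3⟩ := H₃ r hr3 0 1
  obtain ⟨ψ, hψS, hψ2, hψ3⟩ := H₃ r hr3 1 0
  have hn0 : ‖rootCoord r n 0‖ ≤ 16 * (M * (8 * c ^ 2 * Real.exp (-(r * x)))) := by
    have h1 := hφ φ hφS (by simp [decayingNorm, hφ2, hφ3])
    rw [skewForm_rootCoord hr0.ne', hn2, hn3, hφ2, hφ3] at h1
    simp only [mul_one, mul_zero, zero_mul, add_zero] at h1
    exact le_of_mul_le_mul_left ((hcoef 0 _).trans h1) hpos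
  have hn1 : ‖rootCoord r n 1‖ ≤ 16 * (M * (8 * c ^ 2 * Real.exp (-(r * x)))) := by
    have h1 := hφ ψ hψS (by simp [decayingNorm, hψ2, hψ3])
    rw [skewForm_rootCoord hr0.ne', hn2, hn3, hψ2, hψ3] at h1
    simp only [mul_one, mul_zero, zero_mul, add_zero, zero_add] at h1
    exact le_of_mul_le_mul_left ((hcoef 1 _).trans h1) hpos
  have hM0 : 0 ≤ M := norm_nonneg _
  have hnn : ‖rootCoord r n‖ ≤ 16 * (8 * c ^ 2) * M * Real.exp (-(r * x)) := by
    rw [pi_norm_le_iff_of_nonneg (by positivity)]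
    have hz : 0 ≤ 16 * (8 * c ^ 2) * M * Real.exp (-(r * x)) := by positivity
    intro j
    fin_cases j
    · change ‖rootCoord r n 0‖ ≤ _
      linarith
    · change ‖rootCoord r n 1‖ ≤ _
      linarith
    · change ‖rootCoord r n 2‖ ≤ _
      rw [hn2, norm_zero]; exact hz
    · change ‖rootCoord r n 3‖ ≤ _
      rw [hn3, norm_zero]; exact hz
  have hgrow : ∀ {t₁ t₂ : ℝ → ℂ} (g : SquareIntegrable t₁ t₂),
      ‖rootCoord r ((fundMatrix g x μ).mulVec n)‖ ≤
        coeffBound t₁ t₂ * (16 * (8 * c ^ 2)) * M := by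
    intro t₁ t₂ g
    have hp := coeffBound_pos (τ₁ := t₁) (τ₂ := t₂)
    refine (norm_rootCoord_fundMatrix_le g hr n hx).1.trans ?_
    calc _ ≤ coeffBound t₁ t₂ * Real.exp (r * x) *
          (16 * (8 * c ^ 2) * M * Real.exp (-(r * x))) := by gcongr
      _ = coeffBound t₁ t₂ * (16 * (8 * c ^ 2)) * M *
          (Real.exp (r * x) * Real.exp (-(r * x))) := by ring
      _ = _ := by rw [hexp, mul_one]
  have has : s = a - n := by rw [hn]; abel
  have hks : ‖rootCoord r ((fundMatrix k x μ).mulVec s)‖ ≤ (1 + c * (16 * (8 * c ^ 2))) * M := by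
    rw [has, Matrix.mulVec_sub, rootCoord_sub]
    refine (norm_sub_le _ _).trans ?_
    have := hgrow k
    linarith
  -- Going back from `x` to zero in the second system costs `e^{rx}`, which the decay of `s` in the
  -- first system regains.
  have hs0 : ‖rootCoord r s‖ ≤ c * Real.exp (r * x) * ((1 + c * (16 * (8 * c ^ 2))) * M) := by
    refine (norm_rootCoord_fundMatrix_le k hr s hx).2.trans ?_
    gcongr
  have hhs : ‖rootCoord r ((fundMatrix h x μ).mulVec s)‖ ≤
      8 * b ^ 2 * (c * (1 + c * (16 * (8 * c ^ 2)))) * M := by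
    refine ((H₁ r hr1 s hs).2 x hx).trans ?_
    calc _ ≤ 8 * b ^ 2 * Real.exp (-(r * x)) *
          (c * Real.exp (r * x) * ((1 + c * (16 * (8 * c ^ 2))) * M)) := by
          gcongr
          exact (decayingNorm_le_norm _).trans hs0
      _ = 8 * b ^ 2 * (c * (1 + c * (16 * (8 * c ^ 2)))) * M *
          (Real.exp (r * x) * Real.exp (-(r * x))) := by ring
      _ = _ := by rw [hexp, mul_one]
  have han : a = n + s := by rw [hn]; abel
  calc ‖rootCoord r ((fundMatrix h x μ).mulVec a)‖
      ≤ ‖rootCoord r ((fundMatrix h x μ).mulVec n)‖ +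
        ‖rootCoord r ((fundMatrix h x μ).mulVec s)‖ := by
        conv_lhs => rw [han, Matrix.mulVec_add, rootCoord_add]
        exact norm_add_le _ _
    _ ≤ b * (16 * (8 * c ^ 2)) * M + 8 * b ^ 2 * (c * (1 + c * (16 * (8 * c ^ 2)))) * M :=
        add_le_add (hgrow h) hhs
    _ = _ := by ring

/-! ### Asymptotics of the minors on the ray -/

section Asymptotics

variable {τ₁ τ₂ : ℝ → ℂ} (h : SquareIntegrable τ₁ τ₂)

/-- Elimination of component `l` from the two boundary relations. The minors act as Plücker
coordinates of the plane of decaying initial vectors. -/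
theorem sum_minor_mul {μ : ℂ} {s : Fin 4 → ℂ} (hs : IsDecaying h μ s) (l : Fin 4) :
    ∑ k, minor h k l μ * s k = 0 := by
  have h1 := hs.1
  have h2 := hs.2
  simp only [Matrix.mulVec, dotProduct, Fin.sum_univ_four] at h1 h2 ⊢
  simp only [minor]
  linear_combination fundMatrix h 1 μ 0 l * h2 - fundMatrix h 1 μ 1 l * h1

theorem minor_self (k : Fin 4) (μ : ℂ) : minor h k k μ = 0 := by
  unfold minor; ring

theorem minor_swap (k l : Fin 4) (μ : ℂ) : minor h k l μ = -minor h l k μ := by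
  unfold minor; ring

/-- A zero of this minor gives a nonzero decaying `a` with components 2 and 3 zero. For such `a` the
decaying coordinates are at most three times the growing ones, while the dichotomy makes the growing
ones at most a sixth of the decaying ones; so `a = 0`. -/
theorem eventually_minor_ne_zero :
    ∀ᶠ r : ℝ in atTop, minor h 1 0 (-4 * (r : ℂ) ^ 4) ≠ 0 := by
  obtain ⟨R, hR1, hR⟩ := exists_isDecaying_bound h (ε := 1 / 6) (by norm_num)
  filter_upwards [eventually_ge_atTop R] with r hr h0
  have hr0 : 0 < r := by linarith
  set T := fundMatrix h 1 (-4 * (r : ℂ) ^ 4) with hT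
  obtain ⟨v, hv, hTv⟩ := Matrix.exists_mulVec_eq_zero_iff (M := !![T 0 0, T 0 1; T 1 0, T 1 1]).2
    (by rw [Matrix.det_fin_two_of, ← h0, minor, ← hT]; ring)
  set a : Fin 4 → ℂ := ![v 0, v 1, 0, 0] with ha
  have h1 := congrFun hTv 0
  have h2 := congrFun hTv 1
  simp [Matrix.mulVec, dotProduct] at h1 h2
  have haS : IsDecaying h (-4 * (r : ℂ) ^ 4) a := by
    unfold IsDecaying
    rw [← hT]
    simpa [ha, Matrix.mulVec, dotProduct, Fin.sum_univ_four] using ⟨h1, h2⟩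
  have hg := (hR r hr a haS).1
  set z := rootCoord r a with hz
  have hcoord : ∀ j, z j = v 0 / 4 - rootsNegFour j ^ 3 * ((r : ℂ)⁻¹ * v 1) / 16 := fun j => by
    have h4 := rootsNegFour_pow_four j
    simp [hz, rootCoord, Fin.sum_univ_four, ha]
    linear_combination (-(1 / 16) * v 0) * h4
  have hI : I ^ 2 = -1 := Complex.I_sq
  have hI3 : I ^ 3 = -I := Complex.I_pow_three
  have e2 : z 2 = z 0 - I * (z 0 - z 1) := by
    simp only [hcoord, rootsNegFour]
    simp
    ring_nf
    simp only [hI, hI3, Complex.I_pow_four]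
    ring
  have e3 : z 3 = z 1 - I * (z 0 - z 1) := by
    simp only [hcoord, rootsNegFour]
    simp
    ring_nf
    simp only [hI, hI3, Complex.I_pow_four]
    ring
  have g0 : ‖z 0‖ ≤ growingNorm z := le_max_left _ _
  have g1 : ‖z 1‖ ≤ growingNorm z := le_max_right _ _
  have hb : ‖I * (z 0 - z 1)‖ ≤ 2 * growingNorm z := by
    rw [norm_mul, Complex.norm_I, one_mul]
    exact (norm_sub_le _ _).trans (by linarith)
  have hd : decayingNorm z ≤ 3 * growingNorm z := by
    refine max_le ?_ ?_
    · rw [e2]; exact (norm_sub_le _ _).trans (by linarith)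
    · rw [e3]; exact (norm_sub_le _ _).trans (by linarith)
  have hg0 := growingNorm_nonneg z
  have hnorm := norm_le_growingNorm_add z
  have hz0 : z = 0 := norm_le_zero_iff.1 (by linarith)
  have ha0 := eq_zero_of_rootCoord hr0.ne' hz0
  refine hv (funext fun i => ?_)
  fin_cases i
  · exact congrFun ha0 0
  · exact congrFun ha0 1

/-- There are decaying solutions which are asymptotically exponential. -/
theorem exists_isDecaying_tendsto (c d : ℂ) : ∃ s : ℝ → Fin 4 → ℂ,
    (∀ᶠ r : ℝ in atTop, IsDecaying h (-4 * (r : ℂ) ^ 4) (s r)) ∧ ∀ k : Fin 4,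
      Tendsto (fun r : ℝ => ((r : ℂ) ^ (k : ℕ))⁻¹ * s r k) atTop
        (𝓝 (rootsNegFour 2 ^ (k : ℕ) * c + rootsNegFour 3 ^ (k : ℕ) * d)) := by
  obtain ⟨R, hR1, hR⟩ := exists_isDecaying h
  have : ∀ r : ℝ, ∃ s, R ≤ r → (IsDecaying h (-4 * (r : ℂ) ^ 4) s ∧ rootCoord r s 2 = c ∧
      rootCoord r s 3 = d) := fun r => by
    by_cases hr : R ≤ r
    · obtain ⟨s, hs⟩ := hR r hr c d
      exact ⟨s, fun _ => hs⟩
    · exact ⟨0, fun h => absurd h hr⟩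
  choose s hs using this
  have hS : ∀ᶠ r : ℝ in atTop, IsDecaying h (-4 * (r : ℂ) ^ 4) (s r) := by
    filter_upwards [eventually_ge_atTop R] with r hr using (hs r hr).1
  refine ⟨s, hS, fun k => ?_⟩
  have hg : Tendsto (fun r => growingNorm (rootCoord r (s r))) atTop (𝓝 0) := by
    rw [Metric.tendsto_atTop]
    intro ε hε
    have hm : 0 < max ‖c‖ ‖d‖ + 1 := by positivity
    obtain ⟨R', hR'1, hR'⟩ := exists_isDecaying_bound h
      (ε := ε / (2 * (max ‖c‖ ‖d‖ + 1))) (by positivity)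
    refine ⟨max R R', fun r hr => ?_⟩
    obtain ⟨h1, h2, h3⟩ := hs r ((le_max_left _ _).trans hr)
    have := (hR' r ((le_max_right _ _).trans hr) _ h1).1
    rw [decayingNorm, h2, h3] at this
    rw [Real.dist_0_eq_abs, abs_of_nonneg (growingNorm_nonneg _)]
    refine this.trans_lt ?_
    rw [div_mul_eq_mul_div, div_lt_iff₀ (by positivity)]
    nlinarith [le_max_left ‖c‖ ‖d‖, norm_nonneg c]
  have h0 : Tendsto (fun r => rootCoord r (s r) 0) atTop (𝓝 0) :=
    squeeze_zero_norm (fun r => le_max_left _ _) hg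
  have h1 : Tendsto (fun r => rootCoord r (s r) 1) atTop (𝓝 0) :=
    squeeze_zero_norm (fun r => le_max_right _ _) hg
  have hlim := (((h0.const_mul (rootsNegFour 0 ^ (k : ℕ))).add
    (h1.const_mul (rootsNegFour 1 ^ (k : ℕ)))).add
    (tendsto_const_nhds (x := rootsNegFour 2 ^ (k : ℕ) * c))).add
    (tendsto_const_nhds (x := rootsNegFour 3 ^ (k : ℕ) * d))
  simp only [mul_zero, zero_add] at hlim
  refine hlim.congr' ?_
  filter_upwards [eventually_ge_atTop R] with r hr
  obtain ⟨-, h2, h3⟩ := hs r hr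
  have hr0 : r ≠ 0 := by linarith
  have hr' : (r : ℂ) ^ (k : ℕ) ≠ 0 := pow_ne_zero _ (by exact_mod_cast hr0)
  conv_rhs => rw [← fromRoots_rootCoord hr0 (s r)]
  rw [fromRoots, inv_mul_cancel_left₀ hr', Fin.sum_univ_four, h2, h3]

/-- Two decaying solutions with components asymptotic to `(r ω) ^ k`, `ω = -1 ± i`, determine the
ratios of the minors through `sum_minor_mul` and Cramer's rule. The limits depend on the exponents
alone. -/
theorem tendsto_minor_ratios :
    Tendsto (fun r : ℝ => (r : ℂ) * (minor h 2 0 (-4 * (r : ℂ) ^ 4) /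
        minor h 1 0 (-4 * (r : ℂ) ^ 4))) atTop (𝓝 1) ∧
      Tendsto (fun r : ℝ => (r : ℂ) ^ 2 * (minor h 3 0 (-4 * (r : ℂ) ^ 4) /
        minor h 1 0 (-4 * (r : ℂ) ^ 4))) atTop (𝓝 (1 / 2)) ∧
      Tendsto (fun r : ℝ => minor h 3 1 (-4 * (r : ℂ) ^ 4) /
        minor h 1 0 (-4 * (r : ℂ) ^ 4)) atTop (𝓝 0) := by
  obtain ⟨s, hs, hsl⟩ := exists_isDecaying_tendsto h 1 0
  obtain ⟨t, ht, htl⟩ := exists_isDecaying_tendsto h 0 1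
  simp only [mul_one, mul_zero, add_zero, zero_add] at hsl htl
  set A : Fin 4 → ℝ → ℂ := fun k r => ((r : ℂ) ^ (k : ℕ))⁻¹ * s r k with hA
  set B : Fin 4 → ℝ → ℂ := fun k r => ((r : ℂ) ^ (k : ℕ))⁻¹ * t r k with hB
  have hI : I ^ 2 = -1 := Complex.I_sq
  have hI3 : I ^ 3 = -I := Complex.I_pow_three
  have lim : ∀ i j k l : Fin 4, Tendsto (fun r => A i r * B j r - A k r * B l r) atTop
      (𝓝 (rootsNegFour 2 ^ (i : ℕ) * rootsNegFour 3 ^ (j : ℕ) -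
        rootsNegFour 2 ^ (k : ℕ) * rootsNegFour 3 ^ (l : ℕ))) := fun i j k l =>
    ((hsl i).mul (htl j)).sub ((hsl k).mul (htl l))
  have hD := lim 2 3 3 2
  have hX := lim 3 1 1 3
  have hZ := lim 1 2 2 1
  have hW := lim 2 0 0 2
  have vD : rootsNegFour 2 ^ ((2 : Fin 4) : ℕ) * rootsNegFour 3 ^ ((3 : Fin 4) : ℕ) -
        rootsNegFour 2 ^ ((3 : Fin 4) : ℕ) * rootsNegFour 3 ^ ((2 : Fin 4) : ℕ) = -8 * I := by
    simp [rootsNegFour]; ring_nf; simp only [hI3, show I ^ 5 = I by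
      rw [pow_succ, Complex.I_pow_four, one_mul]]; ring
  have vX : rootsNegFour 2 ^ ((3 : Fin 4) : ℕ) * rootsNegFour 3 ^ ((1 : Fin 4) : ℕ) -
        rootsNegFour 2 ^ ((1 : Fin 4) : ℕ) * rootsNegFour 3 ^ ((3 : Fin 4) : ℕ) = -8 * I := by
    simp [rootsNegFour]; ring_nf; simp only [hI3]; ring
  have vZ : rootsNegFour 2 ^ ((1 : Fin 4) : ℕ) * rootsNegFour 3 ^ ((2 : Fin 4) : ℕ) -
        rootsNegFour 2 ^ ((2 : Fin 4) : ℕ) * rootsNegFour 3 ^ ((1 : Fin 4) : ℕ) = -4 * I := by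
    simp [rootsNegFour]; ring_nf; simp only [hI3]; ring
  rw [vD] at hD
  rw [vX] at hX
  rw [vZ] at hZ
  have hI0 : (-8 * I) ≠ 0 := by simp
  have hDne : ∀ᶠ r in atTop, A 2 r * B 3 r - A 3 r * B 2 r ≠ 0 := hD.eventually_ne hI0
  have hne := eventually_minor_ne_zero h
  have key : ∀ᶠ r : ℝ in atTop, (r : ℂ) ≠ 0 ∧
      (∀ k : Fin 4, s r k = (r : ℂ) ^ (k : ℕ) * A k r) ∧
      (∀ k : Fin 4, t r k = (r : ℂ) ^ (k : ℕ) * B k r) := by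
    filter_upwards [eventually_gt_atTop (0 : ℝ)] with r hr
    have hr' : (r : ℂ) ≠ 0 := by exact_mod_cast hr.ne'
    exact ⟨hr', fun k => (mul_inv_cancel_left₀ (pow_ne_zero _ hr') _).symm,
      fun k => (mul_inv_cancel_left₀ (pow_ne_zero _ hr') _).symm⟩
  clear_value A B
  refine ⟨?_, ?_, ?_⟩
  · have := hX.div hD hI0
    rw [div_self hI0] at this
    refine this.congr' ?_
    filter_upwards [hDne, hne, key, hs, ht] with r hd hp hk h1 h2
    obtain ⟨hr, hsr, htr⟩ := hk
    have q1 := sum_minor_mul h h1 0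
    have q2 := sum_minor_mul h h2 0
    simp only [Fin.sum_univ_four, minor_self, hsr, htr] at q1 q2
    simp only [Pi.div_apply]
    rw [div_eq_iff hd, mul_div_assoc', div_mul_eq_mul_div, eq_div_iff hp]
    generalize (-4 * (r : ℂ) ^ 4 : ℂ) = ρ at *
    simp at q1 q2
    apply mul_left_cancel₀ hr
    linear_combination A 3 r * q2 - B 3 r * q1
  · have := hZ.div hD hI0
    rw [show -4 * I / (-8 * I) = 1 / 2 by rw [mul_div_mul_right _ _ Complex.I_ne_zero]; norm_num]
      at this
    refine this.congr' ?_
    filter_upwards [hDne, hne, key, hs, ht] with r hd hp hk h1 h2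
    obtain ⟨hr, hsr, htr⟩ := hk
    have q1 := sum_minor_mul h h1 0
    have q2 := sum_minor_mul h h2 0
    simp only [Fin.sum_univ_four, minor_self, hsr, htr] at q1 q2
    simp only [Pi.div_apply]
    rw [div_eq_iff hd, mul_div_assoc', div_mul_eq_mul_div, eq_div_iff hp]
    generalize (-4 * (r : ℂ) ^ 4 : ℂ) = ρ at *
    simp at q1 q2
    apply mul_left_cancel₀ hr
    linear_combination B 2 r * q1 - A 2 r * q2
  -- Components 0 and 2 carry `r²` together, components 2 and 3 carry `r⁵`; hence the factor `r⁻³`.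
  · have hr3 : Tendsto (fun r : ℝ => (((r ^ 3 : ℝ) : ℂ))⁻¹) atTop (𝓝 0) := by
      have : Tendsto (fun r : ℝ => (r ^ 3)⁻¹) atTop (𝓝 0) :=
        (tendsto_pow_atTop (n := 3) (by norm_num)).inv_tendsto_atTop
      have := (Complex.continuous_ofReal.tendsto 0).comp this
      simpa [Function.comp_def] using this
    have := hr3.mul (hW.div hD hI0)
    rw [zero_mul] at this
    refine this.congr' ?_
    filter_upwards [hDne, hne, key, hs, ht] with r hd hp hk h1 h2
    obtain ⟨hr, hsr, htr⟩ := hk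
    have q1 := sum_minor_mul h h1 1
    have q2 := sum_minor_mul h h2 1
    simp only [Fin.sum_univ_four, minor_self, hsr, htr] at q1 q2
    rw [minor_swap h 0 1] at q1 q2
    simp only [Pi.div_apply]
    rw [mul_div_assoc', div_eq_iff hd, inv_mul_eq_iff_eq_mul₀ (by push_cast; exact pow_ne_zero _ hr),
      div_mul_eq_mul_div, mul_div_assoc', eq_div_iff hp]
    simp at q1 q2 ⊢
    linear_combination B 2 r * q1 - A 2 r * q2

end Asymptotics

end FourthOrder

/-! ### Relations between the minors and the separation condition -/

namespace FourthOrder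

open Filter

theorem analyticOrderAt_ne_top_of_ne_zero {f : ℂ → ℂ} (hf : Differentiable ℂ f) {c : ℂ}
    (hc : f c ≠ 0) (z : ℂ) : analyticOrderAt f z ≠ ⊤ := by
  intro hz
  rw [analyticOrderAt_eq_top] at hz
  have := AnalyticOnNhd.eqOn_zero_of_preconnected_of_eventuallyEq_zero
    (fun w _ => hf.analyticAt w) isPreconnected_univ (mem_univ z) hz
  exact hc (this (mem_univ c))

section Minors

variable {τ₁ τ₂ : ℝ → ℂ} (h : SquareIntegrable τ₁ τ₂)

theorem differentiable_minor (k l : Fin 4) : Differentiable ℂ (minor h k l) :=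
  ((differentiable_fundMatrix h 1 1 k).mul (differentiable_fundMatrix h 1 0 l)).sub
    ((differentiable_fundMatrix h 1 1 l).mul (differentiable_fundMatrix h 1 0 k))

theorem quarterGrowth_minor (k l : Fin 4) : QuarterGrowth (minor h k l) :=
  ((quarterGrowth_fundMatrix h one_mem_Icc01 1 k).mul
    (quarterGrowth_fundMatrix h one_mem_Icc01 0 l)).sub
    ((quarterGrowth_fundMatrix h one_mem_Icc01 1 l).mul
    (quarterGrowth_fundMatrix h one_mem_Icc01 0 k))

/-- Entry `(0, 1)` of `M S Mᵀ = S`: the first two rows of `M` are orthogonal for the skew form. -/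
theorem minor_two_one (μ : ℂ) : minor h 2 1 μ = minor h 3 0 μ := by
  have := congrFun (congrFun (mul_skewMatrix_mul_transpose h one_mem_Icc01 μ) 0) 1
  simp [Matrix.mul_apply, Fin.sum_univ_four, skewMatrix] at this
  unfold minor
  linear_combination this

theorem plucker (μ : ℂ) : minor h 1 0 μ * minor h 3 2 μ - minor h 2 0 μ * minor h 3 1 μ +
    minor h 3 0 μ * minor h 2 1 μ = 0 := by
  unfold minor; ring

theorem Delta_two (μ : ℂ) : Delta τ₁ τ₂ 2 μ = minor h 1 0 μ := by
  have c3 := fun k : Fin 4 => C_spec h μ (r := 3) (by simp) (k := k) one_mem_Icc01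
  have c4 := fun k : Fin 4 => C_spec h μ (r := 4) (by simp) (k := k) one_mem_Icc01
  have a1 := c3 1
  have a0 := c3 0
  have b1 := c4 1
  have b0 := c4 0
  simp at a1 a0 b1 b0
  rw [Delta]
  change Matrix.det (Matrix.of fun s r : Fin 2 => V (2 + 1 + s) (C τ₁ τ₂ (2 + 1 + r) μ)) = _
  rw [Matrix.det_fin_two]
  simp [V, a1, a0, b1, b0, minor]

theorem Delta_three (μ : ℂ) : Delta τ₁ τ₂ 3 μ = fundMatrix h 1 μ 0 0 := by
  have b0 := C_spec h μ (r := 4) (by simp) (k := 0) one_mem_Icc01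
  simp at b0
  rw [Delta]
  change Matrix.det (Matrix.of fun s r : Fin 1 => V (3 + 1 + s) (C τ₁ τ₂ (3 + 1 + r) μ)) = _
  rw [Matrix.det_fin_one]
  simp [V, b0]

/-- If the minor 20 vanished as well, the Plücker relation with 21 = 30 would make 30 vanish. Then
`T 0 0` times row 1 equals `T 1 0` times row 0, and independence of the rows gives `T 0 0 = 0`, a
common zero of `Δ_{2,2}` and `Δ_{3,3}`. -/
theorem minor_ne_zero_of_separated (hsep : Separated τ₁ τ₂) {μ : ℂ} (h1 : minor h 1 0 μ = 0) :
    minor h 2 0 μ ≠ 0 := by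
  intro h2
  have h3 : minor h 3 0 μ = 0 := by
    have := plucker h μ
    rw [h1, h2, minor_two_one] at this
    simpa using this
  set T := fundMatrix h 1 μ with hT
  have hrow : ∀ k, T 0 0 * T 1 k = T 1 0 * T 0 k := by
    have m0 := minor_self h 0 μ
    simp only [minor, ← hT] at m0 h1 h2 h3
    intro k
    fin_cases k
    · change T 0 0 * T 1 0 = T 1 0 * T 0 0; ring
    · change T 0 0 * T 1 1 = T 1 0 * T 0 1; linear_combination h1
    · change T 0 0 * T 1 2 = T 1 0 * T 0 2; linear_combination h2
    · change T 0 0 * T 1 3 = T 1 0 * T 0 3; linear_combination h3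
  have hinv := mul_invFundMatrix h one_mem_Icc01 μ
  rw [← hT] at hinv
  have e11 := congrFun (congrFun hinv 1) 1
  have e01 := congrFun (congrFun hinv 0) 1
  rw [Matrix.mul_apply] at e11 e01
  have hT0 : T 0 0 = 0 := by
    calc T 0 0 = T 0 0 * ∑ k, T 1 k * invFundMatrix h 1 μ k 1 := by rw [e11]; simp
      _ = T 1 0 * ∑ k, T 0 k * invFundMatrix h 1 μ k 1 := by
        rw [Finset.mul_sum, Finset.mul_sum]
        exact Finset.sum_congr rfl fun k _ => by rw [← mul_assoc, hrow, mul_assoc]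
      _ = 0 := by rw [e01]; simp
  exact hsep 2 (by simp) μ ⟨by rw [Delta_two h, h1], by rw [Delta_three h, ← hT, hT0]⟩

end Minors

/-! ### Comparison of the two problems -/

section Comparison

variable {τ₁ τ₂ σ₁ σ₂ : ℝ → ℂ} (h : SquareIntegrable τ₁ τ₂) (k : SquareIntegrable σ₁ σ₂)

/-- Nonvanishing on the ray excludes infinite orders, so equal cardinals give equal orders. -/
theorem analyticOrderAt_minor_eq_of_spec {l : Fin 4} {i j : ℕ} (hl : 0 ≠ l)
    (hc : ∀ m : Fin 4, (∀ c, m ≠ ![0, l] c) ↔ (m : ℕ) = 4 - i ∨ (m : ℕ) = 4 - j) (hi : 1 ≤ i)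
    (hj : 1 ≤ j) (hs : ∀ μ : ℂ, spec τ₁ τ₂ i j μ = spec σ₁ σ₂ i j μ)
    (hh : ∀ᶠ r : ℝ in atTop, minor h l 0 (-4 * (r : ℂ) ^ 4) ≠ 0)
    (hk : ∀ᶠ r : ℝ in atTop, minor k l 0 (-4 * (r : ℂ) ^ 4) ≠ 0) (z : ℂ) :
    analyticOrderAt (minor h l 0) z = analyticOrderAt (minor k l 0) z := by
  obtain ⟨r, hr⟩ := hh.exists
  obtain ⟨r', hr'⟩ := hk.exists
  have n1 := analyticOrderAt_ne_top_of_ne_zero (differentiable_minor h l 0) hr z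
  have n2 := analyticOrderAt_ne_top_of_ne_zero (differentiable_minor k l 0) hr' z
  have he : Function.Injective ![0, l] := by
    intro a b hab
    fin_cases a <;> fin_cases b <;> simp_all
  have e1 := spec_eq_analyticOrderAt h z (e := ![0, l]) he hc hi hj n1
  have e2 := spec_eq_analyticOrderAt k z (e := ![0, l]) he hc hi hj n2
  rw [hs z, e2] at e1
  have e3 := Nat.cast_injective e1
  rw [← ENat.natCast_toNat n1, ← ENat.natCast_toNat n2]
  exact congrArg (Nat.cast : ℕ → ℕ∞) e3.symm

/-- Both sides have the same zeros, and their quotient tends to `1` on the ray because the scaled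
ratios share the nonzero limit `L`. -/
theorem minor_mul_eq {l : Fin 4} {n : ℕ} {L : ℂ} (hL0 : L ≠ 0)
    (hord1 : ∀ z, analyticOrderAt (minor h 1 0) z = analyticOrderAt (minor k 1 0) z)
    (hordl : ∀ z, analyticOrderAt (minor h l 0) z = analyticOrderAt (minor k l 0) z)
    (hh : Tendsto (fun r : ℝ => (r : ℂ) ^ n * (minor h l 0 (-4 * (r : ℂ) ^ 4) /
        minor h 1 0 (-4 * (r : ℂ) ^ 4))) atTop (𝓝 L))
    (hk : Tendsto (fun r : ℝ => (r : ℂ) ^ n * (minor k l 0 (-4 * (r : ℂ) ^ 4) /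
        minor k 1 0 (-4 * (r : ℂ) ^ 4))) atTop (𝓝 L)) (z : ℂ) :
    minor h l 0 z * minor k 1 0 z = minor k l 0 z * minor h 1 0 z := by
  have nh := eventually_minor_ne_zero h
  have nk := eventually_minor_ne_zero k
  have nkl := hk.eventually_ne hL0
  have key := eq_const_mul_of_tendsto_ray (f := fun z => minor h l 0 z * minor k 1 0 z)
    (g := fun z => minor k l 0 z * minor h 1 0 z) (L := 1)
    ((differentiable_minor h l 0).mul (differentiable_minor k 1 0))
    ((differentiable_minor k l 0).mul (differentiable_minor h 1 0))
    ((quarterGrowth_minor h l 0).mul (quarterGrowth_minor k 1 0))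
    ((quarterGrowth_minor k l 0).mul (quarterGrowth_minor h 1 0)) (fun z => ?_) ?_ ?_ z
  · simpa using key
  · change analyticOrderAt (minor k l 0 * minor h 1 0) z ≤
      analyticOrderAt (minor h l 0 * minor k 1 0) z
    rw [analyticOrderAt_mul ((differentiable_minor k l 0).analyticAt z)
      ((differentiable_minor h 1 0).analyticAt z),
      analyticOrderAt_mul ((differentiable_minor h l 0).analyticAt z)
      ((differentiable_minor k 1 0).analyticAt z), hordl, hord1]
  · filter_upwards [nh, nkl] with r h1 h2
    refine mul_ne_zero (fun h0 => h2 ?_) h1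
    rw [h0, zero_div, mul_zero]
  · have := hh.div hk hL0
    rw [div_self hL0] at this
    refine this.congr' ?_
    filter_upwards [nh, nk, nkl, eventually_gt_atTop (0 : ℝ)] with r h1 h2 h3 hr
    have hr' : (r : ℂ) ≠ 0 := by exact_mod_cast hr.ne'
    have h4 : minor k l 0 (-4 * (r : ℂ) ^ 4) ≠ 0 := fun h0 => h3 (by rw [h0, zero_div, mul_zero])
    simp only [Pi.div_apply]
    field_simp

/-- The minors of the two problems which determine the decaying solutions are proportional. -/
structure ProportionalMinors : Prop where
  two_zero : ∀ z, minor h 2 0 z * minor k 1 0 z = minor k 2 0 z * minor h 1 0 z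
  three_zero : ∀ z, minor h 3 0 z * minor k 1 0 z = minor k 3 0 z * minor h 1 0 z
  three_one : ∀ z, minor h 3 1 z * minor k 1 0 z = minor k 3 1 z * minor h 1 0 z

theorem proportionalMinors (hsep : Separated τ₁ τ₂)
    (h12 : ∀ μ : ℂ, spec τ₁ τ₂ 1 2 μ = spec σ₁ σ₂ 1 2 μ)
    (h13 : ∀ μ : ℂ, spec τ₁ τ₂ 1 3 μ = spec σ₁ σ₂ 1 3 μ)
    (h23 : ∀ μ : ℂ, spec τ₁ τ₂ 2 3 μ = spec σ₁ σ₂ 2 3 μ) : ProportionalMinors h k := by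
  have nh := eventually_minor_ne_zero h
  have nk := eventually_minor_ne_zero k
  obtain ⟨hX, hZ, hW⟩ := tendsto_minor_ratios h
  obtain ⟨kX, kZ, kW⟩ := tendsto_minor_ratios k
  have half : (1 / 2 : ℂ) ≠ 0 := by norm_num
  have nz : ∀ {t₁ t₂ : ℝ → ℂ} (g : SquareIntegrable t₁ t₂), (∀ᶠ r : ℝ in atTop,
      minor g 2 0 (-4 * (r : ℂ) ^ 4) ≠ 0) ∧ ∀ᶠ r : ℝ in atTop,
      minor g 3 0 (-4 * (r : ℂ) ^ 4) ≠ 0 := fun g =>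
    ⟨((tendsto_minor_ratios g).1.eventually_ne one_ne_zero).mono fun r hr h0 =>
      hr (by rw [h0, zero_div, mul_zero]),
      ((tendsto_minor_ratios g).2.1.eventually_ne half).mono fun r hr h0 =>
      hr (by rw [h0, zero_div, mul_zero])⟩
  have o1 := analyticOrderAt_minor_eq_of_spec h k (l := 1) (by decide) (by decide) le_rfl
    one_le_two h12 nh nk
  have o2 := analyticOrderAt_minor_eq_of_spec h k (l := 2) (by decide) (by decide) le_rfl
    (by norm_num) h13 (nz h).1 (nz k).1
  have o3 := analyticOrderAt_minor_eq_of_spec h k (l := 3) (by decide) (by decide) one_le_two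
    (by norm_num) h23 (nz h).2 (nz k).2
  have e2 := minor_mul_eq h k (l := 2) (n := 1) one_ne_zero o1 o2 (by simpa only [pow_one] using hX)
    (by simpa only [pow_one] using kX)
  have e3 := minor_mul_eq h k (l := 3) half o1 o3 hZ kZ
  refine ⟨e2, e3, fun z => ?_⟩
  have dh := differentiable_minor h
  have dk := differentiable_minor k
  have qh := quarterGrowth_minor h
  have qk := quarterGrowth_minor k
  have dN : Differentiable ℂ
      (fun z => minor h 3 1 z * minor k 1 0 z - minor k 3 1 z * minor h 1 0 z) :=
    ((dh 3 1).mul (dk 1 0)).sub ((dk 3 1).mul (dh 1 0))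
  -- The quotient below is the difference of the ratios 31/10 of the two problems. Its limit on the
  -- ray is zero, so it is enough to exclude poles.
  have key := eq_const_mul_of_tendsto_ray
    (f := fun z => minor h 3 1 z * minor k 1 0 z - minor k 3 1 z * minor h 1 0 z)
    (g := fun z => minor h 1 0 z * minor k 1 0 z) (L := 0) dN ((dh 1 0).mul (dk 1 0))
    (((qh 3 1).mul (qk 1 0)).sub ((qk 3 1).mul (qh 1 0))) ((qh 1 0).mul (qk 1 0))
    (fun w => ?_) ?_ ?_ z
  · rw [zero_mul] at key
    exact sub_eq_zero.1 key
  · have hg : analyticOrderAt (fun z => minor h 1 0 z * minor k 1 0 z) w =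
        analyticOrderAt (minor h 1 0) w + analyticOrderAt (minor k 1 0) w :=
      analyticOrderAt_mul ((dh 1 0).analyticAt w) ((dk 1 0).analyticAt w)
    by_cases h1 : minor h 1 0 w = 0
    · have h2 := minor_ne_zero_of_separated h hsep h1
      have a2 : analyticOrderAt (minor h 2 0) w = 0 :=
        ((dh 2 0).analyticAt w).analyticOrderAt_eq_zero.2 h2
      have b2 : analyticOrderAt (minor k 2 0) w = 0 := by rw [← o2, a2]
      -- Both Plücker relations, solved for the minors 31, exhibit the factor `minor h 1 0 * minor k
      -- 1 0` after multiplication by the minors 20, which do not vanish at `w`.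
      have hid : (fun z => (minor h 3 1 z * minor k 1 0 z - minor k 3 1 z * minor h 1 0 z)) *
          (minor h 2 0 * minor k 2 0) = (fun z => minor h 1 0 z * minor k 1 0 z) *
          (fun z => minor h 3 2 z * minor k 2 0 z - minor k 3 2 z * minor h 2 0 z) := by
        -- Cancelling the minor 10 gives proportionality of 20 and 30 off its zeros; the identity
        -- theorem then removes the restriction.
        have hne : ∀ z, minor h 1 0 z ≠ 0 → minor h 3 0 z * minor k 2 0 z =
            minor k 3 0 z * minor h 2 0 z := fun z hz => by
          apply mul_left_cancel₀ hz
          linear_combination minor h 2 0 z * e3 z - minor h 3 0 z * e2 z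
        have hex : ∀ z, minor h 3 0 z * minor k 2 0 z = minor k 3 0 z * minor h 2 0 z := by
          obtain ⟨r, hr⟩ := nh.exists
          have d1 : AnalyticOnNhd ℂ (fun z => minor h 3 0 z * minor k 2 0 z) univ :=
            fun z _ => ((dh 3 0).mul (dk 2 0)).analyticAt z
          have d2 : AnalyticOnNhd ℂ (fun z => minor k 3 0 z * minor h 2 0 z) univ :=
            fun z _ => ((dk 3 0).mul (dh 2 0)).analyticAt z
          have := d1.eq_of_eventuallyEq d2 (z₀ := -4 * (r : ℂ) ^ 4) (by
            filter_upwards [(dh 1 0).continuous.continuousAt.eventually_ne hr] with z hz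
            exact hne z hz)
          exact fun z => congrFun this z
        funext z
        have p1 := plucker h z
        have p2 := plucker k z
        rw [minor_two_one] at p1 p2
        simp only [Pi.mul_apply]
        linear_combination (-minor k 1 0 z * minor k 2 0 z) * p1 +
          (minor h 1 0 z * minor h 2 0 z) * p2 +
          (minor h 3 0 z * minor k 1 0 z) * hex z + (minor k 3 0 z * minor h 2 0 z) * e3 z
      have hN : AnalyticAt ℂ
          (fun z => minor h 3 1 z * minor k 1 0 z - minor k 3 1 z * minor h 1 0 z) w :=
        dN.analyticAt w
      have hG : AnalyticAt ℂ (fun z => minor h 1 0 z * minor k 1 0 z) w :=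
        ((dh 1 0).mul (dk 1 0)).analyticAt w
      have hH : AnalyticAt ℂ
          (fun z => minor h 3 2 z * minor k 2 0 z - minor k 3 2 z * minor h 2 0 z) w :=
        (((dh 3 2).mul (dk 2 0)).sub ((dk 3 2).mul (dh 2 0))).analyticAt w
      have o := congrArg (fun f => analyticOrderAt f w) hid
      change analyticOrderAt _ w = analyticOrderAt _ w at o
      rw [analyticOrderAt_mul hN (((dh 2 0).analyticAt w).mul ((dk 2 0).analyticAt w)),
        analyticOrderAt_mul ((dh 2 0).analyticAt w) ((dk 2 0).analyticAt w), a2, b2, add_zero,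
        add_zero, analyticOrderAt_mul hG hH] at o
      rw [o]
      exact le_self_add
    · have a1 : analyticOrderAt (minor h 1 0) w = 0 :=
        ((dh 1 0).analyticAt w).analyticOrderAt_eq_zero.2 h1
      rw [hg, ← o1, a1, add_zero]
      simp
  · filter_upwards [nh, nk] with r h1 h2 using mul_ne_zero h1 h2
  · have := hW.sub kW
    rw [sub_zero] at this
    refine this.congr' ?_
    filter_upwards [nh, nk] with r h1 h2
    generalize (-4 * (r : ℂ) ^ 4 : ℂ) = ρ at *
    field_simp

/-- Proportional Plücker coordinates define the same plane. Where the minor 10 is nonzero, the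
relations of `sum_minor_mul` for `l = 0, 1` already imply the two boundary conditions. -/
theorem ProportionalMinors.isDecaying (hp : ProportionalMinors h k) : ∀ᶠ r : ℝ in atTop, ∀ a,
    IsDecaying h (-4 * (r : ℂ) ^ 4) a → IsDecaying k (-4 * (r : ℂ) ^ 4) a := by
  filter_upwards [eventually_minor_ne_zero h, eventually_minor_ne_zero k] with r h1 h2 a ha
  generalize (-4 * (r : ℂ) ^ 4 : ℂ) = μ at *
  have q0 := sum_minor_mul h ha 0
  have q1 := sum_minor_mul h ha 1
  simp only [Fin.sum_univ_four, minor_self, zero_mul, zero_add, add_zero] at q0 q1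
  have s0 : minor k 1 0 μ * a 1 + minor k 2 0 μ * a 2 + minor k 3 0 μ * a 3 = 0 := by
    apply mul_left_cancel₀ h1
    linear_combination minor k 1 0 μ * q0 - a 2 * hp.two_zero μ - a 3 * hp.three_zero μ
  have s1 : minor k 0 1 μ * a 0 + minor k 2 1 μ * a 2 + minor k 3 1 μ * a 3 = 0 := by
    apply mul_left_cancel₀ h1
    rw [minor_swap h 0 1, minor_two_one] at q1
    rw [minor_swap k 0 1, minor_two_one]
    linear_combination minor k 1 0 μ * q1 - a 2 * hp.three_zero μ - a 3 * hp.three_one μ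
  have hdet : fundMatrix k 1 μ 1 1 * fundMatrix k 1 μ 0 0 -
      fundMatrix k 1 μ 1 0 * fundMatrix k 1 μ 0 1 ≠ 0 := h2
  unfold IsDecaying
  simp only [Matrix.mulVec, dotProduct, Fin.sum_univ_four]
  simp only [minor] at s0 s1
  constructor
  · apply mul_left_cancel₀ hdet
    linear_combination fundMatrix k 1 μ 0 1 * s0 - fundMatrix k 1 μ 0 0 * s1
  · apply mul_left_cancel₀ hdet
    linear_combination fundMatrix k 1 μ 1 1 * s0 - fundMatrix k 1 μ 1 0 * s1

end Comparison

end FourthOrder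

/-! ### The transition matrix between the two systems -/

namespace FourthOrder

open Filter

/-- Infinitesimal form of symplecticity; it turns the derivative of `-S Mᵀ S` into that of an
inverse matrix. -/
theorem skewMatrix_mul_transpose_mul (τ₁ τ₂ : ℝ → ℂ) (μ : ℂ) (x : ℝ) :
    skewMatrix * (sysMatrix τ₁ τ₂ μ x).transpose * skewMatrix = sysMatrix τ₁ τ₂ μ x := by
  ext i j
  fin_cases i <;> fin_cases j <;>
    simp [skewMatrix, sysMatrix, assocMatrix, Matrix.mul_apply, Matrix.vecMul, dotProduct,
      Fin.sum_univ_four]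

section InverseFundamental

variable {τ₁ τ₂ : ℝ → ℂ} (h : SquareIntegrable τ₁ τ₂)

theorem hasACDeriv_fundMatrix (μ : ℂ) (i j : Fin 4) :
    HasACDeriv (fun x => fundMatrix h x μ i j)
      (fun x => (sysMatrix τ₁ τ₂ μ x * fundMatrix h x μ) i j) := by
  refine (isLinearSol_sol h μ (Pi.single j 1) i).congr_deriv ?_
  filter_upwards with x
  rw [Matrix.mul_apply_eq_vecMul]; simp [Matrix.mulVec, Matrix.vecMul, dotProduct, fundMatrix]

theorem invFundMatrix_apply (x : ℝ) (μ : ℂ) (i j : Fin 4) : invFundMatrix h x μ i j =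
    ∑ b, ∑ a, -(skewMatrix i a * skewMatrix b j) * fundMatrix h x μ b a := by
  simp only [invFundMatrix, Matrix.neg_apply, Matrix.mul_apply, Matrix.transpose_apply,
    Finset.sum_mul, ← Finset.sum_neg_distrib]
  exact Finset.sum_congr rfl fun b _ => Finset.sum_congr rfl fun a _ => by ring

theorem hasACDeriv_invFundMatrix (μ : ℂ) (i j : Fin 4) :
    HasACDeriv (fun x => invFundMatrix h x μ i j)
      (fun x => -(invFundMatrix h x μ * sysMatrix τ₁ τ₂ μ x) i j) := by
  have h1 := HasACDeriv.sum Finset.univ fun b _ => HasACDeriv.sum Finset.univ fun a _ =>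
    (hasACDeriv_fundMatrix h μ b a).const_mul (-(skewMatrix i a * skewMatrix b j))
  simp only [← invFundMatrix_apply] at h1
  refine h1.congr_deriv ?_
  filter_upwards with x
  have e : invFundMatrix h x μ * sysMatrix τ₁ τ₂ μ x =
      skewMatrix * (sysMatrix τ₁ τ₂ μ x * fundMatrix h x μ).transpose * skewMatrix := by
    conv_lhs => rw [← skewMatrix_mul_transpose_mul]
    rw [invFundMatrix, Matrix.transpose_mul]
    simp only [Matrix.neg_mul, Matrix.mul_assoc]
    rw [← Matrix.mul_assoc skewMatrix skewMatrix, skewMatrix_mul_self]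
    simp
  rw [e]
  simp only [Matrix.mul_apply (M := skewMatrix * _), Matrix.mul_apply (M := skewMatrix),
    Matrix.transpose_apply, Finset.sum_mul, ← Finset.sum_neg_distrib]
  exact Finset.sum_congr rfl fun b _ => Finset.sum_congr rfl fun a _ => by ring

theorem differentiable_invFundMatrix (x : ℝ) (i j : Fin 4) :
    Differentiable ℂ (fun μ => invFundMatrix h x μ i j) := by
  simp only [invFundMatrix_apply]
  exact Differentiable.fun_sum fun b _ => Differentiable.fun_sum fun a _ =>
    (differentiable_fundMatrix h x b a).const_mul _

theorem quarterGrowth_invFundMatrix {x : ℝ} (hx : x ∈ Icc (0 : ℝ) 1) (i j : Fin 4) :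
    QuarterGrowth (fun μ => invFundMatrix h x μ i j) := by
  simp only [invFundMatrix_apply]
  exact QuarterGrowth.sum _ fun b _ => QuarterGrowth.sum _ fun a _ =>
    (QuarterGrowth.const _).mul (quarterGrowth_fundMatrix h hx b a)

end InverseFundamental

section Transformation

variable {τ₁ τ₂ σ₁ σ₂ : ℝ → ℂ} (h : SquareIntegrable τ₁ τ₂) (k : SquareIntegrable σ₁ σ₂)

/-- The matrix which maps the solutions of the second system to the solutions of the first. -/
def transMatrix (x : ℝ) (μ : ℂ) : Matrix (Fin 4) (Fin 4) ℂ :=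
  fundMatrix h x μ * invFundMatrix k x μ

theorem transMatrix_zero (μ : ℂ) : transMatrix h k 0 μ = 1 := by
  have := mul_invFundMatrix k zero_mem_Icc01 μ
  rw [fundMatrix_zero, one_mul] at this
  rw [transMatrix, this, fundMatrix_zero, one_mul]

theorem hasACDeriv_transMatrix (μ : ℂ) (i j : Fin 4) :
    HasACDeriv (fun x => transMatrix h k x μ i j) (fun x => (sysMatrix τ₁ τ₂ μ x *
      transMatrix h k x μ - transMatrix h k x μ * sysMatrix σ₁ σ₂ μ x) i j) := by
  have h1 := HasACDeriv.sum Finset.univ fun l _ =>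
    (hasACDeriv_fundMatrix h μ i l).mul (hasACDeriv_invFundMatrix k μ l j)
  simp only [transMatrix, Matrix.mul_apply (M := fundMatrix h _ μ)]
  refine h1.congr_deriv ?_
  filter_upwards with x
  rw [Finset.sum_add_distrib, Matrix.sub_apply, ← Matrix.mul_assoc, Matrix.mul_assoc _ _ (sysMatrix _ _ _ _),
    Matrix.mul_apply (M := _ * fundMatrix h x μ), Matrix.mul_apply (M := fundMatrix h x μ),
    sub_eq_add_neg, ← Finset.sum_neg_distrib]
  simp only [mul_neg]

theorem norm_rootCoord_single_le {r : ℝ} (hr : 0 < r) (j : Fin 4) :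
    ‖rootCoord r (Pi.single j 1)‖ ≤ (r⁻¹) ^ (j : ℕ) := by
  have hp : 0 ≤ (r⁻¹) ^ (j : ℕ) := by positivity
  rw [pi_norm_le_iff_of_nonneg hp]
  intro i
  have e : rootCoord r (Pi.single j 1) i =
      -(1 / 16) * (rootsNegFour i ^ (4 - (j : ℕ)) * ((r : ℂ)⁻¹) ^ (j : ℕ)) := by
    rw [rootCoord, Finset.sum_eq_single j]
    · simp
    · intro b _ hb
      simp [hb]
    · simp
  have h16 : ‖(-(1 / 16) : ℂ)‖ = 1 / 16 := by rw [norm_neg]; simp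
  rw [e, norm_mul, norm_mul, h16, norm_pow, norm_pow, norm_inv, Complex.norm_real,
    Real.norm_of_nonneg hr.le]
  have : ‖rootsNegFour i‖ ^ (4 - (j : ℕ)) ≤ 4 := by
    rw [← norm_rootsNegFour_pow_four i]
    exact pow_le_pow_right₀ (one_le_norm_rootsNegFour i) (by omega)
  calc 1 / 16 * (‖rootsNegFour i‖ ^ (4 - (j : ℕ)) * r⁻¹ ^ (j : ℕ))
      ≤ 1 / 16 * (4 * r⁻¹ ^ (j : ℕ)) := by gcongr
    _ ≤ _ := by linarith

/-- In `rootCoord` the matrix is bounded along the ray. The `j`-th unit vector has coordinates of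
size at most `r^{-j}`, whereas reading component 0 costs no power of `r`. The entry thus tends to
zero on the ray, and entire functions of this growth are then zero. -/
theorem transMatrix_fst_row (hS : ∀ᶠ r : ℝ in atTop, ∀ a,
    IsDecaying h (-4 * (r : ℂ) ^ 4) a → IsDecaying k (-4 * (r : ℂ) ^ 4) a) {x : ℝ}
    (hx : x ∈ Icc (0 : ℝ) 1) {j : Fin 4} (hj : j ≠ 0) (μ : ℂ) : transMatrix h k x μ 0 j = 0 := by
  obtain ⟨K, R, hK, hR, H⟩ := exists_norm_rootCoord_le h k
  have hd : Differentiable ℂ (fun μ => transMatrix h k x μ 0 j) := by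
    simp only [transMatrix, Matrix.mul_apply]
    exact Differentiable.fun_sum fun l _ =>
      (differentiable_fundMatrix h x 0 l).mul (differentiable_invFundMatrix k x l j)
  have hq : QuarterGrowth (fun μ => transMatrix h k x μ 0 j) := by
    simp only [transMatrix, Matrix.mul_apply]
    exact QuarterGrowth.sum _ fun l _ =>
      (quarterGrowth_fundMatrix h hx 0 l).mul (quarterGrowth_invFundMatrix k hx l j)
  refine hq.eq_of_tendsto_ray hd (L := 0) ?_ μ
  have hlim : Tendsto (fun r : ℝ => 4 * K * (r⁻¹) ^ (j : ℕ)) atTop (𝓝 0) := by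
    have hj' : (j : ℕ) ≠ 0 := fun h0 => hj (Fin.ext h0)
    have := ((tendsto_inv_atTop_zero (𝕜 := ℝ)).pow (j : ℕ)).const_mul (4 * K)
    simpa [hj'] using this
  refine squeeze_zero_norm' ?_ hlim
  filter_upwards [hS, eventually_ge_atTop R] with r hr hrR
  have hr0 : 0 < r := by linarith
  set ν : ℂ := -4 * (r : ℂ) ^ 4
  -- The initial vector for which the second system reaches the `j`-th unit vector at `x`; the first
  -- system then reaches column `j` of the transition matrix.
  set a := (invFundMatrix k x ν).mulVec (Pi.single j 1) with ha
  have h1 := H r hrR hr x hx a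
  rw [ha, Matrix.mulVec_mulVec, Matrix.mulVec_mulVec, mul_invFundMatrix k hx, Matrix.one_mulVec]
    at h1
  have h2 := norm_apply_le_rootCoord hr0 ((transMatrix h k x ν).mulVec (Pi.single j 1)) 0 0
  rw [Matrix.mulVec_single_one] at h2
  simp only [Fin.val_zero, pow_zero, one_mul, Matrix.col_apply] at h2
  refine h2.trans ?_
  rw [← Matrix.mulVec_single_one]
  have h3 := norm_rootCoord_single_le hr0 j
  have h4 := mul_le_mul_of_nonneg_left h3 hK
  have h5 : ‖rootCoord r ((transMatrix h k x ν).mulVec (Pi.single j 1))‖ ≤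
    K * ‖rootCoord r (Pi.single j 1)‖ := h1
  linarith

/-- In `P' = F P - P F̃` an entry that vanishes identically determines, through the units above the
diagonal, an entry of the next row. So `P` is lower triangular with equal diagonal entries, and
these are `1`. Then `P 2 1` and `P 2 0` agree almost everywhere with `σ₁ - τ₁` and `τ₂ - σ₂`. The
remaining equations give `P 2 1` derivative zero and `P 2 0` the constant derivative `P 3 0`. -/
theorem coefficients_eq (hrow : ∀ x ∈ Icc (0 : ℝ) 1, ∀ j : Fin 4, j ≠ 0 →
    transMatrix h k x 0 0 j = 0) :
    (∃ c : ℂ, ∀ᵐ x ∂(volume.restrict (Ioo (0 : ℝ) 1)), τ₁ x = σ₁ x + c) ∧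
      ∃ c d : ℂ, ∀ᵐ x ∂(volume.restrict (Ioo (0 : ℝ) 1)), τ₂ x = σ₂ x + (c + d * x) := by
  set P : ℝ → Matrix (Fin 4) (Fin 4) ℂ := fun x => transMatrix h k x 0 with hP
  have hP0 : P 0 = 1 := transMatrix_zero h k 0
  have hD : ∀ i j, HasACDeriv (fun x => P x i j)
      (fun x => (∑ l, assocMatrix τ₁ τ₂ x i l * P x l j) - ∑ l, P x i l * assocMatrix σ₁ σ₂ x l j) :=
    fun i j => (hasACDeriv_transMatrix h k 0 i j).congr_deriv (by
      filter_upwards with x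
      simp [sysMatrix, Matrix.mul_apply, hP])
  have hrow' : ∀ x ∈ Icc (0 : ℝ) 1, ∀ j : Fin 4, j ≠ 0 → P x 0 j = 0 := hrow
  clear_value P
  have hc : ∀ i j, ContinuousOn (fun x => P x i j) (Icc 0 1) := fun i j => (hD i j).continuousOn
  have hm : ∀ᵐ x ∂(volume.restrict (Ioo (0 : ℝ) 1)), x ∈ Icc (0 : ℝ) 1 := by
    filter_upwards [ae_restrict_mem measurableSet_Ioo] with x hx using Ioo_subset_Icc_self hx
  have z01 : ∀ x ∈ Icc (0 : ℝ) 1, P x 0 1 = 0 := fun x hx => hrow' x hx 1 (by decide)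
  have z02 : ∀ x ∈ Icc (0 : ℝ) 1, P x 0 2 = 0 := fun x hx => hrow' x hx 2 (by decide)
  have z03 : ∀ x ∈ Icc (0 : ℝ) 1, P x 0 3 = 0 := fun x hx => hrow' x hx 3 (by decide)
  have z12 : ∀ x ∈ Icc (0 : ℝ) 1, P x 1 2 = 0 := by
    refine eqOn_zero_of_ae (hc 1 2) ?_
    filter_upwards [(hD 0 2).ae_eq_zero z02, hm] with x hx hxm
    simpa [Fin.sum_univ_four, assocMatrix, z01 x hxm, z02 x hxm, z03 x hxm] using hx
  have z13 : ∀ x ∈ Icc (0 : ℝ) 1, P x 1 3 = 0 := by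
    refine eqOn_zero_of_ae (hc 1 3) ?_
    filter_upwards [(hD 0 3).ae_eq_zero z03, hm] with x hx hxm
    simpa [Fin.sum_univ_four, assocMatrix, z01 x hxm, z02 x hxm, z03 x hxm] using hx
  have e11 : ∀ x ∈ Icc (0 : ℝ) 1, P x 1 1 - P x 0 0 = 0 := by
    refine eqOn_zero_of_ae ((hc 1 1).sub (hc 0 0)) ?_
    filter_upwards [(hD 0 1).ae_eq_zero z01, hm] with x hx hxm
    simpa [Fin.sum_univ_four, assocMatrix, z01 x hxm, z02 x hxm, z03 x hxm] using hx
  have d00 : HasACDeriv (fun x => P x 0 0) (fun x => P x 1 0) := by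
    refine (hD 0 0).congr_deriv ?_
    filter_upwards [hm] with x hxm
    simp [Fin.sum_univ_four, assocMatrix, z01 x hxm, z02 x hxm, z03 x hxm]
  have z23 : ∀ x ∈ Icc (0 : ℝ) 1, P x 2 3 = 0 := by
    refine eqOn_zero_of_ae (hc 2 3) ?_
    filter_upwards [(hD 1 3).ae_eq_zero z13, hm] with x hx hxm
    simpa [Fin.sum_univ_four, assocMatrix, z03 x hxm, z12 x hxm, z13 x hxm] using hx
  have e22 : ∀ x ∈ Icc (0 : ℝ) 1, P x 2 2 - P x 1 1 = 0 := by
    refine eqOn_zero_of_ae ((hc 2 2).sub (hc 1 1)) ?_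
    filter_upwards [(hD 1 2).ae_eq_zero z12, hm] with x hx hxm
    simpa [Fin.sum_univ_four, assocMatrix, z02 x hxm, z12 x hxm, z13 x hxm] using hx
  have e33 : ∀ x ∈ Icc (0 : ℝ) 1, P x 3 3 - P x 2 2 = 0 := by
    refine eqOn_zero_of_ae ((hc 3 3).sub (hc 2 2)) ?_
    filter_upwards [(hD 2 3).ae_eq_zero z23, hm] with x hx hxm
    simpa [Fin.sum_univ_four, assocMatrix, z03 x hxm, z13 x hxm, z23 x hxm] using hx
  have diff : ∀ i j, (∀ x ∈ Icc (0 : ℝ) 1, P x i i - P x j j = 0) →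
      ∀ᵐ x ∂(volume.restrict (Ioo (0 : ℝ) 1)),
      ((∑ l, assocMatrix τ₁ τ₂ x i l * P x l i) - ∑ l, P x i l * assocMatrix σ₁ σ₂ x l i) -
      ((∑ l, assocMatrix τ₁ τ₂ x j l * P x l j) - ∑ l, P x j l * assocMatrix σ₁ σ₂ x l j) = 0 :=
    fun i j hij => ((hD i i).sub (hD j j)).ae_eq_zero hij
  -- The four diagonal derivatives are equal and their sum telescopes to zero, so the first one, `P
  -- 1 0`, vanishes. The weights recover the sum from the successive differences.
  have z10 : ∀ x ∈ Icc (0 : ℝ) 1, P x 1 0 = 0 := by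
    refine eqOn_zero_of_ae (hc 1 0) ?_
    filter_upwards [diff 1 0 e11, diff 2 1 e22, diff 3 2 e33, hm] with x d1 d2 d3 hxm
    have a11 := sub_eq_zero.1 (e11 x hxm)
    have a22 := sub_eq_zero.1 (e22 x hxm)
    have a33 := sub_eq_zero.1 (e33 x hxm)
    simp [Fin.sum_univ_four, assocMatrix, z01 x hxm, z02 x hxm, z03 x hxm, z12 x hxm, z13 x hxm,
      z23 x hxm, a33, a22, a11] at d1 d2 d3
    linear_combination (-3 / 4) * d1 + (-1 / 2) * d2 + (-1 / 4) * d3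
  have z00 : ∀ x ∈ Icc (0 : ℝ) 1, P x 0 0 = 1 := by
    intro x hx
    rw [HasACDeriv.eq_of_deriv_zero (d00.congr_deriv (by
      filter_upwards [hm] with x hx using z10 x hx)) hx, hP0]
    simp
  have z11 : ∀ x ∈ Icc (0 : ℝ) 1, P x 1 1 = 1 := fun x hx => by
    rw [sub_eq_zero.1 (e11 x hx), z00 x hx]
  have z22 : ∀ x ∈ Icc (0 : ℝ) 1, P x 2 2 = 1 := fun x hx => by
    rw [sub_eq_zero.1 (e22 x hx), z11 x hx]
  have z33 : ∀ x ∈ Icc (0 : ℝ) 1, P x 3 3 = 1 := fun x hx => by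
    rw [sub_eq_zero.1 (e33 x hx), z22 x hx]
  have z32 : ∀ x ∈ Icc (0 : ℝ) 1, P x 3 2 = 0 := by
    refine eqOn_zero_of_ae (hc 3 2) ?_
    filter_upwards [((hD 3 3).sub (HasACDeriv.const 1)).ae_eq_zero
      (fun x hx => by simp [z33 x hx]), hm] with x hx hxm
    simpa [Fin.sum_univ_four, assocMatrix, z03 x hxm, z13 x hxm, z23 x hxm] using hx
  have a21 : ∀ᵐ x ∂(volume.restrict (Ioo (0 : ℝ) 1)), P x 2 1 = σ₁ x - τ₁ x := by
    filter_upwards [((hD 1 1).sub (HasACDeriv.const 1)).ae_eq_zero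
      (fun x hx => by simp [z11 x hx]), hm] with x hx hxm
    simp [Fin.sum_univ_four, assocMatrix, z01 x hxm, z10 x hxm, z11 x hxm, z12 x hxm,
      z13 x hxm] at hx
    linear_combination hx
  have a20 : ∀ᵐ x ∂(volume.restrict (Ioo (0 : ℝ) 1)), P x 2 0 = τ₂ x - σ₂ x := by
    filter_upwards [(hD 1 0).ae_eq_zero z10, hm] with x hx hxm
    simp [Fin.sum_univ_four, assocMatrix, z00 x hxm, z10 x hxm, z11 x hxm, z12 x hxm,
      z13 x hxm] at hx
    linear_combination hx
  have a31 : ∀ᵐ x ∂(volume.restrict (Ioo (0 : ℝ) 1)), P x 3 1 = σ₂ x - τ₂ x := by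
    filter_upwards [(hD 3 2).ae_eq_zero z32, hm] with x hx hxm
    simp [Fin.sum_univ_four, assocMatrix, z02 x hxm, z12 x hxm, z22 x hxm, z32 x hxm,
      z33 x hxm] at hx
    linear_combination -hx
  -- After substitution all terms in the coefficients cancel, including the quadratic ones.
  have d21 : HasACDeriv (fun x => P x 2 1) (fun _ => 0) := by
    refine (hD 2 1).congr_deriv ?_
    filter_upwards [a21, a20, a31, hm] with x h1 h2 h3 hxm
    simp [Fin.sum_univ_four, assocMatrix, z01 x hxm, z11 x hxm, z22 x hxm, z23 x hxm, h1, h2, h3]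
    ring
  have d30 : HasACDeriv (fun x => P x 3 0) (fun _ => 0) := by
    refine (hD 3 0).congr_deriv ?_
    filter_upwards [a20, a31, hm] with x h2 h3 hxm
    simp [Fin.sum_univ_four, assocMatrix, z00 x hxm, z10 x hxm, z32 x hxm, z33 x hxm, h2, h3]
    ring
  have d20 : HasACDeriv (fun x => P x 2 0 - P 0 3 0 * x) (fun _ => 0) := by
    refine ((hD 2 0).sub (HasACDeriv.const_mul (P 0 3 0) (HasACDeriv.of_contDiff (f := fun x : ℝ => (x : ℂ))
      Complex.ofRealCLM.contDiff fun x => Complex.ofRealCLM.hasDerivAt))).congr_deriv ?_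
    filter_upwards [a21, a20, hm] with x h1 h2 hxm
    simp [Fin.sum_univ_four, assocMatrix, z00 x hxm, z10 x hxm, z22 x hxm, z23 x hxm, h1, h2,
      d30.eq_of_deriv_zero hxm]
    ring
  refine ⟨⟨-P 0 2 1, ?_⟩, P 0 2 0, P 0 3 0, ?_⟩
  · filter_upwards [a21, hm] with x h1 hxm
    rw [← d21.eq_of_deriv_zero hxm]
    linear_combination h1
  · filter_upwards [a20, hm] with x h1 hxm
    have := d20.eq_of_deriv_zero hxm
    simp only [Complex.ofReal_zero, mul_zero, sub_zero] at this
    linear_combination -h1 + this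

end Transformation

end FourthOrder

/-! ### Regular distributions and their derivatives -/

namespace FourthOrder

theorem locallyIntegrableOn_unitIoo {f : ℝ → ℂ} (hf : MemLp f 2 (volume.restrict (Ioo 0 1))) :
    LocallyIntegrableOn f unitIoo := by
  have : IntegrableOn f (Ioo 0 1) := hf.integrable one_le_two
  exact this.locallyIntegrableOn

theorem regularDistribution_apply {f : ℝ → ℂ} (hf : MemLp f 2 (volume.restrict (Ioo 0 1)))
    (φ : 𝓓(unitIoo, ℝ)) : regularDistribution f φ = ∫ x, φ x • f x :=
  TestFunction.integralAgainstBilinCLM_eq_integral (locallyIntegrableOn_unitIoo hf)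

theorem regularDistribution_apply_add {f g a : ℝ → ℂ}
    (hf : MemLp f 2 (volume.restrict (Ioo 0 1))) (hg : MemLp g 2 (volume.restrict (Ioo 0 1)))
    (ha : Continuous a) (h : ∀ᵐ x ∂(volume.restrict (Ioo (0 : ℝ) 1)), f x = g x + a x)
    (φ : 𝓓(unitIoo, ℝ)) :
    regularDistribution f φ = regularDistribution g φ + ∫ x, φ x • a x := by
  rw [regularDistribution_apply hf, regularDistribution_apply hg, ← integral_add]
  · refine integral_congr_ae ?_
    filter_upwards [(ae_restrict_iff' measurableSet_Ioo).1 h] with x hx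
    by_cases hxI : x ∈ Ioo (0 : ℝ) 1
    · rw [hx hxI, smul_add]
    · have : φ x = 0 := image_eq_zero_of_notMem_tsupport fun hx' => hxI (φ.tsupport_subset hx')
      simp [this]
  · exact φ.integrable_bilin (ContinuousLinearMap.lsmul ℝ ℝ) (locallyIntegrableOn_unitIoo hg)
  · exact (φ.continuous.smul ha).integrable_of_hasCompactSupport φ.hasCompactSupport.smul_right

theorem lineDerivOp_apply_real (φ : 𝓓(unitIoo, ℝ)) (x : ℝ) :
    (∂_{(1 : ℝ)} φ) x = deriv φ x := by
  rw [TestFunction.lineDerivOp_eq_lineDerivCLM ℝ, TestFunction.lineDerivCLM_apply_of_le (by simp)]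
  simp [lineDeriv, deriv_comp_const_add]

theorem hasDerivAt_testFunction (φ : 𝓓(unitIoo, ℝ)) (x : ℝ) :
    HasDerivAt φ ((∂_{(1 : ℝ)} φ) x) x := by
  rw [lineDerivOp_apply_real]
  exact (φ.contDiff.differentiable (by simp)).differentiableAt.hasDerivAt

theorem integral_lineDerivOp_smul (φ : 𝓓(unitIoo, ℝ)) {a : ℝ → ℂ} {d : ℂ}
    (ha : ∀ x, HasDerivAt a d x) :
    ∫ x, (∂_{(1 : ℝ)} φ) x • a x = -∫ x, φ x • d := by
  have hac : Continuous a := continuous_iff_continuousAt.2 fun x => (ha x).continuousAt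
  have i1 : Integrable fun x => (∂_{(1 : ℝ)} φ) x • a x :=
    ((∂_{(1 : ℝ)} φ).continuous.smul hac).integrable_of_hasCompactSupport
      (∂_{(1 : ℝ)} φ).hasCompactSupport.smul_right
  have i2 : Integrable fun x => φ x • d :=
    (φ.continuous.smul continuous_const).integrable_of_hasCompactSupport
      φ.hasCompactSupport.smul_right
  have i3 : Integrable fun x => φ x • a x :=
    (φ.continuous.smul hac).integrable_of_hasCompactSupport φ.hasCompactSupport.smul_right
  have := integral_eq_zero_of_hasDerivAt_of_integrable
    (fun x => (hasDerivAt_testFunction φ x).smul (ha x)) (i2.add i1) i3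
  rw [integral_add i2 i1] at this
  linear_combination this

theorem integral_lineDerivOp_smul_const (φ : 𝓓(unitIoo, ℝ)) (c : ℂ) :
    ∫ x, (∂_{(1 : ℝ)} φ) x • c = 0 := by
  rw [integral_lineDerivOp_smul φ (fun x => hasDerivAt_const x c)]
  simp

/-- A constant is annihilated because the derivative of a test function has integral zero. -/
theorem lineDerivOp_regularDistribution_eq {f g : ℝ → ℂ} {c : ℂ}
    (hf : MemLp f 2 (volume.restrict (Ioo 0 1))) (hg : MemLp g 2 (volume.restrict (Ioo 0 1)))
    (h : ∀ᵐ x ∂(volume.restrict (Ioo (0 : ℝ) 1)), f x = g x + c) :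
    ∂_{(1 : ℝ)} (regularDistribution f) = ∂_{(1 : ℝ)} (regularDistribution g) := by
  ext φ
  rw [Distribution.lineDerivOp_apply_apply, Distribution.lineDerivOp_apply_apply, map_neg, map_neg,
    regularDistribution_apply_add hf hg continuous_const h, integral_lineDerivOp_smul_const,
    add_zero]

/-- One integration by parts turns the affine difference into a constant tested against a
derivative. -/
theorem lineDerivOp_lineDerivOp_regularDistribution_eq {f g : ℝ → ℂ} {c d : ℂ}
    (hf : MemLp f 2 (volume.restrict (Ioo 0 1))) (hg : MemLp g 2 (volume.restrict (Ioo 0 1)))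
    (h : ∀ᵐ x ∂(volume.restrict (Ioo (0 : ℝ) 1)), f x = g x + (c + d * x)) :
    ∂_{(1 : ℝ)} (∂_{(1 : ℝ)} (regularDistribution f)) =
      ∂_{(1 : ℝ)} (∂_{(1 : ℝ)} (regularDistribution g)) := by
  have ha (x : ℝ) : HasDerivAt (fun x : ℝ => c + d * (x : ℂ)) d x := by
    simpa using (Complex.ofRealCLM.hasDerivAt (x := x)).const_mul d |>.const_add c
  ext φ
  simp only [Distribution.lineDerivOp_apply_apply, map_neg, neg_neg]
  rw [regularDistribution_apply_add hf hg (by fun_prop) h, integral_lineDerivOp_smul _ ha,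
    integral_lineDerivOp_smul_const, neg_zero, add_zero]

end FourthOrder
end

/-! ### The uniqueness theorem -/

open FourthOrder in
theorem theorem2p4
    (p q pt qt : 𝓓'(unitIoo, ℂ)) (τ₁ τ₂ σ₁ σ₂ : ℝ → ℂ)
    (hreg : IsRegularization p q τ₁ τ₂) (hregt : IsRegularization pt qt σ₁ σ₂)
    (hsep : Separated τ₁ τ₂) (hsept : Separated σ₁ σ₂)
    (h12 : ∀ μ : ℂ, spec τ₁ τ₂ 1 2 μ = spec σ₁ σ₂ 1 2 μ)
    (h13 : ∀ μ : ℂ, spec τ₁ τ₂ 1 3 μ = spec σ₁ σ₂ 1 3 μ)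
    (h23 : ∀ μ : ℂ, spec τ₁ τ₂ 2 3 μ = spec σ₁ σ₂ 2 3 μ) :
    p = pt ∧ q = qt := by
  have h := hreg.squareIntegrable
  have k := hregt.squareIntegrable
  have hp := proportionalMinors h k hsep h12 h13 h23
  -- The first row of the transition matrix vanishes off the diagonal for every spectral parameter;
  -- its value zero suffices to compare the coefficients.
  obtain ⟨⟨c, hc⟩, c', d, hd⟩ := coefficients_eq h k fun x hx j hj =>
    transMatrix_fst_row h k (ProportionalMinors.isDecaying h k hp) hx hj 0
  rw [← hreg.deriv_τ₁, ← hregt.deriv_τ₁, ← hreg.deriv_deriv_τ₂, ← hregt.deriv_deriv_τ₂]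
  exact ⟨lineDerivOp_regularDistribution_eq hreg.memLp_τ₁ hregt.memLp_τ₁ hc,
    lineDerivOp_lineDerivOp_regularDistribution_eq hreg.memLp_τ₂ hregt.memLp_τ₂ hd⟩
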